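/- Let $\alpha>-1$ and let $\mathbb{R}^2_+=\{z\in\mathbb{C}:\operatorname{Im}z>0\}$ carry the measure $dA_\alpha(z)=\frac1\pi(\alpha+1)(2\operatorname{Im}z)^\alpha\,dA(z)$, where $dA$ is Lebesgue measure. For a bounded interval $I=[a,b)\subset\mathbb{R}$ with $a<b$ let $Q_I=\{x+iy: x\in I,\ 0<y<|I|\}$, and let $c_I$ be the Euclidean centre of $Q_I$. Let $\mathcal{D}^1,\mathcal{D}^2$ be any two adjacent dyadic systems on $\mathbb{R}$: each $\mathcal{D}^j$ consists of intervals $[a,b)$ of lengths $2^k$, $k\in\mathbb{Z}$, those of any fixed length $2^k$ partition $\mathbb{R}$, and any two are nested or disjoint; and there is a constant $C$ such that every bounded interval $J=[a,b)$, $a<b$, is contained in some $I\in\mathcal{D}:=\mathcal{D}^1\cup\mathcal{D}^2$ with $|I|\le C|J|$. A weight is a measurable, a.e. positive and finite function on $\mathbb{R}^2_+$. A weight $w$ belongs to $\mathcal{B}_2$ if $$\sup_{I\in\mathcal{D}}\Big(\frac1{A_\alpha(Q_I)}\int_{Q_I}w\,dA_\alpha\Big)\Big(\frac1{A_\alpha(Q_I)}\int_{Q_I}w^{-1}\,dA_\alpha\Big)<\infty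 .$$ Write $L^2_\alpha(w)=L^2(\mathbb{R}^2_+,w\,dA_\alpha)$. Let $\mu,\lambda\in\mathcal{B}_2$, $\nu=\mu^{1/2}\lambda^{-1/2}$ and $\nu(E)=\int_E\nu\,dA_\alpha$. For a function $b$ that is locally integrable on $\mathbb{R}^2_+$ and integrable on every $Q_I$, $I\in\mathcal{D}$, with respect to $dA_\alpha$, let $$\mathrm{osc}_\nu(b,I)=\frac1{\nu(Q_I)}\int_{Q_I}|b-b_{Q_I}|\,dA_\alpha,\qquad b_{Q_I}=\frac1{A_\alpha(Q_I)}\int_{Q_I}b\,dA_\alpha .$$ Such a $b$ belongs to $\mathrm{BMOA}_\nu$ if it is holomorphic on $\mathbb{R}^2_+$ and $\sup_{I\in\mathcal{D}}\mathrm{osc}_\nu(b,I)<\infty$; it belongs to $\mathrm{VMOA}_\nu$ if moreover $$\lim_{\delta\to0^+}\ \sup_{I\in\mathcal{D},\,|I|<\delta}\mathrm{osc}_\nu(b,I)=0\qquad\text{and}\qquad \lim_{R\to\infty}\ \sup_{I\in\mathcal{D},\,|c_I|>R}\mathrm{osc}_\nu(b,I)=0 .$$ Let $$P_\alpha f(z)=i^{2+\alpha}\int_{\mathbb{R}^2_+}\frac{f(w)}{(z-\overline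 w)^{2+\alpha}}\,dA_\alpha(w),\qquad P^+_\alpha f(z)=\int_{\mathbb{R}^2_+}\frac{f(w)}{|z-\overline w|^{2+\alpha}}\,dA_\alpha(w)$$ (principal branches), and $[b,T]f=b\,Tf-T(bf)$ for $T\in\{P_\alpha,P_\alpha^+\}$. The commutator $[b,T]$ is called compact from $L^2_\alpha(\mu)$ to $L^2_\alpha(\lambda)$ if for every $f\in L^2_\alpha(\mu)$ the integrals defining $Tf(z)$ and $T(bf)(z)$ converge absolutely for almost every $z$, and $f\mapsto[b,T]f$ is a compact linear operator from $L^2_\alpha(\mu)$ to $L^2_\alpha(\lambda)$. **Theorem.** Let $\alpha>-1$, let $\mu,\lambda\in\mathcal{B}_2$, $\nu=\mu^{1/2}\lambda^{-1/2}$, and let $b\in\mathrm{BMOA}_\nu$. Then $[b,P_\alpha]$ is compact from $L^2_\alpha(\mu)$ to $L^2_\alpha(\lambda)$ if and only if $b\in\mathrm{VMOA}_\nu$; and likewise $[b,P^+_\alpha]$ is compact from $L^2_\alpha(\mu)$ to $L^2_\alpha(\lambda)$ if and only if $b\in\mathrm{VMOA}_\nu$. -/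

import Mathlib

open MeasureTheory Set Filter
open scoped ENNReal ComplexConjugate

noncomputable section

namespace BergmanCommutator

/-- The upper half plane `{z : Im z > 0}`, as a subset of `ℂ`. -/
def upperHalf : Set ℂ := {z | 0 < z.im}

/-- The measure `dA_α = (1/π) (α+1) (2 Im z)^α dA` on the upper half plane
(extended by zero to `ℂ`). -/
def areaMeasure (α : ℝ) : Measure ℂ :=
  (volume.restrict upperHalf).withDensity
    fun z => ENNReal.ofReal (1 / Real.pi * (α + 1) * (2 * z.im) ^ α)

/-- The measure `w dA_α` attached to a weight `w`. -/
def weightedMeasure (α : ℝ) (w : ℂ → ℝ) : Measure ℂ :=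
  (areaMeasure α).withDensity fun z => ENNReal.ofReal (w z)

/-- The space `L²_α(w)` of (classes of) complex functions with `∫ |f|² w dA_α < ∞`. -/
abbrev WeightedL2 (α : ℝ) (w : ℂ → ℝ) : Type := Lp ℂ 2 (weightedMeasure α w)

/-! Intervals are given by their end points: `I : ℝ × ℝ` stands for `[I.1, I.2)`. -/

/-- A dyadic system on `ℝ`: half-open intervals of lengths `2 ^ k`, `k ∈ ℤ`, such that those of any
fixed length partition `ℝ`, and any two of them are nested or disjoint. -/
structure IsDyadicSystem (𝒟 : Set (ℝ × ℝ)) : Prop where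
  length_eq : ∀ I ∈ 𝒟, ∃ k : ℤ, I.2 - I.1 = (2 : ℝ) ^ k
  partition : ∀ (k : ℤ) (x : ℝ), ∃! I : ℝ × ℝ,
    I ∈ 𝒟 ∧ I.2 - I.1 = (2 : ℝ) ^ k ∧ x ∈ Ico I.1 I.2
  nested : ∀ I ∈ 𝒟, ∀ J ∈ 𝒟, Ico I.1 I.2 ⊆ Ico J.1 J.2 ∨ Ico J.1 J.2 ⊆ Ico I.1 I.2 ∨
    Disjoint (Ico I.1 I.2) (Ico J.1 J.2)

/-- Two adjacent dyadic systems: every bounded interval is contained in an interval of comparable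
length from one of the two systems (the "1/3-trick"). -/
structure AreAdjacent (𝒟₁ 𝒟₂ : Set (ℝ × ℝ)) : Prop where
  left : IsDyadicSystem 𝒟₁
  right : IsDyadicSystem 𝒟₂
  cover : ∃ C : ℝ, ∀ a b : ℝ, a < b → ∃ I ∈ 𝒟₁ ∪ 𝒟₂,
    Ico a b ⊆ Ico I.1 I.2 ∧ I.2 - I.1 ≤ C * (b - a)

/-- The Carleson box `Q_I = {x + i y : x ∈ I, 0 < y < |I|}`. -/
def carlesonBox (I : ℝ × ℝ) : Set ℂ :=
  {z | z.re ∈ Ico I.1 I.2 ∧ z.im ∈ Ioo 0 (I.2 - I.1)}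

/-- The Euclidean centre `c_I` of the square `Q_I`. -/
def boxCenter (I : ℝ × ℝ) : ℂ := ⟨(I.1 + I.2) / 2, (I.2 - I.1) / 2⟩

/-- A weight on the upper half plane: measurable and (almost everywhere) positive and finite. -/
structure IsWeight (α : ℝ) (w : ℂ → ℝ) : Prop where
  aemeasurable : AEMeasurable w (areaMeasure α)
  pos : ∀ᵐ z ∂areaMeasure α, 0 < w z

/-- The Békollé–Bonami characteristic `[w]_{B₂}`, with averages with respect to `dA_α`. -/
def b2Const (α : ℝ) (𝒟 : Set (ℝ × ℝ)) (w : ℂ → ℝ) : ℝ≥0∞ :=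
  ⨆ I ∈ 𝒟, (⨍⁻ z in carlesonBox I, ENNReal.ofReal (w z) ∂areaMeasure α) *
    (⨍⁻ z in carlesonBox I, ENNReal.ofReal ((w z)⁻¹) ∂areaMeasure α)

/-- The dyadic Békollé–Bonami class `B₂`. -/
def MemB2 (α : ℝ) (𝒟 : Set (ℝ × ℝ)) (w : ℂ → ℝ) : Prop :=
  IsWeight α w ∧ b2Const α 𝒟 w < ⊤

/-- The weighted mean oscillation `ν(Q_I)⁻¹ ∫_{Q_I} |b - b_{Q_I}| dA_α`, where `b_{Q_I}` is the
`dA_α`-average of `b` over `Q_I` and `ν(Q_I) = ∫_{Q_I} ν dA_α`. -/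
def meanOsc (α : ℝ) (ν : ℂ → ℝ) (b : ℂ → ℂ) (I : ℝ × ℝ) : ℝ≥0∞ :=
  (∫⁻ z in carlesonBox I, ‖b z - ⨍ w in carlesonBox I, b w ∂areaMeasure α‖ₑ ∂areaMeasure α) /
    weightedMeasure α ν (carlesonBox I)

/-- `b ∈ BMO_ν`: `b` is locally integrable and integrable on the Carleson boxes (so that its
averages over them exist), and its weighted mean oscillations are bounded. -/
structure MemBMO (α : ℝ) (𝒟 : Set (ℝ × ℝ)) (ν : ℂ → ℝ) (b : ℂ → ℂ) : Prop where
  locallyIntegrable : LocallyIntegrableOn b upperHalf (areaMeasure α)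
  integrableOn_box : ∀ I ∈ 𝒟, IntegrableOn b (carlesonBox I) (areaMeasure α)
  bounded : ⨆ I ∈ 𝒟, meanOsc α ν b I < ⊤

/-- `b ∈ BMOA_ν`: a holomorphic function in `BMO_ν`. -/
def MemBMOA (α : ℝ) (𝒟 : Set (ℝ × ℝ)) (ν : ℂ → ℝ) (b : ℂ → ℂ) : Prop :=
  MemBMO α 𝒟 ν b ∧ DifferentiableOn ℂ b upperHalf

/-- `b ∈ VMO_ν`: the mean oscillation tends to `0`, uniformly, as `|I| → 0` and as
`|c_I| → ∞`. -/
structure MemVMO (α : ℝ) (𝒟 : Set (ℝ × ℝ)) (ν : ℂ → ℝ) (b : ℂ → ℂ) : Prop where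
  memBMO : MemBMO α 𝒟 ν b
  small : ∀ ε : ℝ≥0∞, 0 < ε → ∃ δ : ℝ, 0 < δ ∧
    ∀ I ∈ 𝒟, I.2 - I.1 < δ → meanOsc α ν b I ≤ ε
  far : ∀ ε : ℝ≥0∞, 0 < ε → ∃ R : ℝ,
    ∀ I ∈ 𝒟, R < ‖boxCenter I‖ → meanOsc α ν b I ≤ ε

/-- `b ∈ VMOA_ν`: a holomorphic function in `VMO_ν`. -/
def MemVMOA (α : ℝ) (𝒟 : Set (ℝ × ℝ)) (ν : ℂ → ℝ) (b : ℂ → ℂ) : Prop :=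
  MemVMO α 𝒟 ν b ∧ DifferentiableOn ℂ b upperHalf

/-- The kernel `i^{2+α} / (z - w̄)^{2+α}` of the Bergman projection `P_α` (principal branches; note that
`z - w̄` lies in the upper half plane). -/
def bergmanKernel (α : ℝ) (z w : ℂ) : ℂ :=
  Complex.I ^ (2 + α : ℂ) / (z - conj w) ^ (2 + α : ℂ)

/-- The kernel `1 / |z - w̄|^{2+α}` of the Berezin transform `P_α⁺`. -/
def berezinKernel (α : ℝ) (z w : ℂ) : ℂ :=
  ((1 / ‖z - conj w‖ ^ (2 + α) : ℝ) : ℂ)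

/-- The integral operator `T f (z) = ∫ K(z,w) f(w) dA_α(w)`. -/
def integralOp (α : ℝ) (K : ℂ → ℂ → ℂ) (f : ℂ → ℂ) (z : ℂ) : ℂ :=
  ∫ w, K z w * f w ∂areaMeasure α

/-- The commutator `[b, T] f = b T f - T (b f)`. -/
def commutator (b : ℂ → ℂ) (T : (ℂ → ℂ) → ℂ → ℂ) (f : ℂ → ℂ) : ℂ → ℂ :=
  fun z => b z * T f z - T (fun w => b w * f w) z

/-- The commutator `[b, T]`, with `T` the integral operator with kernel `K`, is compact from
`L²_α(μ)` to `L²_α(lam)`: for every `f ∈ L²_α(μ)` the integrals that define `T f` and `T (b f)`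
converge absolutely almost everywhere, and `f ↦ [b, T] f` is a compact linear operator from
`L²_α(μ)` to `L²_α(lam)`. -/
def IsCompactCommutator (α : ℝ) (μ lam : ℂ → ℝ) (b : ℂ → ℂ) (K : ℂ → ℂ → ℂ) : Prop :=
  (∀ f : WeightedL2 α μ, ∀ᵐ z ∂areaMeasure α,
    Integrable (fun w => K z w * f w) (areaMeasure α) ∧
    Integrable (fun w => K z w * (b w * f w)) (areaMeasure α)) ∧
  ∃ S : WeightedL2 α μ →L[ℂ] WeightedL2 α lam, IsCompactOperator S ∧
    ∀ f : WeightedL2 α μ, S f =ᵐ[areaMeasure α] commutator b (integralOp α K) f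

end BergmanCommutator

end

/-! Both implications pass through one condition on the derivative, `DerivVanish`: with y = Im ζ and
B_ζ = `hball ζ (8 * y)`, the quantity |b'(ζ)| y^(3+α) / ν(B_ζ) tends to 0 as ζ approaches the real
line or infinity. The corresponding bounded condition is `DerivBound`, which holds for b in BMOA_ν:
Cauchy's formula for the derivative of b - b_Q, averaged over a disc of radius y/2, bounds b'(ζ) by
the oscillation on a box Q of side comparable to y that contains B_ζ. Applied to VMOA_ν, the same
estimate gives `DerivVanish`.

The central estimate is `DerivBound.enorm_sub_mul_kerP_le`. If a measure ρ controls b' in the sense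
of `DerivBound`, then |b(z) - b(w)| |z - w̄|^(-2-α) is at most C ∫ |z - ζ̄|^(-2-α) |w - ζ̄|^(-2-α)
dρ(ζ). It is proved by joining z to w along a chain that climbs in doubling steps to height |z -
w̄|. With ρ = C₀ν the commutator is dominated by the composition P⁺ν P⁺. Since ν²λ = μ,
multiplication by ν maps L²(μ) to L²(λ), so boundedness follows once P⁺ is bounded on L²(W) for W in
B₂. That is `lintegral_opP_sq_le`: the kernel is dominated by sums over the two dyadic systems,
whose box tops are disjoint and carry a fixed part of the area, and `carleson_embedding` applies
with respect to the measures W dA and W⁻¹ dA.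

Under `DerivVanish` one may instead take ρ = εν + M·1_F dA with F compact
(`DerivVanish.exists_split`). The commutator kernel is then at most a small multiple of the kernel
of P⁺ν P⁺ plus a multiple of k(z)k(w), where k is the kernel at i and is square integrable against
the weights that occur. The second part is Hilbert–Schmidt and the first has small norm, so the
commutator is compact. The same splitting, integrated over Q × Q, bounds ∫_Q |b - b_Q| by Cεν(Q) +
CM(∫_Q k)². The last term is negligible against ν(Q) on small and on far boxes, so `DerivVanish`
also implies VMOA_ν (`DerivVanish.memVMOA`).

For necessity, the commutator is tested on the indicator of a tiny square near ζ and evaluated on a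
neighbouring square. There b(z) - b(w) is nearly -b'(ζ)ηy and the kernel is nearly y^(-2-α)K(i,i),
whence |b'(ζ)| y^(3+α) ≤ (C‖Sf‖ + ε) ν(B_ζ) for the normalised test function f
(`IsBergmanType.exists_test`). If `DerivVanish` failed, infinitely many such test functions with
disjoint supports would form an orthonormal sequence on which S is bounded below, contradicting
compactness. -/

noncomputable section

namespace BergmanCommutator

/-! ### The measure of rectangles -/

/-- The constant `2 ^ α / π` for which a Carleson box of side `h` has measure `boxConst α * h ^ (2 + α)`. -/
def boxConst (α : ℝ) : ℝ := 2 ^ α / Real.pi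

lemma boxConst_pos (α : ℝ) : 0 < boxConst α := by unfold boxConst; positivity

lemma measurableSet_upperHalf : MeasurableSet upperHalf :=
  measurableSet_lt measurable_const Complex.measurable_im

/-- The rectangle `[a, b) × (0, h)`. -/
def lowRect (a b h : ℝ) : Set ℂ := {z | z.re ∈ Ico a b ∧ z.im ∈ Ioo 0 h}

/-- The rectangle `[a, b) × [h, k)`. -/
def rect (a b h k : ℝ) : Set ℂ := {z | z.re ∈ Ico a b ∧ z.im ∈ Ico h k}

lemma measurableSet_lowRect (a b h : ℝ) : MeasurableSet (lowRect a b h) :=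
  (Complex.measurable_re measurableSet_Ico).inter (Complex.measurable_im measurableSet_Ioo)

lemma measurableSet_rect (a b h k : ℝ) : MeasurableSet (rect a b h k) :=
  (Complex.measurable_re measurableSet_Ico).inter (Complex.measurable_im measurableSet_Ico)

lemma measurableSet_carlesonBox (I : ℝ × ℝ) : MeasurableSet (carlesonBox I) :=
  measurableSet_lowRect I.1 I.2 (I.2 - I.1)

lemma lintegral_density {α : ℝ} (hα : -1 < α) {h : ℝ} (hh : 0 < h) :
    ∫⁻ y in Ioo 0 h, ENNReal.ofReal (1 / Real.pi * (α + 1) * (2 * y) ^ α) =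
      ENNReal.ofReal (boxConst α * h ^ (α + 1)) := by
  have h1 : IntervalIntegrable (fun y : ℝ => 1 / Real.pi * (α + 1) * 2 ^ α * y ^ α) volume 0 h :=
    (intervalIntegral.intervalIntegrable_rpow' hα).const_mul _
  have h2 : ∫⁻ y in Ioo 0 h, ENNReal.ofReal (1 / Real.pi * (α + 1) * (2 * y) ^ α) =
      ∫⁻ y in Ioc 0 h, ENNReal.ofReal (1 / Real.pi * (α + 1) * 2 ^ α * y ^ α) := by
    rw [setLIntegral_congr Ioo_ae_eq_Ioc]
    refine setLIntegral_congr_fun measurableSet_Ioc fun y hy => ?_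
    rw [Real.mul_rpow (by norm_num) hy.1.le]; ring_nf
  rw [h2, ← ofReal_integral_eq_lintegral_ofReal, ← intervalIntegral.integral_of_le hh.le,
    intervalIntegral.integral_const_mul, integral_rpow (Or.inl hα)]
  · congr 1
    have : α + 1 ≠ 0 := by linarith
    rw [Real.zero_rpow this]
    unfold boxConst
    field_simp
    ring
  · exact (intervalIntegrable_iff_integrableOn_Ioc_of_le hh.le).1 h1
  · refine (ae_restrict_iff' measurableSet_Ioc).2 (Eventually.of_forall fun y hy => ?_)
    have : 0 < α + 1 := by linarith
    have := hy.1
    simp only [Pi.zero_apply]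
    positivity

lemma areaMeasure_lowRect {α : ℝ} (hα : -1 < α) (a b : ℝ) {h : ℝ} (hh : 0 < h) :
    areaMeasure α (lowRect a b h) =
      ENNReal.ofReal (b - a) * ENNReal.ofReal (boxConst α * h ^ (α + 1)) := by
  have hm := measurableSet_lowRect a b h
  have hsub : lowRect a b h ∩ upperHalf = lowRect a b h :=
    inter_eq_left.2 fun z hz => hz.2.1
  rw [areaMeasure, withDensity_apply _ hm, Measure.restrict_restrict hm, hsub]
  have hpre : lowRect a b h =
      Complex.measurableEquivRealProd ⁻¹' (Ico a b ×ˢ Ioo 0 h) := by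
    ext z; rfl
  have hint := (Complex.volume_preserving_equiv_real_prod.restrict_preimage
    ((measurableSet_Ico (a := a) (b := b)).prod (measurableSet_Ioo (a := 0) (b := h)))).lintegral_comp_emb
      Complex.measurableEquivRealProd.measurableEmbedding
      (fun p : ℝ × ℝ => ENNReal.ofReal (1 / Real.pi * (α + 1) * (2 * p.2) ^ α))
  simp only [Complex.measurableEquivRealProd_apply] at hint
  rw [hpre, hint]
  rw [Measure.volume_eq_prod, ← Measure.prod_restrict, lintegral_prod]
  · simp only
    rw [lintegral_density hα hh]
    simp [mul_comm]
  · exact (by fun_prop : Measurable fun p : ℝ × ℝ =>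
      ENNReal.ofReal (1 / Real.pi * (α + 1) * (2 * p.2) ^ α)).aemeasurable

lemma areaMeasure_carlesonBox {α : ℝ} (hα : -1 < α) {I : ℝ × ℝ} (hI : I.1 < I.2) :
    areaMeasure α (carlesonBox I) = ENNReal.ofReal (boxConst α * (I.2 - I.1) ^ (2 + α)) := by
  have h0 : 0 < I.2 - I.1 := sub_pos.2 hI
  have := areaMeasure_lowRect hα I.1 I.2 h0
  rw [carlesonBox, ← lowRect, this, ← ENNReal.ofReal_mul h0.le]
  congr 1
  rw [show (2 + α) = 1 + (α + 1) by ring, Real.rpow_add h0 1 (α + 1), Real.rpow_one]; ring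

lemma areaMeasure_rect {α : ℝ} (hα : -1 < α) (a b : ℝ) {h k : ℝ} (hh : 0 < h) (hk : h ≤ k) :
    areaMeasure α (rect a b h k) =
      ENNReal.ofReal (b - a) * ENNReal.ofReal (boxConst α * (k ^ (α + 1) - h ^ (α + 1))) := by
  have hd : rect a b h k = lowRect a b k \ lowRect a b h := by
    ext z
    simp only [rect, lowRect, mem_ofPred_eq, Set.mem_sdiff, mem_Ico, mem_Ioo, not_and, not_lt]
    constructor
    · rintro ⟨h1, h2, h3⟩
      exact ⟨⟨h1, by linarith, h3⟩, fun _ _ => h2⟩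
    · rintro ⟨⟨h1, h2, h3⟩, h4⟩
      exact ⟨h1, h4 h1 h2, h3⟩
  rw [hd, measure_sdiff, areaMeasure_lowRect hα a b (hh.trans_le hk), areaMeasure_lowRect hα a b hh,
    ← ENNReal.mul_sub, ← ENNReal.ofReal_sub, mul_sub]
  · have := boxConst_pos α; positivity
  · simp
  · exact fun z hz => ⟨hz.1, hz.2.1, hz.2.2.trans_le hk⟩
  · exact (measurableSet_lowRect a b h).nullMeasurableSet
  · rw [areaMeasure_lowRect hα a b hh]; exact ENNReal.mul_ne_top (by simp) (by simp)

/-- Rectangles of Whitney type have measure comparable to `y ^ (2 + α)`. -/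
lemma areaMeasure_whitney {α : ℝ} (hα : -1 < α) (x : ℝ) {p q y : ℝ} (hp : 0 < p) (hq : 0 < q)
    (hy : 0 < y) :
    areaMeasure α (rect x (x + p * y) y (y + q * y)) =
      ENNReal.ofReal (p * boxConst α * ((1 + q) ^ (α + 1) - 1) * y ^ (2 + α)) := by
  rw [areaMeasure_rect hα _ _ hy (by nlinarith), ← ENNReal.ofReal_mul (by nlinarith)]
  congr 1
  rw [show y + q * y = (1 + q) * y by ring, Real.mul_rpow (by linarith) hy.le,
    show (2 + α) = 1 + (α + 1) by ring, Real.rpow_add hy 1 (α + 1), Real.rpow_one]; ring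

lemma whitneyConst_pos {α : ℝ} (hα : -1 < α) {p q : ℝ} (hp : 0 < p) (hq : 0 < q) :
    0 < p * boxConst α * ((1 + q) ^ (α + 1) - 1) := by
  have h1 : (1 : ℝ) < (1 + q) ^ (α + 1) := Real.one_lt_rpow (by linarith) (by linarith)
  have := boxConst_pos α
  have : 0 < (1 + q) ^ (α + 1) - 1 := by linarith
  positivity

lemma ae_mem_upperHalf (α : ℝ) : ∀ᵐ z ∂areaMeasure α, z ∈ upperHalf :=
  (withDensity_absolutelyContinuous _ _).ae_le (ae_restrict_mem measurableSet_upperHalf)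

instance (α : ℝ) : SFinite (areaMeasure α) := by
  unfold areaMeasure
  infer_instance

instance (α : ℝ) : SigmaFinite (areaMeasure α) := by
  unfold areaMeasure
  exact SigmaFinite.withDensity_ofReal _

/-! ### The quasi-distance `‖z - conj w‖` and the kernel -/

lemma norm_sub_conj_comm (z w : ℂ) : ‖z - conj w‖ = ‖w - conj z‖ := by
  rw [← Complex.norm_conj, map_sub, Complex.conj_conj, norm_sub_rev]

lemma im_add_im_le_norm_sub_conj (z w : ℂ) : z.im + w.im ≤ ‖z - conj w‖ := by
  have := (le_abs_self _).trans (Complex.abs_im_le_norm (z - conj w))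
  simpa using this

lemma abs_re_sub_le_norm_sub_conj (z w : ℂ) : |z.re - w.re| ≤ ‖z - conj w‖ := by
  simpa using Complex.abs_re_le_norm (z - conj w)

lemma norm_sub_conj_le_add_norm_sub (z ζ w : ℂ) : ‖z - conj w‖ ≤ ‖z - ζ‖ + ‖ζ - conj w‖ :=
  norm_sub_le_norm_sub_add_norm_sub z ζ (conj w)

lemma norm_sub_le_norm_sub_conj {z w : ℂ} (hz : 0 ≤ z.im) (hw : 0 ≤ w.im) :
    ‖z - w‖ ≤ ‖z - conj w‖ := by
  rw [Complex.norm_def, Complex.norm_def]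
  apply Real.sqrt_le_sqrt
  simp only [Complex.normSq_apply, Complex.sub_re, Complex.sub_im, Complex.conj_re, Complex.conj_im]
  nlinarith [mul_nonneg hz hw]

lemma norm_sub_conj_pos {z w : ℂ} (hz : 0 < z.im) (hw : 0 < w.im) : 0 < ‖z - conj w‖ :=
  (add_pos hz hw).trans_le (im_add_im_le_norm_sub_conj z w)

/-- The kernel `1 / |z - conj w| ^ (2 + α)` with values in `ℝ≥0∞`. -/
def kerP (α : ℝ) (z w : ℂ) : ℝ≥0∞ := ENNReal.ofReal (‖z - conj w‖ ^ (-(2 + α)))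

lemma kerP_comm (α : ℝ) (z w : ℂ) : kerP α z w = kerP α w z := by
  rw [kerP, kerP, norm_sub_conj_comm]

lemma measurable_kerP_uncurry (α : ℝ) : Measurable fun p : ℂ × ℂ => kerP α p.1 p.2 := by
  unfold kerP
  have : Measurable fun p : ℂ × ℂ => conj p.2 := Complex.continuous_conj.measurable.comp measurable_snd
  fun_prop

lemma measurable_kerP_right (α : ℝ) (z : ℂ) : Measurable fun w => kerP α z w := by
  unfold kerP
  have : Measurable fun w : ℂ => conj w := Complex.continuous_conj.measurable
  fun_prop

lemma kerP_ne_top (α : ℝ) (z w : ℂ) : kerP α z w ≠ ⊤ := ENNReal.ofReal_ne_top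

lemma rpow_neg_le_of_le_mul {s a b C : ℝ} (hs : 0 ≤ s) (ha : 0 < a) (hC : 0 < C)
    (h : b ≤ C * a) (hb : 0 < b) : a ^ (-s) ≤ C ^ s * b ^ (-s) := by
  have h1 : (C * a) ^ (-s) ≤ b ^ (-s) := Real.rpow_le_rpow_of_nonpos hb h (by linarith)
  rw [Real.mul_rpow hC.le ha.le] at h1
  have h2 : C ^ s * C ^ (-s) = 1 := by rw [← Real.rpow_add hC]; simp
  calc a ^ (-s) = C ^ s * (C ^ (-s) * a ^ (-s)) := by rw [← mul_assoc, h2, one_mul]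
    _ ≤ _ := by gcongr

/-- All kernel comparisons reduce to a triangle inequality for the quasi-distance: the kernel is a
negative power, so an upper bound for the distance at (z', w') is a lower bound for the kernel
there. -/
lemma kerP_le_of_le {α : ℝ} (hα : -1 < α) {z w z' w' : ℂ} (hz : 0 < z.im) (hw : 0 < w.im)
    (hz' : 0 < z'.im) (hw' : 0 < w'.im) {C : ℝ} (hC : 0 < C)
    (h : ‖z' - conj w'‖ ≤ C * ‖z - conj w‖) :
    kerP α z w ≤ ENNReal.ofReal (C ^ (2 + α)) * kerP α z' w' := by
  rw [kerP, kerP, ← ENNReal.ofReal_mul (by positivity)]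
  exact ENNReal.ofReal_le_ofReal (rpow_neg_le_of_le_mul (by linarith) (norm_sub_conj_pos hz hw) hC h
    (norm_sub_conj_pos hz' hw'))

/-! ### Dyadic systems -/

lemma IsDyadicSystem.lt {𝒟 : Set (ℝ × ℝ)} (h : IsDyadicSystem 𝒟) {I : ℝ × ℝ} (hI : I ∈ 𝒟) :
    I.1 < I.2 := by
  obtain ⟨k, hk⟩ := h.length_eq I hI
  have : (0 : ℝ) < 2 ^ k := by positivity
  linarith

lemma AreAdjacent.lt {𝒟₁ 𝒟₂ : Set (ℝ × ℝ)} (h : AreAdjacent 𝒟₁ 𝒟₂) {I : ℝ × ℝ}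
    (hI : I ∈ 𝒟₁ ∪ 𝒟₂) : I.1 < I.2 :=
  hI.elim h.left.lt h.right.lt

/-- The upper half of a Carleson box. -/
def boxTop (I : ℝ × ℝ) : Set ℂ := rect I.1 I.2 ((I.2 - I.1) / 2) (I.2 - I.1)

lemma measurableSet_boxTop (I : ℝ × ℝ) : MeasurableSet (boxTop I) := measurableSet_rect _ _ _ _

lemma boxTop_subset {I : ℝ × ℝ} (hI : I.1 < I.2) : boxTop I ⊆ carlesonBox I :=
  fun _ hz => ⟨hz.1, by have := hz.2.1; linarith, hz.2.2⟩

/-- A point of a top has height in [ℓ/2, ℓ) with ℓ a power of two, so its height determines the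
generation; within one generation the intervals partition the line. -/
lemma IsDyadicSystem.disjoint_boxTop {𝒟 : Set (ℝ × ℝ)} (h : IsDyadicSystem 𝒟) {I J : ℝ × ℝ}
    (hI : I ∈ 𝒟) (hJ : J ∈ 𝒟) (hIJ : I ≠ J) : Disjoint (boxTop I) (boxTop J) := by
  rw [Set.disjoint_left]
  intro z hz hz'
  obtain ⟨k, hk⟩ := h.length_eq I hI
  obtain ⟨l, hl⟩ := h.length_eq J hJ
  have hkl : k = l := by
    have h1 := hz.2; have h2 := hz'.2
    rw [hk] at h1; rw [hl] at h2
    have e1 : (2 : ℝ) ^ k < 2 ^ (l + 1) := by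
      rw [zpow_add₀ two_ne_zero, zpow_one]; linarith [h1.1, h2.2]
    have e2 : (2 : ℝ) ^ l < 2 ^ (k + 1) := by
      rw [zpow_add₀ two_ne_zero, zpow_one]; linarith [h2.1, h1.2]
    rw [zpow_lt_zpow_iff_right₀ one_lt_two] at e1 e2
    omega
  subst hkl
  exact hIJ ((h.partition k z.re).unique ⟨hI, hk, hz.1⟩ ⟨hJ, hl, hz'.1⟩)

/-- The tops are pairwise disjoint with nonempty interior, and the plane is separable. -/
lemma IsDyadicSystem.countable {𝒟 : Set (ℝ × ℝ)} (h : IsDyadicSystem 𝒟) : 𝒟.Countable := by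
  refine Set.PairwiseDisjoint.countable_of_nonempty_interior (s := boxTop)
    (fun I hI J hJ hIJ => h.disjoint_boxTop hI hJ hIJ) fun I hI => ?_
  have hlt := h.lt hI
  refine ⟨⟨(I.1 + I.2) / 2, (I.2 - I.1) * (3 / 4)⟩, mem_interior.2
    ⟨{z | z.re ∈ Ioo I.1 I.2 ∧ z.im ∈ Ioo ((I.2 - I.1) / 2) (I.2 - I.1)}, ?_, ?_, ?_⟩⟩
  · exact fun z hz => ⟨⟨hz.1.1.le, hz.1.2⟩, hz.2.1.le, hz.2.2⟩
  · exact (isOpen_Ioo.preimage Complex.continuous_re).inter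
      (isOpen_Ioo.preimage Complex.continuous_im)
  · refine ⟨⟨?_, ?_⟩, ?_, ?_⟩ <;> simp only <;> linarith

lemma carlesonBox_subset {I J : ℝ × ℝ} (hI : I.1 < I.2) (h : Ico I.1 I.2 ⊆ Ico J.1 J.2) :
    carlesonBox I ⊆ carlesonBox J := by
  have := (Ico_subset_Ico_iff hI).1 h
  exact fun z hz => ⟨h hz.1, hz.2.1, by have := hz.2.2; linarith⟩

lemma IsDyadicSystem.box_nested {𝒟 : Set (ℝ × ℝ)} (h : IsDyadicSystem 𝒟) {I J : ℝ × ℝ}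
    (hI : I ∈ 𝒟) (hJ : J ∈ 𝒟) : carlesonBox I ⊆ carlesonBox J ∨ carlesonBox J ⊆ carlesonBox I ∨
      Disjoint (carlesonBox I) (carlesonBox J) := by
  rcases h.nested I hI J hJ with h1 | h1 | h1
  · exact Or.inl (carlesonBox_subset (h.lt hI) h1)
  · exact Or.inr (Or.inl (carlesonBox_subset (h.lt hJ) h1))
  · refine Or.inr (Or.inr (Set.disjoint_left.2 fun z hz hz' => Set.disjoint_left.1 h1 hz.1 hz'.1))

/-- This is sparseness: the disjoint tops carry a fixed proportion of the area of their boxes. -/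
lemma areaMeasure_carlesonBox_le_boxTop {α : ℝ} (hα : -1 < α) :
    ∃ C : ℝ≥0∞, C ≠ ⊤ ∧ ∀ I : ℝ × ℝ, I.1 < I.2 →
      areaMeasure α (carlesonBox I) ≤ C * areaMeasure α (boxTop I) := by
  set c := 2 * boxConst α * ((1 + 1) ^ (α + 1) - 1) with hc
  have hc0 : 0 < c := whitneyConst_pos hα two_pos one_pos
  refine ⟨ENNReal.ofReal (boxConst α * 2 ^ (2 + α) / c), by simp, fun I hI => ?_⟩
  have h0 : 0 < (I.2 - I.1) / 2 := by linarith
  have h1 := areaMeasure_whitney hα I.1 (p := 2) (q := 1) two_pos one_pos h0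
  rw [show I.1 + 2 * ((I.2 - I.1) / 2) = I.2 by ring,
    show (I.2 - I.1) / 2 + 1 * ((I.2 - I.1) / 2) = I.2 - I.1 by ring] at h1
  have := boxConst_pos α
  rw [areaMeasure_carlesonBox hα hI, boxTop, h1, ← ENNReal.ofReal_mul (by positivity)]
  apply ENNReal.ofReal_le_ofReal
  rw [← hc, ← mul_assoc, div_mul_cancel₀ _ hc0.ne', mul_assoc, ← Real.mul_rpow two_pos.le h0.le]
  apply le_of_eq; congr 2; ring

/-- The points of the upper half plane at distance less than `r` from `conj z`. -/
def hball (z : ℂ) (r : ℝ) : Set ℂ := {w | 0 < w.im ∧ ‖z - conj w‖ < r}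

lemma measurableSet_hball (z : ℂ) (r : ℝ) : MeasurableSet (hball z r) := by
  have : Measurable fun w : ℂ => ‖z - conj w‖ := by
    have : Measurable fun w : ℂ => conj w := Complex.continuous_conj.measurable
    fun_prop
  exact measurableSet_upperHalf.inter (measurableSet_lt this measurable_const)

/-- The covering property is applied to [Re z - r, Re z + r). A point w with |z - w̄| < r has its
real part in this interval and height below r, hence lies in the box of any interval covering it. -/
lemma AreAdjacent.exists_box {𝒟₁ 𝒟₂ : Set (ℝ × ℝ)} (h : AreAdjacent 𝒟₁ 𝒟₂) :
    ∃ C : ℝ, 1 ≤ C ∧ ∀ (z : ℂ) (r : ℝ), 0 < z.im → 0 < r → ∃ I ∈ 𝒟₁ ∪ 𝒟₂,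
      hball z r ⊆ carlesonBox I ∧ 2 * r ≤ I.2 - I.1 ∧ I.2 - I.1 ≤ C * r ∧ z.re ∈ Ico I.1 I.2 := by
  obtain ⟨C, hC⟩ := h.cover
  refine ⟨max 1 (2 * C), le_max_left _ _, fun z r hz hr => ?_⟩
  obtain ⟨I, hI, h1, h2⟩ := hC (z.re - r) (z.re + r) (by linarith)
  have h3 := (Ico_subset_Ico_iff (by linarith)).1 h1
  refine ⟨I, hI, fun w hw => ?_, by linarith, ?_, by linarith, by linarith⟩
  · have e1 := abs_lt.1 ((abs_re_sub_le_norm_sub_conj z w).trans_lt hw.2)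
    have e2 := (im_add_im_le_norm_sub_conj z w).trans_lt hw.2
    exact ⟨⟨by linarith, by linarith⟩, hw.1, by linarith⟩
  · have : 2 * C * r ≤ max 1 (2 * C) * r := by gcongr; exact le_max_right _ _
    linarith

/-- The kernel is dominated by a sparse sum over the two dyadic systems. -/
lemma AreAdjacent.kerP_le {α : ℝ} (hα : -1 < α) {𝒟₁ 𝒟₂ : Set (ℝ × ℝ)} (h : AreAdjacent 𝒟₁ 𝒟₂) :
    ∃ C : ℝ≥0∞, C ≠ ⊤ ∧ ∀ z w : ℂ, 0 < z.im → 0 < w.im → ∃ I ∈ 𝒟₁ ∪ 𝒟₂,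
      z ∈ carlesonBox I ∧ w ∈ carlesonBox I ∧ kerP α z w ≤ C * (areaMeasure α (carlesonBox I))⁻¹ := by
  obtain ⟨C, hC1, hC⟩ := h.exists_box
  have hb := boxConst_pos α
  refine ⟨ENNReal.ofReal ((2 * C) ^ (2 + α) * boxConst α), by simp, fun z w hz hw => ?_⟩
  have hd := norm_sub_conj_pos hz hw
  -- The radius is twice the distance, so that w lies strictly inside the half-ball; z lies in the
  -- box because Im z is at most the distance, which is less than the side.
  obtain ⟨I, hI, h1, h2, h3, h4⟩ := hC z (2 * ‖z - conj w‖) hz (by linarith)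
  refine ⟨I, hI, ⟨h4, hz, ?_⟩, h1 ⟨hw, by linarith⟩, ?_⟩
  · linarith [im_add_im_le_norm_sub_conj z w]
  have hlt := h.lt hI
  have h0 : 0 < I.2 - I.1 := by linarith
  rw [areaMeasure_carlesonBox hα hlt, ← ENNReal.ofReal_inv_of_pos (by positivity),
    ← ENNReal.ofReal_mul (by positivity), kerP]
  apply ENNReal.ofReal_le_ofReal
  have := rpow_neg_le_of_le_mul (s := 2 + α) (by linarith) hd (by linarith : 0 < 2 * C)
    (h3.trans_eq (by ring)) h0
  refine this.trans_eq ?_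
  rw [Real.rpow_neg h0.le]
  field_simp

/-! ### Cauchy–Schwarz and duality for `ℝ≥0∞`-valued functions -/

/-- Keeps the maximal members of a finite laminar family. In the induction, a new set that is
contained in no selected set replaces the selected sets that it contains and is disjoint from the
others. -/
lemma exists_disjoint_subfamily {X ι : Type*} [DecidableEq ι] (Q : ι → Set X) (F : Finset ι)
    (hlam : ∀ i ∈ F, ∀ j ∈ F, Q i ⊆ Q j ∨ Q j ⊆ Q i ∨ Disjoint (Q i) (Q j)) :
    ∃ G ⊆ F, (G : Set ι).PairwiseDisjoint Q ∧ ⋃ i ∈ G, Q i = ⋃ i ∈ F, Q i := by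
  classical
  induction F using Finset.induction_on with
  | empty => exact ⟨∅, by simp, by simp, rfl⟩
  | insert a F ha ih =>
    obtain ⟨G, hGF, hd, hU⟩ := ih fun i hi j hj =>
      hlam i (Finset.mem_insert_of_mem hi) j (Finset.mem_insert_of_mem hj)
    by_cases hsub : ∃ j ∈ G, Q a ⊆ Q j
    · obtain ⟨j, hj, hs⟩ := hsub
      refine ⟨G, hGF.trans (Finset.subset_insert _ _), hd, ?_⟩
      rw [Finset.set_biUnion_insert, ← hU, eq_comm, union_eq_right]
      exact hs.trans (subset_biUnion_of_mem (u := Q) hj)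
    · push Not at hsub
      have hdisj : ∀ j ∈ G, ¬ Q j ⊆ Q a → Disjoint (Q a) (Q j) := fun j hj h =>
        ((hlam a (Finset.mem_insert_self _ _) j (Finset.mem_insert_of_mem (hGF hj))).resolve_left
          (hsub j hj)).resolve_left h
      refine ⟨insert a (G.filter fun j => ¬ Q j ⊆ Q a), ?_, ?_, ?_⟩
      · exact Finset.insert_subset_insert _ ((Finset.filter_subset _ _).trans hGF)
      · rw [Finset.coe_insert]
        refine PairwiseDisjoint.insert (hd.subset fun i hi => (Finset.mem_filter.1 hi).1) fun j hj _ => ?_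
        simp only [Finset.coe_filter, mem_ofPred_eq] at hj
        exact hdisj j hj.1 hj.2
      · rw [Finset.set_biUnion_insert, Finset.set_biUnion_insert, ← hU]
        ext x
        simp only [mem_union, mem_iUnion, Finset.mem_filter, exists_prop]
        constructor
        · rintro (h | ⟨i, ⟨hi, -⟩, hx⟩)
          exacts [Or.inl h, Or.inr ⟨i, hi, hx⟩]
        · rintro (h | ⟨i, hi, hx⟩)
          · exact Or.inl h
          · by_cases hia : Q i ⊆ Q a
            exacts [Or.inl (hia hx), Or.inr ⟨i, ⟨hi, hia⟩, hx⟩]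

section Abstract

variable {X : Type*} [MeasurableSpace X]

lemma sq_lintegral_mul_le {m : Measure X} {f g : X → ℝ≥0∞} (hf : AEMeasurable f m)
    (hg : AEMeasurable g m) :
    (∫⁻ x, f x * g x ∂m) ^ 2 ≤ (∫⁻ x, f x ^ 2 ∂m) * ∫⁻ x, g x ^ 2 ∂m := by
  have h := ENNReal.lintegral_mul_le_Lp_mul_Lq m Real.HolderConjugate.two_two hf hg
  simp only [Pi.mul_apply, ENNReal.rpow_two] at h
  calc _ ≤ ((∫⁻ x, f x ^ 2 ∂m) ^ (1 / 2 : ℝ) * (∫⁻ x, g x ^ 2 ∂m) ^ (1 / 2 : ℝ)) ^ 2 := by gcongr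
    _ = _ := by
      rw [mul_pow, ← ENNReal.rpow_two, ← ENNReal.rpow_two, ← ENNReal.rpow_mul, ← ENNReal.rpow_mul]
      norm_num

lemma sq_sum_mul_le {ι : Type*} (s : Finset ι) (f g : ι → ℝ≥0∞) :
    (∑ i ∈ s, f i * g i) ^ 2 ≤ (∑ i ∈ s, f i ^ 2) * ∑ i ∈ s, g i ^ 2 := by
  have h := ENNReal.inner_le_Lp_mul_Lq s f g Real.HolderConjugate.two_two
  simp only [ENNReal.rpow_two] at h
  calc _ ≤ ((∑ i ∈ s, f i ^ 2) ^ (1 / 2 : ℝ) * (∑ i ∈ s, g i ^ 2) ^ (1 / 2 : ℝ)) ^ 2 := by gcongr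
    _ = _ := by
      rw [mul_pow, ← ENNReal.rpow_two, ← ENNReal.rpow_two, ← ENNReal.rpow_mul, ← ENNReal.rpow_mul]
      norm_num

/-- Absorption: finiteness of `a` is known beforehand and permits the cancellation. -/
lemma le_of_sq_le_mul_self {a c : ℝ≥0∞} (ha : a ≠ ⊤) (h : a ^ 2 ≤ c * a) : a ≤ c := by
  rcases eq_or_ne a 0 with rfl | h0
  · simp
  rw [sq] at h
  exact (ENNReal.mul_le_mul_iff_left h0 ha).1 h

/-- Converse of Cauchy–Schwarz. -/
lemma lintegral_sq_le_of_forall {m : Measure X} [SigmaFinite m] {h : X → ℝ≥0∞} (hh : AEMeasurable h m)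
    {C : ℝ≥0∞} (H : ∀ g : X → ℝ≥0∞, AEMeasurable g m →
      (∫⁻ x, h x * g x ∂m) ^ 2 ≤ C * ∫⁻ x, g x ^ 2 ∂m) :
    ∫⁻ x, h x ^ 2 ∂m ≤ C := by
  -- The natural test function is h itself, but its norm may be infinite; truncation in height and
  -- in space makes the absorption legitimate, and monotone convergence recovers h.
  set g : ℕ → X → ℝ≥0∞ := fun n => (spanningSets m n).indicator fun x => min (h x) n with hg
  have gm : ∀ n, AEMeasurable (g n) m := fun n =>
    (hh.min aemeasurable_const).indicator (measurableSet_spanningSets m n)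
  have gle : ∀ n x, g n x ≤ h x := fun n x => by
    by_cases hx : x ∈ spanningSets m n <;> simp [hg, hx]
  have gmono : ∀ x, Monotone fun n => g n x := fun x i j hij => by
    by_cases hx : x ∈ spanningSets m i
    · have hxj := monotone_spanningSets m hij hx
      simp only [hg, hx, hxj, indicator_of_mem]
      gcongr
    · simp [hg, hx]
  have gfin : ∀ n, ∫⁻ x, g n x ^ 2 ∂m ≠ ⊤ := fun n => by
    refine ne_of_lt (lt_of_le_of_lt (b := ∫⁻ x in spanningSets m n, (n : ℝ≥0∞) ^ 2 ∂m) ?_ ?_)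
    · rw [← lintegral_indicator (measurableSet_spanningSets m n)]
      refine lintegral_mono fun x => ?_
      by_cases hx : x ∈ spanningSets m n
      · simp only [hg, hx, indicator_of_mem]; gcongr; exact min_le_right _ _
      · simp [hg, hx]
    · rw [setLIntegral_const]
      exact ENNReal.mul_lt_top (by finiteness) (measure_spanningSets_lt_top m n)
  have gC : ∀ n, ∫⁻ x, g n x ^ 2 ∂m ≤ C := fun n => by
    refine le_of_sq_le_mul_self (gfin n) (le_trans ?_ (H (g n) (gm n)))
    gcongr with x
    rw [sq]; gcongr; exact gle n x
  have hsup : ∀ x, h x ^ 2 = ⨆ n, g n x ^ 2 := fun x => by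
    refine le_antisymm ?_ (iSup_le fun n => by gcongr; exact gle n x)
    obtain ⟨N, hN⟩ := mem_iUnion.1 ((iUnion_spanningSets m).symm ▸ mem_univ x)
    rw [← ENNReal.iSup_pow_of_ne_zero two_ne_zero]
    gcongr
    refine le_of_forall_lt fun c hc => ?_
    obtain ⟨M, hM⟩ := ENNReal.exists_nat_gt (hc.trans_le le_top).ne
    refine lt_of_lt_of_le ?_ (le_iSup _ (max N M))
    have hx : x ∈ spanningSets m (max N M) := monotone_spanningSets m (le_max_left _ _) hN
    simp only [hg, hx, indicator_of_mem]
    exact lt_min hc (hM.trans_le (by exact_mod_cast le_max_right _ _))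
  simp_rw [hsup]
  rw [lintegral_iSup' (fun n => (gm n).pow_const 2)
    (Eventually.of_forall fun x i j hij => by
      have := gmono x hij
      simp only at this ⊢
      gcongr)]
  exact iSup_le gC

/-! ### The Carleson embedding theorem for laminar families -/

/-- Let M be the largest average of φ over the sets Q i that contain the point. Since M is at least
the i-th average on T i and the T i are disjoint, the sum is at most ∫ M². The set {M > t} is a
disjoint union of maximal Q i, which gives the weak-type bound t·m{M > t} ≤ ∫_{M > t} φ. Integration
over t yields ∫ M² ≤ 2∫ φM, and Cauchy–Schwarz produces the constant 4. -/
lemma carleson_embedding {ι : Type*} (m : Measure X) [SFinite m] (Q T : ι → Set X) (F : Finset ι)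
    (hQ : ∀ i ∈ F, MeasurableSet (Q i)) (hT : ∀ i ∈ F, MeasurableSet (T i))
    (hTQ : ∀ i ∈ F, T i ⊆ Q i) (hTd : (F : Set ι).PairwiseDisjoint T)
    (hlam : ∀ i ∈ F, ∀ j ∈ F, Q i ⊆ Q j ∨ Q j ⊆ Q i ∨ Disjoint (Q i) (Q j))
    (hfin : ∀ i ∈ F, m (Q i) ≠ ⊤) {φ : X → ℝ≥0∞} (hφ : AEMeasurable φ m) :
    ∑ i ∈ F, ((∫⁻ x in Q i, φ x ∂m) / m (Q i)) ^ 2 * m (T i) ≤ 4 * ∫⁻ x, φ x ^ 2 ∂m := by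
  classical
  rcases eq_or_ne (∫⁻ x, φ x ^ 2 ∂m) ⊤ with htop | hY
  · simp [htop]
  set Y := ∫⁻ x, φ x ^ 2 ∂m with hYdef
  set a : ι → ℝ≥0∞ := fun i => (∫⁻ x in Q i, φ x ∂m) / m (Q i) with ha
  have hint : ∀ i ∈ F, ∫⁻ x in Q i, φ x ∂m ≠ ⊤ := fun i hi => by
    have h := sq_lintegral_mul_le (m := m.restrict (Q i)) hφ.restrict (aemeasurable_const (b := 1))
    simp only [mul_one, one_pow, lintegral_const, one_mul, Measure.restrict_apply_univ] at h
    have h2 : (∫⁻ x in Q i, φ x ∂m) ^ 2 < ⊤ := h.trans_lt (ENNReal.mul_lt_top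
      ((setLIntegral_le_lintegral _ _).trans_lt (lt_top_iff_ne_top.2 hY)) (hfin i hi).lt_top)
    exact fun h3 => by simp [h3] at h2
  have hafin : ∀ i ∈ F, a i ≠ ⊤ := fun i hi => by
    rcases eq_or_ne (m (Q i)) 0 with h0 | h0
    · simp [ha, setLIntegral_measure_zero _ _ h0]
    · exact ENNReal.div_ne_top (hint i hi) h0
  set M : X → ℝ≥0∞ := fun x => ⨆ i ∈ (F : Set ι), (Q i).indicator (fun _ => a i) x with hM
  have hMm : Measurable M := Measurable.biSup _ F.countable_toSet fun i hi =>
    measurable_const.indicator (hQ i hi)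
  have hMlt : ∀ x t, t < M x ↔ ∃ i ∈ F, t < (Q i).indicator (fun _ => a i) x := fun x t => by
    simp only [hM, lt_iSup_iff, Finset.mem_coe, exists_prop]
  set A := ∑ i ∈ F, a i with hA
  have hAfin : A ≠ ⊤ := ENNReal.sum_ne_top.2 hafin
  have hMle : ∀ x, M x ≤ A := fun x => iSup₂_le fun i hi =>
    (indicator_le_self' (fun _ _ => zero_le) x).trans (Finset.single_le_sum (fun _ _ => zero_le) hi)
  have hMfin : ∀ x, M x ≠ ⊤ := fun x => ne_top_of_le_ne_top hAfin (hMle x)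
  have hlower : ∑ i ∈ F, a i ^ 2 * m (T i) ≤ ∫⁻ x, M x ^ 2 ∂m := by
    calc ∑ i ∈ F, a i ^ 2 * m (T i) ≤ ∑ i ∈ F, ∫⁻ x in T i, M x ^ 2 ∂m := by
          refine Finset.sum_le_sum fun i hi => ?_
          rw [← setLIntegral_const]
          refine setLIntegral_mono (hMm.pow_const 2) fun x hx => ?_
          gcongr
          have : a i = (Q i).indicator (fun _ => a i) x := by simp [hTQ i hi hx]
          rw [this]
          exact le_iSup₂ (f := fun j (_ : j ∈ (F : Set ι)) => (Q j).indicator (fun _ => a j) x) i hi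
      _ = ∫⁻ x in ⋃ i ∈ F, T i, M x ^ 2 ∂m := (lintegral_biUnion_finset hTd hT _).symm
      _ ≤ _ := setLIntegral_le_lintegral _ _
  -- M is bounded and lives on a finite union of sets of finite measure; this finiteness is what
  -- allows ∫ M² to be cancelled at the end.
  have hXfin : ∫⁻ x, M x ^ 2 ∂m ≠ ⊤ := by
    refine ne_of_lt (lt_of_le_of_lt (b := ∫⁻ x in ⋃ i ∈ F, Q i, A ^ 2 ∂m) ?_ ?_)
    · rw [← lintegral_indicator (F.measurableSet_biUnion hQ)]
      refine lintegral_mono fun x => ?_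
      by_cases hx : x ∈ ⋃ i ∈ F, Q i
      · rw [indicator_of_mem hx]; gcongr; exact hMle x
      · have : M x = 0 := by
          by_contra h0
          obtain ⟨i, hi, h⟩ := (hMlt x 0).1 (pos_iff_ne_zero.2 h0)
          have : x ∈ Q i := by by_contra hc; simp [hc] at h
          exact hx (mem_biUnion hi this)
        simp [this]
    · rw [setLIntegral_const]
      refine ENNReal.mul_lt_top (by finiteness) ?_
      exact (measure_biUnion_finset_le _ _).trans_lt (ENNReal.sum_lt_top.2 fun i hi => (hfin i hi).lt_top)
  have hset : ∀ t : ℝ, 0 < t → {x | t < (M x).toReal} =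
      ⋃ i ∈ F.filter fun i => ENNReal.ofReal t < a i, Q i := fun t ht => by
    ext x
    rw [mem_ofPred_eq, ← ENNReal.ofReal_lt_iff_lt_toReal ht.le (hMfin x), hMlt]
    simp only [mem_iUnion, Finset.mem_filter, exists_prop]
    constructor
    · rintro ⟨i, hi, h⟩
      have hx : x ∈ Q i := by by_contra hc; simp [hc] at h
      exact ⟨i, ⟨hi, by simpa [hx] using h⟩, hx⟩
    · rintro ⟨i, ⟨hi, h⟩, hx⟩
      exact ⟨i, hi, by simpa [hx] using h⟩
  have hweak : ∀ t : ℝ, 0 < t → m {x | t < (M x).toReal} * ENNReal.ofReal t ≤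
      m.withDensity φ {x | t < (M x).toReal} := fun t ht => by
    rw [hset t ht]
    obtain ⟨G, hGF, hd, hU⟩ := exists_disjoint_subfamily Q
      (F.filter fun i => ENNReal.ofReal t < a i)
      fun i hi j hj => hlam i (Finset.mem_filter.1 hi).1 j (Finset.mem_filter.1 hj).1
    have hGm : ∀ i ∈ G, MeasurableSet (Q i) := fun i hi => hQ i (Finset.mem_filter.1 (hGF hi)).1
    rw [← hU, measure_biUnion_finset hd hGm, measure_biUnion_finset hd hGm, Finset.sum_mul]
    refine Finset.sum_le_sum fun i hi => ?_
    obtain ⟨hiF, hti⟩ := Finset.mem_filter.1 (hGF hi)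
    rw [withDensity_apply _ (hQ i hiF), mul_comm]
    exact ENNReal.mul_le_of_le_div hti.le
  -- The layer-cake formula is used twice: for M² with respect to m, where differentiating the
  -- square gives the factor 2, and for M with respect to φ dm.
  have hX : ∫⁻ x, M x ^ 2 ∂m ≤ 2 * ∫⁻ x, φ x * M x ∂m := by
    have h1 := lintegral_rpow_eq_lintegral_meas_lt_mul m (f := fun x => (M x).toReal)
      (Eventually.of_forall fun x => (ENNReal.toReal_nonneg : 0 ≤ (M x).toReal))
      hMm.ennreal_toReal.aemeasurable two_pos
    have h2 := lintegral_eq_lintegral_meas_lt (m.withDensity φ) (f := fun x => (M x).toReal)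
      (Eventually.of_forall fun x => (ENNReal.toReal_nonneg : 0 ≤ (M x).toReal))
      hMm.ennreal_toReal.aemeasurable
    simp only [ENNReal.ofReal_toReal (hMfin _)] at h2
    have e1 : ∀ x, ENNReal.ofReal ((M x).toReal ^ (2 : ℝ)) = M x ^ 2 := fun x => by
      rw [Real.rpow_two, ENNReal.ofReal_pow ENNReal.toReal_nonneg, ENNReal.ofReal_toReal (hMfin _)]
    simp only [e1] at h1
    have h3 : ∫⁻ x, φ x * M x ∂m = ∫⁻ x, M x ∂(m.withDensity φ) := by
      rw [lintegral_withDensity_eq_lintegral_mul₀ hφ hMm.aemeasurable]; rfl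
    rw [h1, h3, h2, ENNReal.ofReal_ofNat]
    refine mul_le_mul' le_rfl (setLIntegral_mono' measurableSet_Ioi fun t ht => ?_)
    have := hweak t ht
    norm_num
    exact this
  refine hlower.trans (le_of_sq_le_mul_self hXfin ?_)
  calc (∫⁻ x, M x ^ 2 ∂m) ^ 2 ≤ (2 * ∫⁻ x, φ x * M x ∂m) ^ 2 := by gcongr
    _ = 4 * (∫⁻ x, φ x * M x ∂m) ^ 2 := by rw [mul_pow]; norm_num
    _ ≤ 4 * (Y * ∫⁻ x, M x ^ 2 ∂m) := by
      gcongr; exact sq_lintegral_mul_le hφ hMm.aemeasurable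
    _ = _ := by ring

end Abstract

/-! ### Békollé–Bonami weights and the boundedness of the positive Bergman operator -/

/-- `W` and `V = W⁻¹` form a Békollé–Bonami pair of weights. -/
structure B2Pair (α : ℝ) (𝒟 : Set (ℝ × ℝ)) (W V : ℂ → ℝ≥0∞) : Prop where
  aem_left : AEMeasurable W (areaMeasure α)
  aem_right : AEMeasurable V (areaMeasure α)
  mul_eq : ∀ᵐ z ∂areaMeasure α, W z * V z = 1
  bound : ∃ K : ℝ≥0∞, K ≠ ⊤ ∧ ∀ I ∈ 𝒟, (∫⁻ z in carlesonBox I, W z ∂areaMeasure α) *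
    (∫⁻ z in carlesonBox I, V z ∂areaMeasure α) ≤ K * areaMeasure α (carlesonBox I) ^ 2

namespace B2Pair

variable {α : ℝ} {𝒟 : Set (ℝ × ℝ)} {W V : ℂ → ℝ≥0∞}

lemma symm (h : B2Pair α 𝒟 W V) : B2Pair α 𝒟 V W where
  aem_left := h.aem_right
  aem_right := h.aem_left
  mul_eq := h.mul_eq.mono fun z hz => by rw [mul_comm, hz]
  bound := by
    obtain ⟨K, hK, hb⟩ := h.bound
    exact ⟨K, hK, fun I hI => by rw [mul_comm]; exact hb I hI⟩

lemma mono (h : B2Pair α 𝒟 W V) {𝒟' : Set (ℝ × ℝ)} (hs : 𝒟' ⊆ 𝒟) : B2Pair α 𝒟' W V where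
  aem_left := h.aem_left
  aem_right := h.aem_right
  mul_eq := h.mul_eq
  bound := by
    obtain ⟨K, hK, hb⟩ := h.bound
    exact ⟨K, hK, fun I hI => hb I (hs hI)⟩

/-- Cauchy–Schwarz for 1 = W^(1/2) V^(1/2). -/
lemma sq_measure_le (h : B2Pair α 𝒟 W V) (E : Set ℂ) :
    areaMeasure α E ^ 2 ≤ (∫⁻ z in E, W z ∂areaMeasure α) * ∫⁻ z in E, V z ∂areaMeasure α := by
  have h1 := sq_lintegral_mul_le (m := (areaMeasure α).restrict E)
    (h.aem_left.restrict.pow_const (1 / 2 : ℝ)) (h.aem_right.restrict.pow_const (1 / 2 : ℝ))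
  have h2 : ∫⁻ z in E, W z ^ (1 / 2 : ℝ) * V z ^ (1 / 2 : ℝ) ∂areaMeasure α = areaMeasure α E := by
    rw [← setLIntegral_one]
    refine lintegral_congr_ae (ae_restrict_of_ae (h.mul_eq.mono fun z hz => ?_))
    simp only
    rw [← ENNReal.mul_rpow_of_nonneg _ _ (by norm_num), hz, ENNReal.one_rpow]
  have h3 : ∀ x : ℝ≥0∞, (x ^ (1 / 2 : ℝ)) ^ 2 = x := fun x => by
    rw [← ENNReal.rpow_two, ← ENNReal.rpow_mul]; norm_num
  simpa only [h2, h3] using h1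

lemma ne_zero (h : B2Pair α 𝒟 W V) {E : Set ℂ} (hE : areaMeasure α E ≠ 0) :
    ∫⁻ z in E, W z ∂areaMeasure α ≠ 0 := fun h0 => by
  rw [lintegral_eq_zero_iff' h.aem_left.restrict] at h0
  have h1 : ∀ᵐ z ∂(areaMeasure α).restrict E, False := by
    filter_upwards [h0, ae_restrict_of_ae h.mul_eq] with z hz hz'
    simp [hz] at hz'
  rw [ae_iff] at h1
  simp at h1
  exact hE h1

/-- V has positive mass on the box, so infinite mass of W would violate the bound on the product. -/
lemma setLIntegral_ne_top (h : B2Pair α 𝒟 W V) (hα : -1 < α) (hlt : ∀ I ∈ 𝒟, I.1 < I.2)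
    {I : ℝ × ℝ} (hI : I ∈ 𝒟) : ∫⁻ z in carlesonBox I, W z ∂areaMeasure α ≠ ⊤ := fun ht => by
  obtain ⟨K, hK, hb⟩ := h.bound
  have hA := areaMeasure_carlesonBox hα (hlt I hI)
  have hpos : areaMeasure α (carlesonBox I) ≠ 0 := by
    have := boxConst_pos α
    have h0 : 0 < I.2 - I.1 := by linarith [hlt I hI]
    rw [hA]; simp; positivity
  have h1 := hb I hI
  rw [ht, ENNReal.top_mul (h.symm.ne_zero hpos), hA, top_le_iff] at h1
  exact ENNReal.mul_ne_top hK (by simp) h1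

/-- The substitution f ↦ fW turns the L²(W dA) norm into the L²(V dA) norm; in this form the
Carleson embedding is applied to the measure V dA itself. -/
lemma lintegral_sq (h : B2Pair α 𝒟 W V) {f : ℂ → ℝ≥0∞} (hf : AEMeasurable f (areaMeasure α)) :
    ∫⁻ z, (f z * W z) ^ 2 ∂(areaMeasure α).withDensity V =
      ∫⁻ z, f z ^ 2 * W z ∂areaMeasure α := by
  rw [lintegral_withDensity_eq_lintegral_mul₀ h.aem_right ((hf.fun_mul h.aem_left).pow_const 2)]
  refine lintegral_congr_ae (h.mul_eq.mono fun z hz => ?_)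
  simp only [Pi.mul_apply]
  calc _ = f z ^ 2 * W z * (W z * V z) := by ring
    _ = _ := by rw [hz, mul_one]

lemma setLIntegral_mul (h : B2Pair α 𝒟 W V) {f : ℂ → ℝ≥0∞} (hf : AEMeasurable f (areaMeasure α))
    {E : Set ℂ} (hE : MeasurableSet E) :
    ∫⁻ z in E, f z * W z ∂(areaMeasure α).withDensity V = ∫⁻ z in E, f z ∂areaMeasure α := by
  rw [setLIntegral_withDensity_eq_lintegral_mul₀ h.aem_right (hf.fun_mul h.aem_left) hE]
  refine lintegral_congr_ae (ae_restrict_of_ae (h.mul_eq.mono fun z hz => ?_))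
  simp only [Pi.mul_apply]
  calc _ = f z * (W z * V z) := by ring
    _ = _ := by rw [hz, mul_one]

end B2Pair

lemma sq_le_iff_le_rpow {x y : ℝ≥0∞} : x ^ 2 ≤ y ↔ x ≤ y ^ (1 / 2 : ℝ) := by
  rw [one_div, ENNReal.le_rpow_inv_iff two_pos, ENNReal.rpow_two]

/-- With σ = V dA and ω = W dA, the integral of f over Q is σ(Q) times the σ-average of fW, and
likewise for g with ω. The B₂ bound replaces σ(Q)ω(Q) by A(Q)²; one factor A(Q) cancels and the
other is at most C·A(T) ≤ C σ(T)^(1/2) ω(T)^(1/2), with T the top. Cauchy–Schwarz over the boxes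
leaves two Carleson sums, each with constant 4. -/
lemma sparse_sum_le {α : ℝ} (hα : -1 < α) {𝒟 : Set (ℝ × ℝ)} (h𝒟 : IsDyadicSystem 𝒟)
    {W V : ℂ → ℝ≥0∞} (h : B2Pair α 𝒟 W V) :
    ∃ C : ℝ≥0∞, C ≠ ⊤ ∧ ∀ f g : ℂ → ℝ≥0∞, AEMeasurable f (areaMeasure α) →
      AEMeasurable g (areaMeasure α) →
      (∑' I : 𝒟, (∫⁻ z in carlesonBox I, f z ∂areaMeasure α) *
        (∫⁻ z in carlesonBox I, g z ∂areaMeasure α) * (areaMeasure α (carlesonBox I))⁻¹) ^ 2 ≤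
      C * ((∫⁻ z, f z ^ 2 * W z ∂areaMeasure α) * ∫⁻ z, g z ^ 2 * V z ∂areaMeasure α) := by
  obtain ⟨K, hK, hb⟩ := h.bound
  obtain ⟨C, hC, hTop⟩ := areaMeasure_carlesonBox_le_boxTop hα
  refine ⟨(K * C) ^ 2 * 16, by finiteness, fun f g hf hg => ?_⟩
  set A := areaMeasure α with hA
  set σ := A.withDensity V with hσ
  set ω := A.withDensity W with hω
  have hσf := h.lintegral_sq hf
  have hωg := h.symm.lintegral_sq hg
  have hσm : ∀ I, σ (carlesonBox I) = ∫⁻ z in carlesonBox I, V z ∂A := fun I =>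
    withDensity_apply _ (measurableSet_carlesonBox I)
  have hωm : ∀ I, ω (carlesonBox I) = ∫⁻ z in carlesonBox I, W z ∂A := fun I =>
    withDensity_apply _ (measurableSet_carlesonBox I)
  have hσfin : ∀ I ∈ 𝒟, σ (carlesonBox I) ≠ ⊤ := fun I hI => by
    rw [hσm]; exact h.symm.setLIntegral_ne_top hα (fun _ => h𝒟.lt) hI
  have hωfin : ∀ I ∈ 𝒟, ω (carlesonBox I) ≠ ⊤ := fun I hI => by
    rw [hωm]; exact h.setLIntegral_ne_top hα (fun _ => h𝒟.lt) hI
  have hApos : ∀ I ∈ 𝒟, A (carlesonBox I) ≠ 0 := fun I hI => by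
    have := boxConst_pos α
    have h0 : 0 < I.2 - I.1 := by linarith [h𝒟.lt hI]
    rw [hA, areaMeasure_carlesonBox hα (h𝒟.lt hI)]; simp; positivity
  have hAfin : ∀ I ∈ 𝒟, A (carlesonBox I) ≠ ⊤ := fun I hI => by
    rw [hA, areaMeasure_carlesonBox hα (h𝒟.lt hI)]; simp
  have hfW : AEMeasurable (fun z => f z * W z) σ :=
    (hf.fun_mul h.aem_left).mono_ac (withDensity_absolutelyContinuous _ _)
  have hgV : AEMeasurable (fun z => g z * V z) ω :=
    (hg.fun_mul h.aem_right).mono_ac (withDensity_absolutelyContinuous _ _)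
  set a : ℝ × ℝ → ℝ≥0∞ := fun I =>
    (∫⁻ z in carlesonBox I, f z * W z ∂σ) / σ (carlesonBox I) with ha
  set c : ℝ × ℝ → ℝ≥0∞ := fun I =>
    (∫⁻ z in carlesonBox I, g z * V z ∂ω) / ω (carlesonBox I) with hc
  have hterm : ∀ I ∈ 𝒟, (∫⁻ z in carlesonBox I, f z ∂A) * (∫⁻ z in carlesonBox I, g z ∂A) *
      (A (carlesonBox I))⁻¹ ≤ K * C * ((a I * σ (boxTop I) ^ (1 / 2 : ℝ)) *
        (c I * ω (boxTop I) ^ (1 / 2 : ℝ))) := fun I hI => by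
    have e1 : ∫⁻ z in carlesonBox I, f z ∂A = a I * σ (carlesonBox I) := by
      rw [ha, ← h.setLIntegral_mul hf (measurableSet_carlesonBox I)]
      exact (ENNReal.div_mul_cancel (by rw [hσm]; exact h.symm.ne_zero (hApos I hI))
        (hσfin I hI)).symm
    have e2 : ∫⁻ z in carlesonBox I, g z ∂A = c I * ω (carlesonBox I) := by
      rw [hc, ← h.symm.setLIntegral_mul hg (measurableSet_carlesonBox I)]
      exact (ENNReal.div_mul_cancel (by rw [hωm]; exact h.ne_zero (hApos I hI))
        (hωfin I hI)).symm
    have e3 : ω (carlesonBox I) * σ (carlesonBox I) ≤ K * A (carlesonBox I) ^ 2 := by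
      rw [hωm, hσm]; exact hb I hI
    have e4 : A (boxTop I) ≤ σ (boxTop I) ^ (1 / 2 : ℝ) * ω (boxTop I) ^ (1 / 2 : ℝ) := by
      rw [← ENNReal.mul_rpow_of_nonneg _ _ (by norm_num), ← sq_le_iff_le_rpow, mul_comm, hσ, hω,
        withDensity_apply _ (measurableSet_boxTop I), withDensity_apply _ (measurableSet_boxTop I)]
      exact h.sq_measure_le _
    rw [e1, e2]
    calc a I * σ (carlesonBox I) * (c I * ω (carlesonBox I)) * (A (carlesonBox I))⁻¹
        = a I * c I * (ω (carlesonBox I) * σ (carlesonBox I)) * (A (carlesonBox I))⁻¹ := by ring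
      _ ≤ a I * c I * (K * A (carlesonBox I) ^ 2) * (A (carlesonBox I))⁻¹ := by gcongr
      _ = a I * c I * (K * A (carlesonBox I)) * (A (carlesonBox I) * (A (carlesonBox I))⁻¹) := by
        ring
      _ = a I * c I * (K * A (carlesonBox I)) := by
        rw [ENNReal.mul_inv_cancel (hApos I hI) (hAfin I hI), mul_one]
      _ ≤ a I * c I * (K * (C * (σ (boxTop I) ^ (1 / 2 : ℝ) * ω (boxTop I) ^ (1 / 2 : ℝ)))) := by
        gcongr
        exact (hTop I (h𝒟.lt hI)).trans (by gcongr)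
      _ = _ := by ring
  rw [sq_le_iff_le_rpow, ENNReal.tsum_eq_iSup_sum]
  refine iSup_le fun F => ?_
  rw [← sq_le_iff_le_rpow]
  have hsq : ∀ x : ℝ≥0∞, (x ^ (1 / 2 : ℝ)) ^ 2 = x := fun x => by
    rw [← ENNReal.rpow_two, ← ENNReal.rpow_mul]; norm_num
  have emb : ∀ (m : Measure ℂ) [SFinite m] (φ : ℂ → ℝ≥0∞), AEMeasurable φ m →
      (∀ I ∈ 𝒟, m (carlesonBox I) ≠ ⊤) →
      ∑ I ∈ F, ((∫⁻ x in carlesonBox I, φ x ∂m) / m (carlesonBox I)) ^ 2 * m (boxTop I) ≤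
        4 * ∫⁻ x, φ x ^ 2 ∂m := fun m _ φ hφ hm =>
    carleson_embedding m (fun I : 𝒟 => carlesonBox I) (fun I : 𝒟 => boxTop I) F
      (fun _ _ => measurableSet_carlesonBox _) (fun _ _ => measurableSet_boxTop _)
      (fun I _ => boxTop_subset (h𝒟.lt I.2))
      (fun I _ J _ hIJ => h𝒟.disjoint_boxTop I.2 J.2 (fun h => hIJ (Subtype.ext h)))
      (fun I _ J _ => h𝒟.box_nested I.2 J.2) (fun I _ => hm I I.2) hφ
  calc _ ≤ (∑ I ∈ F, K * C * ((a I * σ (boxTop I) ^ (1 / 2 : ℝ)) *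
        (c I * ω (boxTop I) ^ (1 / 2 : ℝ)))) ^ 2 := by
        gcongr ?_ ^ 2; exact Finset.sum_le_sum fun I _ => hterm I I.2
    _ = (K * C) ^ 2 * (∑ I ∈ F, (a I * σ (boxTop I) ^ (1 / 2 : ℝ)) *
        (c I * ω (boxTop I) ^ (1 / 2 : ℝ))) ^ 2 := by rw [← Finset.mul_sum, mul_pow]
    _ ≤ (K * C) ^ 2 * ((∑ I ∈ F, (a I * σ (boxTop I) ^ (1 / 2 : ℝ)) ^ 2) *
        ∑ I ∈ F, (c I * ω (boxTop I) ^ (1 / 2 : ℝ)) ^ 2) := by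
        gcongr; exact sq_sum_mul_le _ _ _
    _ ≤ (K * C) ^ 2 * ((4 * ∫⁻ z, f z ^ 2 * W z ∂A) * (4 * ∫⁻ z, g z ^ 2 * V z ∂A)) := by
        simp only [mul_pow, hsq]
        rw [← hσf, ← hωg]
        gcongr
        · exact emb σ _ hfW hσfin
        · exact emb ω _ hgV hωfin
    _ = _ := by ring

/-- The positive Bergman operator, acting on functions with values in `ℝ≥0∞`. -/
def opP (α : ℝ) (f : ℂ → ℝ≥0∞) (z : ℂ) : ℝ≥0∞ := ∫⁻ w, kerP α z w * f w ∂areaMeasure α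

lemma aemeasurable_opP {α : ℝ} {f : ℂ → ℝ≥0∞} (hf : AEMeasurable f (areaMeasure α)) :
    AEMeasurable (opP α f) (areaMeasure α) :=
  ((measurable_kerP_uncurry α).aemeasurable.fun_mul hf.comp_snd).lintegral_prod_right'

/-- Bilinear form of the boundedness of P⁺: the pointwise sparse bound of the kernel is integrated
against f and g, and each dyadic system is estimated separately. -/
lemma lintegral_opP_mul_le {α : ℝ} (hα : -1 < α) {𝒟₁ 𝒟₂ : Set (ℝ × ℝ)} (h𝒟 : AreAdjacent 𝒟₁ 𝒟₂)
    {W V : ℂ → ℝ≥0∞} (h : B2Pair α (𝒟₁ ∪ 𝒟₂) W V) :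
    ∃ C : ℝ≥0∞, C ≠ ⊤ ∧ ∀ f g : ℂ → ℝ≥0∞, AEMeasurable f (areaMeasure α) →
      AEMeasurable g (areaMeasure α) → (∫⁻ z, opP α f z * g z ∂areaMeasure α) ^ 2 ≤
        C * ((∫⁻ z, f z ^ 2 * W z ∂areaMeasure α) * ∫⁻ z, g z ^ 2 * V z ∂areaMeasure α) := by
  obtain ⟨C₁, hC₁, H₁⟩ := sparse_sum_le hα h𝒟.left (h.mono subset_union_left)
  obtain ⟨C₂, hC₂, H₂⟩ := sparse_sum_le hα h𝒟.right (h.mono subset_union_right)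
  obtain ⟨C, hC, HC⟩ := h𝒟.kerP_le hα
  have := h𝒟.left.countable.to_subtype
  have := h𝒟.right.countable.to_subtype
  refine ⟨C ^ 2 * (2 * (C₁ + C₂)), by finiteness, fun f g hf hg => ?_⟩
  set A := areaMeasure α with hA
  set e : Set (ℝ × ℝ) → ℂ → ℂ → ℝ≥0∞ := fun 𝒟 z w => ∑' I : 𝒟,
    (carlesonBox I).indicator 1 z * ((carlesonBox I).indicator 1 w * (A (carlesonBox I))⁻¹) with he
  have hind : ∀ I : ℝ × ℝ, Measurable ((carlesonBox I).indicator (1 : ℂ → ℝ≥0∞)) := fun I =>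
    measurable_one.indicator (measurableSet_carlesonBox I)
  have hle : ∀ (𝒟 : Set (ℝ × ℝ)) (I : ℝ × ℝ), I ∈ 𝒟 → ∀ z w, z ∈ carlesonBox I → w ∈ carlesonBox I →
      (A (carlesonBox I))⁻¹ ≤ e 𝒟 z w := fun 𝒟 I hI z w hz hw => by
    refine le_trans (le_of_eq ?_) (ENNReal.le_tsum (⟨I, hI⟩ : 𝒟))
    simp [hz, hw]
  have hker : ∀ᵐ z ∂A, ∀ᵐ w ∂A, kerP α z w ≤ C * (e 𝒟₁ z w + e 𝒟₂ z w) := by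
    filter_upwards [ae_mem_upperHalf α] with z hz
    filter_upwards [ae_mem_upperHalf α] with w hw
    obtain ⟨I, hI, hzI, hwI, hk⟩ := HC z w hz hw
    refine hk.trans ?_
    gcongr
    rcases hI with hI | hI
    · exact (hle _ I hI z w hzI hwI).trans le_self_add
    · exact (hle _ I hI z w hzI hwI).trans le_add_self
  have hem : ∀ 𝒟 : Set (ℝ × ℝ), Countable 𝒟 → ∀ z, Measurable fun w => e 𝒟 z w :=
    fun 𝒟 _ z => Measurable.tsum fun I => ((hind I).mul_const _).const_mul _
  have hint : ∀ 𝒟 : Set (ℝ × ℝ), Countable 𝒟 → ∫⁻ z, (∫⁻ w, e 𝒟 z w * f w ∂A) * g z ∂A =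
      ∑' I : 𝒟, (∫⁻ z in carlesonBox I, f z ∂A) * (∫⁻ z in carlesonBox I, g z ∂A) *
        (A (carlesonBox I))⁻¹ := fun 𝒟 _ => by
    have hi : ∀ (I : ℝ × ℝ) (u : ℂ → ℝ≥0∞), ∫⁻ w, (carlesonBox I).indicator 1 w * u w ∂A =
        ∫⁻ w in carlesonBox I, u w ∂A := fun I u => by
      rw [← lintegral_indicator (measurableSet_carlesonBox I)]
      refine lintegral_congr fun w => ?_
      by_cases hw : w ∈ carlesonBox I <;> simp [hw]
    have e1 : ∀ z, (∫⁻ w, e 𝒟 z w * f w ∂A) * g z = ∑' I : 𝒟,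
        ((carlesonBox I).indicator 1 z * g z) *
          ((A (carlesonBox I))⁻¹ * ∫⁻ w in carlesonBox I, f w ∂A) := fun z => by
      simp only [he, ← ENNReal.tsum_mul_right]
      rw [lintegral_tsum fun I : 𝒟 => ((((hind I).mul_const _).const_mul _).aemeasurable.fun_mul hf),
        ← ENNReal.tsum_mul_right]
      refine tsum_congr fun I => ?_
      rw [← hi I f]
      have : ∀ w, (carlesonBox I).indicator 1 z * ((carlesonBox I).indicator 1 w *
          (A (carlesonBox I))⁻¹) * f w = ((carlesonBox I).indicator 1 z * (A (carlesonBox I))⁻¹) *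
          ((carlesonBox I).indicator 1 w * f w) := fun w => by ring
      simp_rw [this]
      rw [lintegral_const_mul'' _ ((hind I).aemeasurable.fun_mul hf)]
      ring
    simp_rw [e1]
    rw [lintegral_tsum fun I : 𝒟 => ((hind I).aemeasurable.fun_mul hg).mul_const _]
    refine tsum_congr fun I => ?_
    rw [lintegral_mul_const'' _ ((hind I).aemeasurable.fun_mul hg), hi I g]
    ring
  have hem2 : ∀ 𝒟 : Set (ℝ × ℝ), Countable 𝒟 → Measurable fun p : ℂ × ℂ => e 𝒟 p.1 p.2 :=
    fun 𝒟 _ => Measurable.tsum fun I => ((hind I).comp measurable_fst).mul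
      (((hind I).comp measurable_snd).mul_const _)
  have hmain : ∫⁻ z, opP α f z * g z ∂A ≤ C * (∫⁻ z, (∫⁻ w, e 𝒟₁ z w * f w ∂A) * g z ∂A +
      ∫⁻ z, (∫⁻ w, e 𝒟₂ z w * f w ∂A) * g z ∂A) := by
    have hm1 : AEMeasurable (fun z => (∫⁻ w, e 𝒟₁ z w * f w ∂A) * g z) A :=
      (((hem2 𝒟₁ inferInstance).aemeasurable.fun_mul hf.comp_snd).lintegral_prod_right').fun_mul hg
    have hm2 : AEMeasurable (fun z => (∫⁻ w, e 𝒟₂ z w * f w ∂A) * g z) A :=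
      (((hem2 𝒟₂ inferInstance).aemeasurable.fun_mul hf.comp_snd).lintegral_prod_right').fun_mul hg
    rw [← lintegral_add_left' hm1, ← lintegral_const_mul'' _ (hm1.fun_add hm2)]
    refine lintegral_mono_ae (hker.mono fun z hz => ?_)
    calc opP α f z * g z ≤ (∫⁻ w, C * (e 𝒟₁ z w * f w + e 𝒟₂ z w * f w) ∂A) * g z := by
          gcongr ?_ * _
          refine lintegral_mono_ae (hz.mono fun w hw => ?_)
          calc _ ≤ (C * (e 𝒟₁ z w + e 𝒟₂ z w)) * f w := by gcongr
            _ = _ := by ring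
      _ = _ := by
          have h1 := (hem 𝒟₁ inferInstance z).aemeasurable.fun_mul hf
          have h2 := (hem 𝒟₂ inferInstance z).aemeasurable.fun_mul hf
          rw [lintegral_const_mul'' _ (h1.fun_add h2), lintegral_add_left' h1]
          ring
  rw [hint 𝒟₁ inferInstance, hint 𝒟₂ inferInstance] at hmain
  have hab : ∀ a b : ℝ≥0∞, (a + b) ^ 2 ≤ 2 * (a ^ 2 + b ^ 2) := fun a b => by
    have h3 := sq_sum_mul_le (Finset.univ : Finset (Fin 2)) ![1, 1] ![a, b]
    simpa [Fin.sum_univ_two, one_add_one_eq_two] using h3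
  calc _ ≤ _ := pow_le_pow_left' hmain 2
    _ ≤ C ^ 2 * (2 * (C₁ * _ + C₂ * _)) := by
      rw [mul_pow]
      gcongr
      refine (hab _ _).trans ?_
      gcongr
      · exact H₁ f g hf hg
      · exact H₂ f g hf hg
    _ = _ := by ring

/-- The positive Bergman operator is bounded on `L²(W)` for a Békollé–Bonami weight `W`. -/
lemma lintegral_opP_sq_le {α : ℝ} (hα : -1 < α) {𝒟₁ 𝒟₂ : Set (ℝ × ℝ)} (h𝒟 : AreAdjacent 𝒟₁ 𝒟₂)
    {W V : ℂ → ℝ≥0∞} (h : B2Pair α (𝒟₁ ∪ 𝒟₂) W V) :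
    ∃ C : ℝ≥0∞, C ≠ ⊤ ∧ ∀ f : ℂ → ℝ≥0∞, AEMeasurable f (areaMeasure α) →
      ∫⁻ z, opP α f z ^ 2 * W z ∂areaMeasure α ≤ C * ∫⁻ z, f z ^ 2 * W z ∂areaMeasure α := by
  obtain ⟨C, hC, H⟩ := lintegral_opP_mul_le hα h𝒟 h
  refine ⟨C, hC, fun f hf => ?_⟩
  set A := areaMeasure α
  have hac : A.withDensity W ≪ A := withDensity_absolutelyContinuous _ _
  have hWf : ∀ᵐ z ∂A, W z ≠ ⊤ := h.mul_eq.mono fun z hz h0 => by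
    rw [h0] at hz
    rcases eq_or_ne (V z) 0 with h1 | h1
    · simp [h1] at hz
    · simp [ENNReal.top_mul h1] at hz
  have hWf0 : ∀ᵐ z ∂A, W z ≠ 0 := h.mul_eq.mono fun z hz h0 => by simp [h0] at hz
  have : SigmaFinite (A.withDensity W) := SigmaFinite.withDensity_of_ne_top hWf
  have hm := aemeasurable_opP hf
  have hsq : ∀ u : ℂ → ℝ≥0∞, AEMeasurable u A →
      ∫⁻ z, u z ^ 2 ∂A.withDensity W = ∫⁻ z, u z ^ 2 * W z ∂A := fun u hu => by
    rw [lintegral_withDensity_eq_lintegral_mul₀ h.aem_left (hu.pow_const 2)]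
    exact lintegral_congr fun z => mul_comm _ _
  rw [← hsq _ hm]
  refine lintegral_sq_le_of_forall (hm.mono_ac hac) fun g hg => ?_
  have hgA : AEMeasurable g A :=
    hg.mono_ac (withDensity_absolutelyContinuous' h.aem_left hWf0)
  -- Duality in L²(W dA): the test function g corresponds to gW in the dual weight, because (gW)²V =
  -- g²W.
  have h1 := H f (fun z => g z * W z) hf (hgA.fun_mul h.aem_left)
  rw [hsq g hgA]
  rw [lintegral_withDensity_eq_lintegral_mul₀ h.aem_left (hm.fun_mul hgA)]
  calc (∫⁻ z, (W * fun z => opP α f z * g z) z ∂A) ^ 2 = (∫⁻ z, opP α f z * (g z * W z) ∂A) ^ 2 := by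
        congr 1; refine lintegral_congr fun z => ?_
        simp only [Pi.mul_apply]; ring
    _ ≤ _ := h1
    _ = _ := by
      rw [mul_assoc]
      congr 2
      refine lintegral_congr_ae (h.mul_eq.mono fun z hz => ?_)
      simp only
      calc _ = g z ^ 2 * W z * (W z * V z) := by ring
        _ = _ := by rw [hz, mul_one]

/-! ### Consequences of the Békollé–Bonami condition -/

lemma sq_rpow_half (x : ℝ≥0∞) : (x ^ (1 / 2 : ℝ)) ^ 2 = x := by
  rw [← ENNReal.rpow_two, ← ENNReal.rpow_mul]; norm_num

lemma rpow_half_sq (x : ℝ≥0∞) : (x ^ 2) ^ (1 / 2 : ℝ) = x := by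
  rw [← ENNReal.rpow_two, ← ENNReal.rpow_mul]; norm_num

/-- The geometric mean of two Békollé–Bonami weights is one. -/
lemma B2Pair.geom {α : ℝ} {𝒟 : Set (ℝ × ℝ)} {W V W' V' : ℂ → ℝ≥0∞} (h : B2Pair α 𝒟 W V)
    (h' : B2Pair α 𝒟 W' V') :
    B2Pair α 𝒟 (fun z => (W z * W' z) ^ (1 / 2 : ℝ)) fun z => (V z * V' z) ^ (1 / 2 : ℝ) where
  aem_left := (h.aem_left.fun_mul h'.aem_left).pow_const _
  aem_right := (h.aem_right.fun_mul h'.aem_right).pow_const _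
  mul_eq := by
    filter_upwards [h.mul_eq, h'.mul_eq] with z hz hz'
    rw [← ENNReal.mul_rpow_of_nonneg _ _ (by norm_num), mul_mul_mul_comm, hz, hz', mul_one,
      ENNReal.one_rpow]
  bound := by
    obtain ⟨K, hK, hb⟩ := h.bound
    obtain ⟨K', hK', hb'⟩ := h'.bound
    have cs : ∀ (E : Set ℂ) (f g : ℂ → ℝ≥0∞), AEMeasurable f (areaMeasure α) →
        AEMeasurable g (areaMeasure α) →
        (∫⁻ z in E, (f z * g z) ^ (1 / 2 : ℝ) ∂areaMeasure α) ^ 2 ≤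
          (∫⁻ z in E, f z ∂areaMeasure α) * ∫⁻ z in E, g z ∂areaMeasure α := fun E f g hf hg => by
      have := sq_lintegral_mul_le (m := (areaMeasure α).restrict E)
        (hf.restrict.pow_const (1 / 2 : ℝ)) (hg.restrict.pow_const (1 / 2 : ℝ))
      simpa only [sq_rpow_half, ← ENNReal.mul_rpow_of_nonneg _ _ (show (0 : ℝ) ≤ 1 / 2 by norm_num)]
        using this
    refine ⟨(K * K') ^ (1 / 2 : ℝ), by finiteness, fun I hI => ?_⟩
    rw [← rpow_half_sq (areaMeasure α (carlesonBox I) ^ 2),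
      ← ENNReal.mul_rpow_of_nonneg _ _ (by norm_num), ← sq_le_iff_le_rpow, mul_pow]
    calc _ ≤ ((∫⁻ z in carlesonBox I, W z ∂areaMeasure α) *
            ∫⁻ z in carlesonBox I, W' z ∂areaMeasure α) *
          ((∫⁻ z in carlesonBox I, V z ∂areaMeasure α) *
            ∫⁻ z in carlesonBox I, V' z ∂areaMeasure α) := by
          gcongr
          · exact cs _ _ _ h.aem_left h'.aem_left
          · exact cs _ _ _ h.aem_right h'.aem_right
      _ = ((∫⁻ z in carlesonBox I, W z ∂areaMeasure α) *
            ∫⁻ z in carlesonBox I, V z ∂areaMeasure α) *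
          ((∫⁻ z in carlesonBox I, W' z ∂areaMeasure α) *
            ∫⁻ z in carlesonBox I, V' z ∂areaMeasure α) := by ring
      _ ≤ (K * areaMeasure α (carlesonBox I) ^ 2) * (K' * areaMeasure α (carlesonBox I) ^ 2) := by
          exact mul_le_mul' (hb I hI) (hb' I hI)
      _ = _ := by ring

section

variable {α : ℝ} {𝒟₁ 𝒟₂ : Set (ℝ × ℝ)} {W V : ℂ → ℝ≥0∞}

/-- The area of the Carleson boxes that cover the balls. -/
lemma exists_box_measure_le (hα : -1 < α) (h𝒟 : AreAdjacent 𝒟₁ 𝒟₂) :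
    ∃ C : ℝ≥0∞, C ≠ ⊤ ∧ ∀ (z : ℂ) (r : ℝ), 0 < z.im → 0 < r → ∃ I ∈ 𝒟₁ ∪ 𝒟₂,
      hball z r ⊆ carlesonBox I ∧
        areaMeasure α (carlesonBox I) ≤ C * ENNReal.ofReal (r ^ (2 + α)) := by
  obtain ⟨C, hC1, hC⟩ := h𝒟.exists_box
  have hb := boxConst_pos α
  refine ⟨ENNReal.ofReal (boxConst α * C ^ (2 + α)), by simp, fun z r hz hr => ?_⟩
  obtain ⟨I, hI, h1, h2, h3, -⟩ := hC z r hz hr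
  refine ⟨I, hI, h1, ?_⟩
  rw [areaMeasure_carlesonBox hα (h𝒟.lt hI), ← ENNReal.ofReal_mul (by positivity), mul_assoc,
    ← Real.mul_rpow (by linarith) hr.le]
  apply ENNReal.ofReal_le_ofReal
  gcongr
  · linarith
  · linarith

namespace B2Pair

lemma measure_hball_mul_le (h : B2Pair α (𝒟₁ ∪ 𝒟₂) W V) (hα : -1 < α)
    (h𝒟 : AreAdjacent 𝒟₁ 𝒟₂) :
    ∃ C : ℝ≥0∞, C ≠ ⊤ ∧ ∀ (z : ℂ) (r : ℝ), 0 < z.im → 0 < r →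
      (areaMeasure α).withDensity W (hball z r) * (areaMeasure α).withDensity V (hball z r) ≤
        C * ENNReal.ofReal (r ^ (2 + α)) ^ 2 := by
  obtain ⟨C, hC, H⟩ := exists_box_measure_le hα h𝒟
  obtain ⟨K, hK, hb⟩ := h.bound
  refine ⟨K * C ^ 2, by finiteness, fun z r hz hr => ?_⟩
  obtain ⟨I, hI, hs, hA⟩ := H z r hz hr
  calc _ ≤ (areaMeasure α).withDensity W (carlesonBox I) *
        (areaMeasure α).withDensity V (carlesonBox I) := by gcongr
    _ ≤ K * areaMeasure α (carlesonBox I) ^ 2 := by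
        rw [withDensity_apply', withDensity_apply']; exact hb I hI
    _ ≤ K * (C * ENNReal.ofReal (r ^ (2 + α))) ^ 2 := by gcongr
    _ = _ := by ring

lemma sq_measure_le' (h : B2Pair α (𝒟₁ ∪ 𝒟₂) W V) (E : Set ℂ) :
    areaMeasure α E ^ 2 ≤
      (areaMeasure α).withDensity W E * (areaMeasure α).withDensity V E := by
  rw [withDensity_apply', withDensity_apply']; exact h.sq_measure_le E

/-- The quantitative `A_∞` property: subsets of a ball carry a definite part of the mass. -/
lemma sq_measure_mul_le (h : B2Pair α (𝒟₁ ∪ 𝒟₂) W V) (hα : -1 < α)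
    (h𝒟 : AreAdjacent 𝒟₁ 𝒟₂) :
    ∃ C : ℝ≥0∞, C ≠ ⊤ ∧ ∀ (z : ℂ) (r : ℝ) (E : Set ℂ), 0 < z.im → 0 < r → E ⊆ hball z r →
      areaMeasure α E ^ 2 * (areaMeasure α).withDensity W (hball z r) ≤
        C * ENNReal.ofReal (r ^ (2 + α)) ^ 2 * (areaMeasure α).withDensity W E := by
  obtain ⟨C, hC, H⟩ := h.measure_hball_mul_le hα h𝒟
  refine ⟨C, hC, fun z r E hz hr hE => ?_⟩
  calc _ ≤ ((areaMeasure α).withDensity W E * (areaMeasure α).withDensity V E) *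
        (areaMeasure α).withDensity W (hball z r) := by gcongr; exact h.sq_measure_le' E
    _ ≤ ((areaMeasure α).withDensity W E * (areaMeasure α).withDensity V (hball z r)) *
        (areaMeasure α).withDensity W (hball z r) := by gcongr
    _ = ((areaMeasure α).withDensity W (hball z r) * (areaMeasure α).withDensity V (hball z r)) *
        (areaMeasure α).withDensity W E := by ring
    _ ≤ _ := mul_le_mul_left (H z r hz hr) _

lemma measure_ne_zero (h : B2Pair α (𝒟₁ ∪ 𝒟₂) W V) {E : Set ℂ} (hE : areaMeasure α E ≠ 0) :
    (areaMeasure α).withDensity W E ≠ 0 := by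
  rw [withDensity_apply']; exact h.ne_zero hE

lemma measure_hball_ne_top (h : B2Pair α (𝒟₁ ∪ 𝒟₂) W V) (hα : -1 < α)
    (h𝒟 : AreAdjacent 𝒟₁ 𝒟₂) {z : ℂ} {r : ℝ} (hz : 0 < z.im) (hr : 0 < r) :
    (areaMeasure α).withDensity W (hball z r) ≠ ⊤ := by
  obtain ⟨C, -, H⟩ := h𝒟.exists_box
  obtain ⟨I, hI, hs, -⟩ := H z r hz hr
  refine ne_top_of_le_ne_top ?_ (measure_mono hs)
  rw [withDensity_apply']
  exact h.setLIntegral_ne_top hα (fun _ => h𝒟.lt) hI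

lemma ne_top_ae (h : B2Pair α (𝒟₁ ∪ 𝒟₂) W V) : ∀ᵐ z ∂areaMeasure α, W z ≠ ⊤ :=
  h.mul_eq.mono fun z hz h0 => by
    rw [h0] at hz
    rcases eq_or_ne (V z) 0 with h1 | h1
    · simp [h1] at hz
    · simp [ENNReal.top_mul h1] at hz

lemma ne_zero_ae (h : B2Pair α (𝒟₁ ∪ 𝒟₂) W V) : ∀ᵐ z ∂areaMeasure α, W z ≠ 0 :=
  h.mul_eq.mono fun z hz h0 => by simp [h0] at hz

lemma sigmaFinite (h : B2Pair α (𝒟₁ ∪ 𝒟₂) W V) : SigmaFinite ((areaMeasure α).withDensity W) :=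
  SigmaFinite.withDensity_of_ne_top h.ne_top_ae

/-- The kernel function at `i` is square integrable. -/
lemma lintegral_kerP_I_sq_ne_top (h : B2Pair α (𝒟₁ ∪ 𝒟₂) W V) (hα : -1 < α)
    (h𝒟 : AreAdjacent 𝒟₁ 𝒟₂) :
    ∫⁻ w, kerP α Complex.I w ^ 2 * V w ∂areaMeasure α ≠ ⊤ := by
  have := h.sigmaFinite
  obtain ⟨C, hC, H⟩ := lintegral_opP_mul_le hα h𝒟 h
  set A := areaMeasure α with hA
  -- On this square near i the kernel at z dominates a multiple of the kernel at i, so P⁺f is there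
  -- at least a constant times ∫ k f, with k the kernel at i. Testing P⁺ against the indicator of D
  -- therefore makes f ↦ ∫ k f bounded on L²(W).
  set D := rect 0 1 1 2 with hD
  have hDm : MeasurableSet D := measurableSet_rect _ _ _ _
  have hDA : A D ≠ 0 := by
    have := areaMeasure_whitney hα 0 (p := 1) (q := 1) (y := 1) one_pos one_pos one_pos
    rw [show (0 : ℝ) + 1 * 1 = 1 by norm_num, show (1 : ℝ) + 1 * 1 = 2 by norm_num] at this
    rw [hA, hD, this]
    have := whitneyConst_pos hα (p := 1) (q := 1) one_pos one_pos
    simp only [ne_eq, ENNReal.ofReal_eq_zero, not_le]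
    positivity
  have hDtop : A D ≠ ⊤ := by
    have := areaMeasure_whitney hα 0 (p := 1) (q := 1) (y := 1) one_pos one_pos one_pos
    rw [show (0 : ℝ) + 1 * 1 = 1 by norm_num, show (1 : ℝ) + 1 * 1 = 2 by norm_num] at this
    rw [hA, hD, this]; simp
  have hI : ∀ z ∈ D, 0 < z.im ∧ ‖z - Complex.I‖ ≤ 2 := fun z hz => by
    refine ⟨by linarith [hz.2.1], ?_⟩
    refine (Complex.norm_le_abs_re_add_abs_im _).trans ?_
    simp only [Complex.sub_re, Complex.I_re, Complex.sub_im, Complex.I_im, sub_zero]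
    rw [abs_of_nonneg hz.1.1, abs_of_nonneg (by linarith [hz.2.1])]
    linarith [hz.1.2, hz.2.2]
  have hker : ∀ z ∈ D, ∀ w : ℂ, 0 < w.im →
      kerP α Complex.I w ≤ ENNReal.ofReal (3 ^ (2 + α)) * kerP α z w := fun z hz w hw => by
    refine kerP_le_of_le hα (by simp) hw (hI z hz).1 hw three_pos ?_
    have h1 := im_add_im_le_norm_sub_conj Complex.I w
    have h2 := norm_sub_conj_le_add_norm_sub z Complex.I w
    have h3 := (hI z hz).2
    simp only [Complex.I_im] at h1
    linarith
  have hVD : ∫⁻ z in D, V z ∂A ≠ ⊤ := by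
    have hs : D ⊆ hball Complex.I 10 := fun z hz => ⟨(hI z hz).1, by
      have h2 := norm_sub_conj_le_add_norm_sub z Complex.I Complex.I
      rw [norm_sub_conj_comm]
      have h3 := (hI z hz).2
      have h4 : ‖Complex.I - conj Complex.I‖ ≤ 2 := by
        rw [Complex.conj_I, sub_neg_eq_add]
        refine (norm_add_le _ _).trans ?_
        norm_num
      linarith⟩
    rw [← withDensity_apply']
    exact ne_top_of_le_ne_top (h.symm.measure_hball_ne_top hα h𝒟 (by simp) (by norm_num))
      (measure_mono hs)
  have hkm : AEMeasurable (fun w => kerP α Complex.I w) A :=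
    (measurable_kerP_right α Complex.I).aemeasurable
  set C' := ENNReal.ofReal (3 ^ (2 + α)) ^ 2 * (C * ∫⁻ z in D, V z ∂A) / A D ^ 2 with hC'
  have hC't : C' ≠ ⊤ := ENNReal.div_ne_top (by finiteness) (by positivity)
  have key : ∀ f : ℂ → ℝ≥0∞, AEMeasurable f A →
      (∫⁻ w, kerP α Complex.I w * f w ∂A) ^ 2 ≤ C' * ∫⁻ w, f w ^ 2 * W w ∂A := fun f hf => by
    have h1 : A D * (∫⁻ w, kerP α Complex.I w * f w ∂A) ≤
        ENNReal.ofReal (3 ^ (2 + α)) * ∫⁻ z, opP α f z * D.indicator 1 z ∂A := by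
      have e1 : ∫⁻ z, opP α f z * D.indicator 1 z ∂A = ∫⁻ z in D, opP α f z ∂A := by
        rw [← lintegral_indicator hDm]
        refine lintegral_congr fun z => ?_
        by_cases hz : z ∈ D <;> simp [hz]
      rw [e1, mul_comm, ← setLIntegral_const,
        ← lintegral_const_mul'' _ (aemeasurable_opP hf).restrict]
      refine setLIntegral_mono' hDm fun z hz => ?_
      rw [opP, ← lintegral_const_mul'' _ ((measurable_kerP_right α z).aemeasurable.fun_mul hf)]
      refine lintegral_mono_ae ((ae_mem_upperHalf α).mono fun w hw => ?_)
      rw [← mul_assoc]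
      gcongr
      exact hker z hz w hw
    have h2 := H f (D.indicator 1) hf (aemeasurable_one.indicator hDm)
    have h3 : ∫⁻ z, D.indicator 1 z ^ 2 * V z ∂A = ∫⁻ z in D, V z ∂A := by
      rw [← lintegral_indicator hDm]
      refine lintegral_congr fun z => ?_
      by_cases hz : z ∈ D <;> simp [hz]
    rw [h3] at h2
    rw [hC', ENNReal.div_eq_inv_mul, mul_assoc, ← ENNReal.div_eq_inv_mul]
    rw [ENNReal.le_div_iff_mul_le (Or.inl (by positivity)) (Or.inl (by finiteness))]
    calc _ = (A D * (∫⁻ w, kerP α Complex.I w * f w ∂A)) ^ 2 := by ring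
      _ ≤ (ENNReal.ofReal (3 ^ (2 + α)) * ∫⁻ z, opP α f z * D.indicator 1 z ∂A) ^ 2 := by gcongr
      _ = ENNReal.ofReal (3 ^ (2 + α)) ^ 2 * (∫⁻ z, opP α f z * D.indicator 1 z ∂A) ^ 2 := by ring
      _ ≤ ENNReal.ofReal (3 ^ (2 + α)) ^ 2 *
          (C * ((∫⁻ z, f z ^ 2 * W z ∂A) * ∫⁻ z in D, V z ∂A)) := by gcongr
      _ = _ := by ring
  -- The converse of Cauchy–Schwarz, in L²(W dA), turns the bounded functional into square
  -- integrability of kV against W, that is, of k against V.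
  have hfin : ∫⁻ w, (kerP α Complex.I w * V w) ^ 2 ∂A.withDensity W ≤ C' := by
    refine lintegral_sq_le_of_forall ((hkm.fun_mul h.aem_right).mono_ac
      (withDensity_absolutelyContinuous _ _)) fun g hg => ?_
    have hgA : AEMeasurable g A :=
      hg.mono_ac (withDensity_absolutelyContinuous' h.aem_left h.ne_zero_ae)
    rw [lintegral_withDensity_eq_lintegral_mul₀ h.aem_left
      ((hkm.fun_mul h.aem_right).fun_mul hgA),
      lintegral_withDensity_eq_lintegral_mul₀ h.aem_left (hgA.pow_const 2)]
    have e1 : ∫⁻ w, (W * fun w => kerP α Complex.I w * V w * g w) w ∂A =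
        ∫⁻ w, kerP α Complex.I w * g w ∂A := by
      refine lintegral_congr_ae (h.mul_eq.mono fun w hw => ?_)
      simp only [Pi.mul_apply]
      calc _ = kerP α Complex.I w * g w * (W w * V w) := by ring
        _ = _ := by rw [hw, mul_one]
    rw [e1]
    refine (key g hgA).trans (le_of_eq ?_)
    congr 1
    exact lintegral_congr fun w => mul_comm _ _
  have := h.symm.lintegral_sq hkm
  rw [this] at hfin
  exact ne_top_of_le_ne_top hC't hfin

/-- Disjoint squares of side 2^n at height 2^n have a fixed proportion of the area scale of the
half-balls of radius 5·2^n about i. By the A_∞ property each carries W-mass bounded below by a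
positive constant independent of n, so the total mass is infinite. -/
lemma measure_hball_tendsto (h : B2Pair α (𝒟₁ ∪ 𝒟₂) W V) (hα : -1 < α)
    (h𝒟 : AreAdjacent 𝒟₁ 𝒟₂) (N : ℝ≥0∞) (hN : N ≠ ⊤) :
    ∃ r₀ : ℝ, ∀ r, r₀ ≤ r → N ≤ (areaMeasure α).withDensity W (hball Complex.I r) := by
  obtain ⟨C, hC, H⟩ := h.sq_measure_mul_le hα h𝒟
  set m := (areaMeasure α).withDensity W with hm
  set E : ℕ → Set ℂ := fun n => rect 0 (0 + 1 * 2 ^ n) (2 ^ n) (2 ^ n + 1 * 2 ^ n) with hE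
  have hEm : ∀ n, MeasurableSet (E n) := fun n => measurableSet_rect _ _ _ _
  have hsub : ∀ n, E n ⊆ hball Complex.I (5 * 2 ^ n) := fun n z hz => by
    have hp : (1 : ℝ) ≤ 2 ^ n := one_le_pow₀ one_le_two
    have h1 := hz.1.1; have h2 := hz.1.2; have h3 := hz.2.1; have h4 := hz.2.2
    refine ⟨by linarith, ?_⟩
    rw [norm_sub_conj_comm, Complex.conj_I]
    refine (Complex.norm_le_abs_re_add_abs_im _).trans_lt ?_
    simp only [sub_neg_eq_add, Complex.add_re, Complex.add_im, Complex.I_re, Complex.I_im, add_zero]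
    rw [abs_of_nonneg h1, abs_of_nonneg (by linarith)]
    linarith
  have hdisj : Pairwise (Function.onFun Disjoint E) := by
    refine (pairwise_disjoint_on E).2 fun i j hij => Set.disjoint_left.2 fun z hz hz' => ?_
    have h1 := hz.2.2; have h2 := hz'.2.1
    have h3 : (2 : ℝ) ^ (i + 1) ≤ 2 ^ j := pow_le_pow_right₀ one_le_two hij
    rw [pow_succ] at h3
    linarith
  have hc := whitneyConst_pos hα (p := 1) (q := 1) one_pos one_pos
  generalize hcdef : 1 * boxConst α * ((1 + 1) ^ (α + 1) - 1) = c at hc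
  have hAE : ∀ n, areaMeasure α (E n) = ENNReal.ofReal (c * (2 ^ n) ^ (2 + α)) := fun n =>
    hcdef ▸ areaMeasure_whitney hα 0 one_pos one_pos (by positivity)
  set κ : ℝ≥0∞ := ENNReal.ofReal c ^ 2 * m (hball Complex.I 5) with hκ
  have hκ0 : κ ≠ 0 := by
    refine mul_ne_zero (pow_ne_zero 2 (ENNReal.ofReal_pos.2 hc).ne') fun h0 => ?_
    have h1 : m (E 0) = 0 := measure_mono_null ((hsub 0).trans (by simp)) h0
    refine h.measure_ne_zero ?_ h1
    rw [hAE]; exact (ENNReal.ofReal_pos.2 (by positivity)).ne'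
  have hlow : ∀ n, κ ≤ C * ENNReal.ofReal (5 ^ (2 + α)) ^ 2 * m (E n) := fun n => by
    have h1 := H Complex.I (5 * 2 ^ n) (E n) (by simp) (by positivity) (hsub n)
    have hmono : m (hball Complex.I 5) ≤ m (hball Complex.I (5 * 2 ^ n)) :=
      measure_mono fun z hz => ⟨hz.1, hz.2.trans_le (by
        have hp : (1 : ℝ) ≤ 2 ^ n := one_le_pow₀ one_le_two
        linarith)⟩
    have hx0 : ENNReal.ofReal (((2 : ℝ) ^ n) ^ (2 + α)) ^ 2 ≠ 0 :=
      pow_ne_zero 2 (ENNReal.ofReal_pos.2 (by positivity)).ne'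
    have h5 : (0 : ℝ) ≤ 5 ^ (2 + α) := by positivity
    rw [hAE, Real.mul_rpow (x := 5) (by positivity) (by positivity), ENNReal.ofReal_mul hc.le,
      ENNReal.ofReal_mul h5] at h1
    rw [← ENNReal.mul_le_mul_iff_left hx0 (by finiteness)]
    calc κ * ENNReal.ofReal (((2 : ℝ) ^ n) ^ (2 + α)) ^ 2
        = (ENNReal.ofReal c * ENNReal.ofReal (((2 : ℝ) ^ n) ^ (2 + α))) ^ 2 *
          m (hball Complex.I 5) := by rw [hκ]; ring
      _ ≤ (ENNReal.ofReal c * ENNReal.ofReal (((2 : ℝ) ^ n) ^ (2 + α))) ^ 2 *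
          m (hball Complex.I (5 * 2 ^ n)) := by gcongr
      _ ≤ _ := h1
      _ = _ := by ring
  have hmU : m (⋃ n, E n) = ⊤ := by
    rw [measure_iUnion hdisj hEm]
    have h1 : ∑' _ : ℕ, κ ≤ C * ENNReal.ofReal (5 ^ (2 + α)) ^ 2 * ∑' n, m (E n) := by
      rw [← ENNReal.tsum_mul_left]; exact ENNReal.tsum_le_tsum hlow
    rw [ENNReal.tsum_const_eq_top_of_ne_zero hκ0, top_le_iff] at h1
    by_contra h2
    exact ENNReal.mul_ne_top (by finiteness) h2 h1
  have hU : (⋃ n, E n) ⊆ ⋃ n : ℕ, hball Complex.I (5 * 2 ^ n) :=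
    iUnion_mono hsub
  have hmono : Monotone fun n : ℕ => hball Complex.I (5 * 2 ^ n) := fun i j hij z hz =>
    ⟨hz.1, hz.2.trans_le (by
      have : (2 : ℝ) ^ i ≤ 2 ^ j := pow_le_pow_right₀ one_le_two hij
      linarith)⟩
  have hlim := tendsto_measure_iUnion_atTop (μ := m) hmono
  have hT : m (⋃ n : ℕ, hball Complex.I (5 * 2 ^ n)) = ⊤ :=
    top_le_iff.1 (hmU.symm.le.trans (measure_mono hU))
  rw [hT] at hlim
  obtain ⟨n, hn⟩ := (hlim.eventually (lt_mem_nhds hN.lt_top)).exists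
  refine ⟨5 * 2 ^ n, fun r hr => hn.le.trans (measure_mono fun z hz => ⟨hz.1, hz.2.trans_le hr⟩)⟩

end B2Pair

end

/-! ### Derivatives of holomorphic functions and area integrals -/

lemma isOpen_upperHalf : IsOpen upperHalf := isOpen_lt continuous_const Complex.continuous_im

lemma measurable_indicator_upperHalf {b : ℂ → ℂ} (hb : DifferentiableOn ℂ b upperHalf) :
    Measurable (upperHalf.indicator b) := by
  classical
  rw [← piecewise_eq_indicator]
  exact hb.continuousOn.measurable_piecewise continuousOn_const measurableSet_upperHalf

lemma closedBall_subset_upperHalf {ζ : ℂ} {r : ℝ} (hr : r < ζ.im) :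
    Metric.closedBall ζ r ⊆ upperHalf := fun w hw => by
  have h1 := (Complex.abs_im_le_norm (w - ζ)).trans (mem_closedBall_iff_norm.1 hw)
  rw [Complex.sub_im] at h1
  have := (abs_le.1 h1).1
  show 0 < w.im
  linarith

/-- Cauchy's formula for the derivative, applied to b - c: the constant c is free and will be the
average of b over a box. -/
lemma enorm_deriv_le_lintegral_circle {b : ℂ → ℂ} (hb : DifferentiableOn ℂ b upperHalf) {ζ : ℂ}
    {r : ℝ} (hr : 0 < r) (hrζ : r < ζ.im) (c : ℂ) :
    ENNReal.ofReal (2 * Real.pi * r) * ‖deriv b ζ‖ₑ ≤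
      ∫⁻ θ in Ioo (-Real.pi) Real.pi, ‖b (circleMap ζ r θ) - c‖ₑ := by
  set g : ℂ → ℂ := fun w => b w - c with hg
  have hgd : DifferentiableOn ℂ g upperHalf := hb.sub_const c
  have hder : deriv g ζ = deriv b ζ := deriv_sub_const c
  have hform := Complex.two_pi_I_inv_smul_circleIntegral_sub_sq_inv_smul_of_differentiable
    isOpen_upperHalf (closedBall_subset_upperHalf hrζ) hgd (Metric.mem_ball_self hr)
  rw [hder, circleIntegral] at hform
  set F : ℝ → ℂ := fun θ => deriv (circleMap ζ r) θ •
    ((circleMap ζ r θ - ζ) ^ 2)⁻¹ • g (circleMap ζ r θ) with hF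
  -- The circle integral runs over (0, 2π) while polar coordinates use (-π, π); periodicity moves
  -- one to the other.
  have hper : Function.Periodic F (2 * Real.pi) := fun θ => by
    simp only [hF, deriv_circleMap, periodic_circleMap _ _ θ]
  have hshift : ∫ θ in (0 : ℝ)..2 * Real.pi, F θ = ∫ θ in (-Real.pi)..Real.pi, F θ := by
    have := hper.intervalIntegral_add_eq 0 (-Real.pi)
    rw [zero_add, show -Real.pi + 2 * Real.pi = Real.pi by ring] at this
    exact this
  rw [hshift, intervalIntegral.integral_of_le (by linarith [Real.pi_pos]),
    integral_Ioc_eq_integral_Ioo] at hform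
  have hn : ∀ θ, ‖F θ‖ₑ = ENNReal.ofReal r⁻¹ * ‖g (circleMap ζ r θ)‖ₑ := fun θ => by
    rw [← ofReal_norm, ← ofReal_norm, ← ENNReal.ofReal_mul (by positivity)]
    congr 1
    simp only [hF, norm_smul, deriv_circleMap, norm_mul, norm_inv, norm_pow, Complex.norm_I,
      circleMap_sub_center, norm_circleMap_zero, abs_of_pos hr]
    field_simp
  have hle : ‖∫ θ in Ioo (-Real.pi) Real.pi, F θ‖ₑ ≤
      ENNReal.ofReal r⁻¹ * ∫⁻ θ in Ioo (-Real.pi) Real.pi, ‖g (circleMap ζ r θ)‖ₑ := by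
    refine (enorm_integral_le_lintegral_enorm _).trans ?_
    simp_rw [hn]
    rw [lintegral_const_mul' _ _ (by simp)]
  have hpi := Real.pi_pos
  have h1 : ‖deriv b ζ‖ₑ = ENNReal.ofReal (2 * Real.pi)⁻¹ * ‖∫ θ in Ioo (-Real.pi) Real.pi, F θ‖ₑ := by
    rw [← hform, enorm_smul, ← ofReal_norm]
    simp [abs_of_pos hpi]
  rw [h1]
  calc _ ≤ ENNReal.ofReal (2 * Real.pi * r) * (ENNReal.ofReal (2 * Real.pi)⁻¹ *
        (ENNReal.ofReal r⁻¹ * ∫⁻ θ in Ioo (-Real.pi) Real.pi, ‖g (circleMap ζ r θ)‖ₑ)) := by gcongr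
    _ = ENNReal.ofReal (2 * Real.pi * r * ((2 * Real.pi)⁻¹ * r⁻¹)) *
        ∫⁻ θ in Ioo (-Real.pi) Real.pi, ‖g (circleMap ζ r θ)‖ₑ := by
      rw [ENNReal.ofReal_mul (p := 2 * Real.pi * r) (by positivity),
        ENNReal.ofReal_mul (p := (2 * Real.pi)⁻¹) (by positivity)]
      ring
    _ = _ := by
      rw [show 2 * Real.pi * r * ((2 * Real.pi)⁻¹ * r⁻¹) = 1 by field_simp]; simp [hg]

lemma enorm_deriv_le_lintegral_ball {b : ℂ → ℂ} (hb : DifferentiableOn ℂ b upperHalf) {ζ : ℂ}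
    (hζ : 0 < ζ.im) (c : ℂ) :
    ENNReal.ofReal (Real.pi / 32 * ζ.im ^ 3) * ‖deriv b ζ‖ₑ ≤
      ∫⁻ w in Metric.ball ζ (ζ.im / 2), ‖b w - c‖ₑ := by
  set y := ζ.im with hy
  set G : ℂ → ℝ≥0∞ := (Metric.ball ζ (y / 2)).indicator fun w => ‖upperHalf.indicator b w - c‖ₑ
    with hG
  have hsub : ∀ w ∈ Metric.ball ζ (y / 2), w ∈ upperHalf := fun w hw =>
    closedBall_subset_upperHalf (by linarith : y / 2 < ζ.im) (Metric.ball_subset_closedBall hw)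
  have hGm : Measurable G :=
    (((measurable_indicator_upperHalf hb).sub_const c).enorm).indicator measurableSet_ball
  have e1 : ∫⁻ w in Metric.ball ζ (y / 2), ‖b w - c‖ₑ = ∫⁻ w, G w := by
    rw [← lintegral_indicator measurableSet_ball]
    refine lintegral_congr fun w => ?_
    by_cases hw : w ∈ Metric.ball ζ (y / 2)
    · simp [hG, hw, hsub w hw]
    · simp [hG, hw]
  rw [e1, ← lintegral_add_left_eq_self (μ := volume) G ζ,
    ← Complex.lintegral_comp_polarCoord_symm fun u => G (ζ + u)]
  have hpi := Real.pi_pos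
  -- Only the annulus y/4 < r < y/2 is kept. There 2πr² ≥ πy²/8, and integration over a length y/4
  -- gives the constant π/32.
  have hsubt : Ioo (y / 4) (y / 2) ×ˢ Ioo (-Real.pi) Real.pi ⊆ polarCoord.target := fun p hp =>
    ⟨show (0 : ℝ) < p.1 by have := hp.1.1; linarith, hp.2⟩
  refine le_trans ?_ (lintegral_mono_set hsubt)
  rw [Measure.volume_eq_prod, ← Measure.prod_restrict, lintegral_prod]
  · calc _ = ∫⁻ _ in Ioo (y / 4) (y / 2), ENNReal.ofReal (Real.pi / 8 * y ^ 2) * ‖deriv b ζ‖ₑ := by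
          rw [setLIntegral_const, Real.volume_Ioo, mul_right_comm,
            ← ENNReal.ofReal_mul (by positivity)]
          congr 2; ring
      _ ≤ _ := by
        refine setLIntegral_mono' measurableSet_Ioo fun r hr => ?_
        have hr0 : 0 < r := by linarith [hr.1]
        have h1 := enorm_deriv_le_lintegral_circle hb hr0 (by linarith [hr.2] : r < ζ.im) c
        have h2 : ∫⁻ θ in Ioo (-Real.pi) Real.pi, ENNReal.ofReal (r, θ).1 •
            G (ζ + Complex.polarCoord.symm (r, θ)) =
            ENNReal.ofReal r * ∫⁻ θ in Ioo (-Real.pi) Real.pi, ‖b (circleMap ζ r θ) - c‖ₑ := by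
          rw [← lintegral_const_mul' _ _ (by simp)]
          refine lintegral_congr fun θ => ?_
          have h3 : ζ + Complex.polarCoord.symm (r, θ) = circleMap ζ r θ := by
            rw [Complex.polarCoord_symm_apply, circleMap, Complex.exp_mul_I]; push_cast; rfl
          have h4 : circleMap ζ r θ ∈ Metric.ball ζ (y / 2) := by
            rw [mem_ball_iff_norm, circleMap_sub_center, norm_circleMap_zero, abs_of_pos hr0]
            exact hr.2
          rw [h3]
          simp [hG, h4, hsub _ h4]
        rw [h2]
        calc _ ≤ ENNReal.ofReal r * (ENNReal.ofReal (2 * Real.pi * r) * ‖deriv b ζ‖ₑ) := by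
              rw [← mul_assoc, ← ENNReal.ofReal_mul hr0.le]
              refine mul_le_mul_left (ENNReal.ofReal_le_ofReal ?_) _
              have : (y / 4) ^ 2 ≤ r ^ 2 := by gcongr; exact hr.1.le
              nlinarith
          _ ≤ _ := by gcongr
  · have hm : Measurable fun p : ℝ × ℝ => ζ + Complex.polarCoord.symm p := by
      simp_rw [Complex.polarCoord_symm_apply]
      fun_prop
    exact ((measurable_fst.ennreal_ofReal).smul (hGm.comp hm)).aemeasurable

/-- On this disc y/2 < Im w < 3y/2, so the density is at least a multiple of y^α; the sign of α
decides which of the two bounds on Im w is used. -/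
lemma smul_volume_restrict_ball_le {α : ℝ} (hα : -1 < α) :
    ∃ κ : ℝ, 0 < κ ∧ ∀ ζ : ℂ, 0 < ζ.im →
      ENNReal.ofReal (κ * ζ.im ^ α) • volume.restrict (Metric.ball ζ (ζ.im / 2)) ≤
        (areaMeasure α).restrict (Metric.ball ζ (ζ.im / 2)) := by
  have hpi := Real.pi_pos
  have hα1 : 0 < α + 1 := by linarith
  refine ⟨1 / Real.pi * (α + 1) * min 1 (3 ^ α), by positivity, fun ζ hζ => ?_⟩
  have hsub : Metric.ball ζ (ζ.im / 2) ⊆ upperHalf := fun w hw =>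
    closedBall_subset_upperHalf (by linarith : ζ.im / 2 < ζ.im) (Metric.ball_subset_closedBall hw)
  refine Measure.le_iff.2 fun s hs => ?_
  rw [Measure.smul_apply, Measure.restrict_apply hs, Measure.restrict_apply hs, areaMeasure,
    withDensity_apply _ (hs.inter measurableSet_ball),
    Measure.restrict_restrict (hs.inter measurableSet_ball),
    inter_eq_left.2 (inter_subset_right.trans hsub), smul_eq_mul, ← setLIntegral_const]
  refine setLIntegral_mono' (hs.inter measurableSet_ball) fun w hw => ENNReal.ofReal_le_ofReal ?_
  have h1 := (Complex.abs_im_le_norm (w - ζ)).trans_lt (mem_ball_iff_norm.1 hw.2)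
  rw [Complex.sub_im] at h1
  obtain ⟨h2, h3⟩ := abs_lt.1 h1
  rw [mul_assoc]
  gcongr
  rcases le_total 0 α with h0 | h0
  · calc min 1 (3 ^ α) * ζ.im ^ α ≤ 1 * ζ.im ^ α := by gcongr; exact min_le_left _ _
      _ ≤ (2 * w.im) ^ α := by rw [one_mul]; exact Real.rpow_le_rpow hζ.le (by linarith) h0
  · calc min 1 (3 ^ α) * ζ.im ^ α ≤ 3 ^ α * ζ.im ^ α := by gcongr; exact min_le_right _ _
      _ = (3 * ζ.im) ^ α := (Real.mul_rpow (by norm_num) hζ.le).symm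
      _ ≤ (2 * w.im) ^ α := Real.rpow_le_rpow_of_nonpos (by linarith) (by linarith) h0

lemma enorm_deriv_mul_le {α : ℝ} (hα : -1 < α) :
    ∃ C : ℝ≥0∞, C ≠ ⊤ ∧ ∀ b : ℂ → ℂ, DifferentiableOn ℂ b upperHalf → ∀ ζ : ℂ, 0 < ζ.im → ∀ c : ℂ,
      ‖deriv b ζ‖ₑ * ENNReal.ofReal (ζ.im ^ (3 + α)) ≤
        C * ∫⁻ w in Metric.ball ζ (ζ.im / 2), ‖b w - c‖ₑ ∂areaMeasure α := by
  obtain ⟨κ, hκ, H⟩ := smul_volume_restrict_ball_le hα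
  have hpi := Real.pi_pos
  refine ⟨ENNReal.ofReal (32 / (Real.pi * κ)), by simp, fun b hb ζ hζ c => ?_⟩
  have h1 := enorm_deriv_le_lintegral_ball hb hζ c
  have h2 := lintegral_mono' (H ζ hζ) (le_refl fun w => ‖b w - c‖ₑ)
  rw [lintegral_smul_measure, smul_eq_mul] at h2
  have e : ζ.im ^ (3 + α) = 32 / (Real.pi * κ) * (κ * ζ.im ^ α) * (Real.pi / 32 * ζ.im ^ 3) := by
    rw [Real.rpow_add hζ]
    norm_cast
    field_simp
  calc _ = ENNReal.ofReal (32 / (Real.pi * κ)) * (ENNReal.ofReal (κ * ζ.im ^ α) *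
        (ENNReal.ofReal (Real.pi / 32 * ζ.im ^ 3) * ‖deriv b ζ‖ₑ)) := by
        rw [e, ENNReal.ofReal_mul (by positivity), ENNReal.ofReal_mul (by positivity)]; ring
    _ ≤ ENNReal.ofReal (32 / (Real.pi * κ)) * (ENNReal.ofReal (κ * ζ.im ^ α) *
        ∫⁻ w in Metric.ball ζ (ζ.im / 2), ‖b w - c‖ₑ) := by gcongr
    _ ≤ _ := by gcongr

/-! ### The pointwise bound of the commutator kernel -/

lemma hball_subset {z ζ : ℂ} {r R : ℝ} (h : ‖z - ζ‖ + r ≤ R) : hball ζ r ⊆ hball z R :=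
  fun w hw => ⟨hw.1, by
    have := norm_sub_conj_le_add_norm_sub z ζ w
    linarith [hw.2]⟩

lemma segment_subset_upperHalf {p q : ℂ} (hp : 0 < p.im) (hq : 0 < q.im) :
    segment ℝ p q ⊆ upperHalf := by
  have hc : Convex ℝ upperHalf := convex_halfSpace_im_gt 0
  exact hc.segment_subset hp hq

lemma enorm_sub_le_of_segment {b : ℂ → ℂ} (hb : DifferentiableOn ℂ b upperHalf) {p q : ℂ}
    (hp : 0 < p.im) (hq : 0 < q.im) {M : ℝ≥0∞} (hM : ∀ ζ ∈ segment ℝ p q, ‖deriv b ζ‖ₑ ≤ M) :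
    ‖b q - b p‖ₑ ≤ M * ‖q - p‖ₑ := by
  rcases eq_or_ne M ⊤ with rfl | hM'
  · rcases eq_or_ne q p with rfl | hne
    · simp
    · rw [ENNReal.top_mul]
      · exact le_top
      · simpa [sub_eq_zero] using hne
  · have h := (convex_segment p q).norm_image_sub_le_of_norm_deriv_le (𝕜 := ℂ) (f := b) (C := M.toReal)
      (fun ζ hζ => hb.differentiableAt (isOpen_upperHalf.mem_nhds
        (segment_subset_upperHalf hp hq hζ)))
      (fun ζ hζ => by
        have := ENNReal.toReal_mono hM' (hM ζ hζ)
        simpa using this)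
      (left_mem_segment ℝ p q) (right_mem_segment ℝ p q)
    rw [← ofReal_norm, ← ofReal_norm, ← ENNReal.ofReal_toReal hM',
      ← ENNReal.ofReal_mul ENNReal.toReal_nonneg]
    exact ENNReal.ofReal_le_ofReal h

/-- The derivative of `b` is controlled, on the scale of the distance to the real line, by the
measure `ρ`. -/
def DerivBound (α : ℝ) (b : ℂ → ℂ) (ρ : Measure ℂ) : Prop :=
  ∀ ζ : ℂ, 0 < ζ.im → ‖deriv b ζ‖ₑ * ENNReal.ofReal (ζ.im ^ (3 + α)) ≤ ρ (hball ζ (8 * ζ.im))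

/-- The segment stays at heights between τ and 2τ and within 3τ of z, so every half-ball used for b'
lies in the one of radius 3τ + 16τ = 19τ about z, and the segment has length at most 6τ. -/
lemma DerivBound.segment_le {α : ℝ} (hα : -1 < α) {b : ℂ → ℂ} {ρ : Measure ℂ}
    (hb : DifferentiableOn ℂ b upperHalf) (h : DerivBound α b ρ) {z p q : ℂ} {τ : ℝ} (hτ : 0 < τ)
    (hp : p.im ∈ Icc τ (2 * τ)) (hq : q.im ∈ Icc τ (2 * τ)) (hpz : ‖p - z‖ ≤ 3 * τ)
    (hqz : ‖q - z‖ ≤ 3 * τ) :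
    ‖b q - b p‖ₑ ≤ ENNReal.ofReal (6 * τ ^ (-(2 + α))) * ρ (hball z (19 * τ)) := by
  have hM : ∀ ζ ∈ segment ℝ p q, ‖deriv b ζ‖ₑ ≤
      ENNReal.ofReal (τ ^ (-(3 + α))) * ρ (hball z (19 * τ)) := fun ζ hζ => by
    have h1 : ζ.im ∈ Icc τ (2 * τ) := by
      have hc : Convex ℝ {w : ℂ | w.im ∈ Icc τ (2 * τ)} :=
        (convex_Icc τ (2 * τ)).linear_preimage Complex.imLm
      exact hc.segment_subset hp hq hζ
    have h2 : ‖ζ - z‖ ≤ 3 * τ := by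
      have := (convex_closedBall z (3 * τ)).segment_subset (mem_closedBall_iff_norm.2 hpz)
        (mem_closedBall_iff_norm.2 hqz) hζ
      exact mem_closedBall_iff_norm.1 this
    have hζ0 : 0 < ζ.im := hτ.trans_le h1.1
    have h3 := h ζ hζ0
    have h4 : hball ζ (8 * ζ.im) ⊆ hball z (19 * τ) := hball_subset (by
      rw [norm_sub_rev]; linarith [h1.2])
    have h5 : τ ^ (3 + α) ≤ ζ.im ^ (3 + α) := Real.rpow_le_rpow hτ.le h1.1 (by linarith)
    calc ‖deriv b ζ‖ₑ = ENNReal.ofReal (τ ^ (-(3 + α))) *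
          (‖deriv b ζ‖ₑ * ENNReal.ofReal (τ ^ (3 + α))) := by
          rw [mul_comm, mul_assoc, ← ENNReal.ofReal_mul (by positivity), ← Real.rpow_add hτ]
          simp
      _ ≤ ENNReal.ofReal (τ ^ (-(3 + α))) * (‖deriv b ζ‖ₑ * ENNReal.ofReal (ζ.im ^ (3 + α))) := by
          gcongr
      _ ≤ _ := by
          gcongr
          exact h3.trans (measure_mono h4)
  refine (enorm_sub_le_of_segment hb (hτ.trans_le hp.1) (hτ.trans_le hq.1) hM).trans ?_
  have h6 : ‖q - p‖ₑ ≤ ENNReal.ofReal (6 * τ) := by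
    rw [← ofReal_norm]
    apply ENNReal.ofReal_le_ofReal
    have := norm_sub_le_norm_sub_add_norm_sub q z p
    rw [norm_sub_rev z p] at this
    linarith
  calc _ ≤ ENNReal.ofReal (τ ^ (-(3 + α))) * ρ (hball z (19 * τ)) * ENNReal.ofReal (6 * τ) := by
        gcongr
    _ = ENNReal.ofReal (6 * (τ ^ (-(3 + α)) * τ)) * ρ (hball z (19 * τ)) := by
        rw [show 6 * (τ ^ (-(3 + α)) * τ) = τ ^ (-(3 + α)) * (6 * τ) by ring,
          ENNReal.ofReal_mul (p := τ ^ (-(3 + α))) (by positivity)]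
        ring
    _ = _ := by
        rw [← Real.rpow_add_one hτ.ne']
        congr 4; ring

/-- A truncated geometric series. -/
lemma sum_geom_le {s : ℝ} (hs : 1 ≤ s) {d : ℝ} (hd : 0 < d) (n : ℕ) : ∀ y : ℝ, 0 < y →
    ∑ k ∈ Finset.range n, (if d < 2 ^ k * y then (2 ^ k * y) ^ (-s) else 0) ≤
      2 * (max y d) ^ (-s) := by
  induction n with
  | zero => intro y hy; simp; positivity
  | succ n ih =>
    intro y hy
    rw [Finset.sum_range_succ']
    have h1 := ih (2 * y) (by linarith)
    have e : ∀ k : ℕ, (2 : ℝ) ^ (k + 1) * y = 2 ^ k * (2 * y) := fun k => by rw [pow_succ]; ring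
    simp only [e, pow_zero, one_mul]
    -- If y itself counts, the remaining terms contribute at most 2(2y)^(-s) ≤ y^(-s), because s ≥
    -- 1; otherwise the series effectively starts at 2y.
    by_cases hdy : d < y
    · rw [if_pos hdy, max_eq_left hdy.le]
      rw [max_eq_left (by linarith), Real.mul_rpow two_pos.le hy.le] at h1
      have h2 : (2 : ℝ) ^ (-s) ≤ 2 ^ (-1 : ℝ) := Real.rpow_le_rpow_of_exponent_le one_le_two (by linarith)
      rw [Real.rpow_neg_one] at h2
      have h3 : 0 < y ^ (-s) := by positivity
      nlinarith
    · rw [if_neg hdy, add_zero]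
      refine h1.trans ?_
      have : max (2 * y) d ^ (-s) ≤ max y d ^ (-s) :=
        Real.rpow_le_rpow_of_nonpos (by positivity) (max_le_max (by linarith) le_rfl) (by linarith)
      linarith

/-- Climbs vertically from z, doubling the height at each step, so that every step stays at a single
scale. -/
lemma DerivBound.chain_le {α : ℝ} (hα : -1 < α) {b : ℂ → ℂ} {ρ : Measure ℂ}
    (hb : DifferentiableOn ℂ b upperHalf) (h : DerivBound α b ρ) {z : ℂ} (hz : 0 < z.im) (n : ℕ) :
    ‖b ⟨z.re, 2 ^ n * z.im⟩ - b z‖ₑ ≤ ∑ k ∈ Finset.range n,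
      ENNReal.ofReal (6 * (2 ^ k * z.im) ^ (-(2 + α))) * ρ (hball z (19 * (2 ^ k * z.im))) := by
  induction n with
  | zero => simp
  | succ n ih =>
    rw [Finset.sum_range_succ]
    set p : ℂ := ⟨z.re, 2 ^ n * z.im⟩ with hp
    set q : ℂ := ⟨z.re, 2 ^ (n + 1) * z.im⟩ with hq
    have hp1 : (1 : ℝ) ≤ 2 ^ n := one_le_pow₀ one_le_two
    have hτ : z.im ≤ 2 ^ n * z.im := by nlinarith
    have hnorm : ∀ t : ℝ, z.im ≤ t → ‖(⟨z.re, t⟩ : ℂ) - z‖ ≤ t := fun t ht => by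
      refine (Complex.norm_le_abs_re_add_abs_im _).trans ?_
      simp only [Complex.sub_re, Complex.sub_im, sub_self, abs_zero, zero_add]
      rw [abs_of_nonneg (by linarith)]; linarith
    have h1 : ‖b q - b p‖ₑ ≤ ENNReal.ofReal (6 * (2 ^ n * z.im) ^ (-(2 + α))) *
        ρ (hball z (19 * (2 ^ n * z.im))) := by
      refine h.segment_le hα hb (by positivity) ⟨le_rfl, ?_⟩ ⟨?_, ?_⟩ ?_ ?_
      · simp only [hp]; linarith
      · simp only [hq, pow_succ]; nlinarith
      · simp only [hq, pow_succ]; nlinarith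
      · exact (hnorm _ hτ).trans (by linarith)
      · refine (hnorm _ (by rw [pow_succ]; nlinarith)).trans ?_
        rw [pow_succ]; nlinarith
    calc _ = ‖(b p - b z) + (b q - b p)‖ₑ := by congr 1; ring
      _ ≤ ‖b p - b z‖ₑ + ‖b q - b p‖ₑ := enorm_add_le _ _
      _ ≤ _ := add_le_add ih h1

/-- The triangle inequality gives |w - ζ̄| ≤ |w - z| + |z - ζ̄| ≤ (1 + 19)|z - w̄|. -/
lemma kerP_mul_kerP_ge {α : ℝ} (hα : -1 < α) {z w ζ : ℂ} (hz : 0 < z.im) (hw : 0 < w.im)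
    (hζ : ζ ∈ hball z (19 * ‖z - conj w‖)) :
    kerP α z w ≤ ENNReal.ofReal (20 ^ (2 + α)) * kerP α w ζ := by
  refine kerP_le_of_le hα hz hw hw hζ.1 (by norm_num) ?_
  have h1 := norm_sub_conj_le_add_norm_sub w z ζ
  have h2 := norm_sub_le_norm_sub_conj hz.le hw.le
  rw [norm_sub_rev w z] at h1
  linarith [hζ.2]

/-- The sum along a vertical chain, in integrated form. -/
lemma chain_sum_le {α : ℝ} (hα : -1 < α) (ρ : Measure ℂ) {z w : ℂ} (hz : 0 < z.im)
    (hw : 0 < w.im) {n : ℕ} (hn : ∀ k < n, 2 ^ k * z.im ≤ ‖z - conj w‖) :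
    kerP α z w * ∑ k ∈ Finset.range n,
      ENNReal.ofReal (6 * (2 ^ k * z.im) ^ (-(2 + α))) * ρ (hball z (19 * (2 ^ k * z.im))) ≤
    ENNReal.ofReal (12 * 19 ^ (2 + α) * 20 ^ (2 + α)) * ∫⁻ ζ, kerP α z ζ * kerP α w ζ ∂ρ := by
  have e1 : ∀ k, ENNReal.ofReal (6 * (2 ^ k * z.im) ^ (-(2 + α))) *
      ρ (hball z (19 * (2 ^ k * z.im))) = ∫⁻ ζ, (hball z (19 * (2 ^ k * z.im))).indicator
        (fun _ => ENNReal.ofReal (6 * (2 ^ k * z.im) ^ (-(2 + α)))) ζ ∂ρ := fun k => by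
    rw [lintegral_indicator_const (measurableSet_hball _ _)]
  simp_rw [e1]
  have hm : ∀ k, Measurable ((hball z (19 * (2 ^ k * z.im))).indicator
        (fun _ => ENNReal.ofReal (6 * (2 ^ k * z.im) ^ (-(2 + α))))) := fun k =>
    measurable_const.indicator (measurableSet_hball _ _)
  rw [← lintegral_finsetSum _ fun k _ => hm k, ← lintegral_const_mul' _ _ (kerP_ne_top _ _ _),
    ← lintegral_const_mul' _ _ (by simp)]
  refine lintegral_mono fun ζ => ?_
  by_cases hζ : ζ ∈ hball z (19 * ‖z - conj w‖)
  · have hd := norm_sub_conj_pos hz hζ.1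
    -- For fixed ζ only the scales with |z - ζ̄| < 19·2^k y contribute, and the truncated geometric
    -- series is comparable to its first term, a multiple of the kernel at (z, ζ).
    have h1 : ∑ k ∈ Finset.range n, (hball z (19 * (2 ^ k * z.im))).indicator
        (fun _ => ENNReal.ofReal (6 * (2 ^ k * z.im) ^ (-(2 + α)))) ζ ≤
        ENNReal.ofReal (12 * 19 ^ (2 + α)) * kerP α z ζ := by
      have h2 := sum_geom_le (s := 2 + α) (by linarith) (d := ‖z - conj ζ‖ / 19) (by positivity) n
        z.im hz
      have h3 : max z.im (‖z - conj ζ‖ / 19) ^ (-(2 + α)) ≤ 19 ^ (2 + α) * ‖z - conj ζ‖ ^ (-(2 + α)) := by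
        refine rpow_neg_le_of_le_mul (by linarith) (by positivity) (by norm_num) ?_ hd
        have := le_max_right z.im (‖z - conj ζ‖ / 19)
        linarith
      calc _ = ENNReal.ofReal (6 * ∑ k ∈ Finset.range n,
            (if ‖z - conj ζ‖ / 19 < 2 ^ k * z.im then (2 ^ k * z.im) ^ (-(2 + α)) else 0)) := by
            rw [Finset.mul_sum, ENNReal.ofReal_sum_of_nonneg fun k _ => by positivity]
            refine Finset.sum_congr rfl fun k _ => ?_
            by_cases hk : ‖z - conj ζ‖ / 19 < 2 ^ k * z.im
            · have : ζ ∈ hball z (19 * (2 ^ k * z.im)) := ⟨hζ.1, by linarith⟩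
              rw [indicator_of_mem this, if_pos hk]
            · have : ζ ∉ hball z (19 * (2 ^ k * z.im)) := fun hc => hk (by linarith [hc.2])
              rw [indicator_of_notMem this, if_neg hk]; simp
        _ ≤ _ := by
            rw [kerP, ← ENNReal.ofReal_mul (by positivity)]
            apply ENNReal.ofReal_le_ofReal
            nlinarith
    calc _ ≤ (ENNReal.ofReal (20 ^ (2 + α)) * kerP α w ζ) *
          (ENNReal.ofReal (12 * 19 ^ (2 + α)) * kerP α z ζ) := by
          gcongr
          exact kerP_mul_kerP_ge hα hz hw hζ
      _ = _ := by rw [ENNReal.ofReal_mul (p := 12 * 19 ^ (2 + α)) (by positivity)]; ring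
  · have : ∑ k ∈ Finset.range n, (hball z (19 * (2 ^ k * z.im))).indicator
        (fun _ => ENNReal.ofReal (6 * (2 ^ k * z.im) ^ (-(2 + α)))) ζ = 0 := by
      refine Finset.sum_eq_zero fun k hk => indicator_of_notMem (fun hc => hζ ⟨hc.1, ?_⟩) _
      have := hn k (Finset.mem_range.1 hk)
      linarith [hc.2]
    rw [this]; simp

/-- The first doubling that exceeds D overshoots by at most a factor 2, while all earlier heights
stay below D. -/
lemma exists_pow_mul {y D : ℝ} (hy : 0 < y) (hyD : y ≤ D) :
    ∃ n : ℕ, D ≤ 2 ^ n * y ∧ 2 ^ n * y ≤ 2 * D ∧ ∀ k < n, 2 ^ k * y ≤ D := by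
  obtain ⟨m, h1, h2⟩ := exists_nat_pow_near ((one_le_div hy).2 hyD) one_lt_two
  rw [le_div_iff₀ hy] at h1
  rw [div_lt_iff₀ hy] at h2
  refine ⟨m + 1, h2.le, by rw [pow_succ]; linarith, fun k hk => le_trans ?_ h1⟩
  gcongr
  · exact one_le_two
  · omega

/-- The kernel of the commutator is dominated by the kernel of the composition of two positive
Bergman operators with the measure `ρ` in between. -/
theorem DerivBound.enorm_sub_mul_kerP_le {α : ℝ} (hα : -1 < α) :
    ∃ C : ℝ≥0∞, C ≠ ⊤ ∧ ∀ (b : ℂ → ℂ) (ρ : Measure ℂ), DifferentiableOn ℂ b upperHalf →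
      DerivBound α b ρ → ∀ z w : ℂ, 0 < z.im → 0 < w.im →
        ‖b z - b w‖ₑ * kerP α z w ≤ C * ∫⁻ ζ, kerP α z ζ * kerP α w ζ ∂ρ := by
  set c := ENNReal.ofReal (12 * 19 ^ (2 + α) * 20 ^ (2 + α)) with hc
  refine ⟨3 * c, by finiteness, fun b ρ hb h z w hz hw => ?_⟩
  set D := ‖z - conj w‖ with hD
  have hD0 : 0 < D := norm_sub_conj_pos hz hw
  have him := im_add_im_le_norm_sub_conj z w
  -- Both points are raised to heights in [D, 2D]. The raised points are joined by one segment at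
  -- scale D, so b(z) - b(w) splits into two vertical chains and this segment.
  obtain ⟨n, hn1, hn2, hn3⟩ := exists_pow_mul hz (by linarith : z.im ≤ D)
  obtain ⟨m, hm1, hm2, hm3⟩ := exists_pow_mul hw (by linarith : w.im ≤ D)
  set X := ∫⁻ ζ, kerP α z ζ * kerP α w ζ ∂ρ with hX
  set p : ℂ := ⟨z.re, 2 ^ n * z.im⟩ with hp
  set q : ℂ := ⟨w.re, 2 ^ m * w.im⟩ with hq
  have hnorm : ∀ (u : ℂ) (t : ℝ), 0 ≤ u.im → u.im ≤ t → ‖(⟨u.re, t⟩ : ℂ) - u‖ ≤ t := fun u t h0 ht => by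
    refine (Complex.norm_le_abs_re_add_abs_im _).trans ?_
    simp only [Complex.sub_re, Complex.sub_im, sub_self, abs_zero, zero_add]
    rw [abs_of_nonneg (by linarith)]; linarith
  have h1 : kerP α z w * ‖b p - b z‖ₑ ≤ c * X :=
    (mul_le_mul_right (h.chain_le hα hb hz n) _).trans (chain_sum_le hα ρ hz hw hn3)
  have h2 : kerP α z w * ‖b q - b w‖ₑ ≤ c * X := by
    have := (mul_le_mul_right (h.chain_le hα hb hw m) (kerP α w z)).trans
      (chain_sum_le hα ρ hw hz (fun k hk => by rw [norm_sub_conj_comm]; exact hm3 k hk))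
    have e : X = ∫⁻ ζ, kerP α w ζ * kerP α z ζ ∂ρ := lintegral_congr fun ζ => mul_comm _ _
    rw [kerP_comm, e]
    exact this
  have h3 : kerP α z w * ‖b q - b p‖ₑ ≤ c * X := by
    have hseg : ‖b q - b p‖ₑ ≤ ENNReal.ofReal (6 * D ^ (-(2 + α))) * ρ (hball z (19 * D)) := by
      refine h.segment_le hα hb hD0 ⟨hn1, hn2⟩ ⟨hm1, hm2⟩ ?_ ?_
      · exact (hnorm z _ hz.le (by linarith)).trans (by linarith)
      · have e1 := norm_sub_le_norm_sub_add_norm_sub q w z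
        have e2 := hnorm w (2 ^ m * w.im) hw.le (by linarith)
        have e3 := norm_sub_le_norm_sub_conj hz.le hw.le
        rw [norm_sub_rev] at e3
        linarith
    refine (mul_le_mul_right hseg _).trans ?_
    rw [← lintegral_indicator_const (measurableSet_hball _ _),
      ← lintegral_const_mul' _ _ (kerP_ne_top _ _ _), hX, ← lintegral_const_mul' _ _ (by simp [hc])]
    refine lintegral_mono fun ζ => ?_
    by_cases hζ : ζ ∈ hball z (19 * D)
    · rw [indicator_of_mem hζ]
      have k1 := kerP_mul_kerP_ge hα hz hw hζ
      have k2 : ENNReal.ofReal (6 * D ^ (-(2 + α))) ≤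
          ENNReal.ofReal (12 * 19 ^ (2 + α)) * kerP α z ζ := by
        rw [kerP, ← ENNReal.ofReal_mul (by positivity)]
        apply ENNReal.ofReal_le_ofReal
        have := rpow_neg_le_of_le_mul (s := 2 + α) (by linarith) hD0 (by norm_num : (0 : ℝ) < 19)
          hζ.2.le (norm_sub_conj_pos hz hζ.1)
        have h0 : 0 < (19 : ℝ) ^ (2 + α) * ‖z - conj ζ‖ ^ (-(2 + α)) := by
          have := norm_sub_conj_pos hz hζ.1
          positivity
        nlinarith
      calc _ ≤ (ENNReal.ofReal (20 ^ (2 + α)) * kerP α w ζ) *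
            (ENNReal.ofReal (12 * 19 ^ (2 + α)) * kerP α z ζ) := by gcongr
        _ = _ := by rw [hc, ENNReal.ofReal_mul (p := 12 * 19 ^ (2 + α)) (by positivity)]; ring
    · rw [indicator_of_notMem hζ]; simp
  calc ‖b z - b w‖ₑ * kerP α z w
      = kerP α z w * ‖(b q - b w) - (b p - b z) - (b q - b p)‖ₑ := by
        rw [mul_comm]; congr 2; ring
    _ ≤ kerP α z w * (‖b q - b w‖ₑ + ‖b p - b z‖ₑ + ‖b q - b p‖ₑ) := by
        gcongr
        exact (enorm_sub_le).trans (add_le_add_left enorm_sub_le _)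
    _ ≤ c * X + c * X + c * X := by
        rw [mul_add, mul_add]
        exact add_le_add (add_le_add h2 h1) h3
    _ = _ := by ring

/-! ### Vanishing of the derivative at the boundary -/

/-- Points of the upper half plane at definite distance from the boundary and from `∞`. -/
def deepPart (R : ℝ) : Set ℂ := {ζ | R⁻¹ ≤ ζ.im ∧ ‖ζ‖ ≤ R}

lemma measurableSet_deepPart (R : ℝ) : MeasurableSet (deepPart R) :=
  (measurableSet_le measurable_const Complex.measurable_im).inter
    (measurableSet_le measurable_norm measurable_const)

/-- The derivative of `b` is negligible near the boundary, compared to the measure `m`. -/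
def DerivVanish (α : ℝ) (b : ℂ → ℂ) (m : Measure ℂ) : Prop :=
  ∀ ε : ℝ≥0∞, ε ≠ 0 → ∃ R : ℝ, 0 < R ∧ ∀ ζ : ℂ, 0 < ζ.im → ζ ∉ deepPart R →
    ‖deriv b ζ‖ₑ * ENNReal.ofReal (ζ.im ^ (3 + α)) ≤ ε * m (hball ζ (8 * ζ.im))

/-- A small rectangle near `ζ`. -/
def cell (ζ : ℂ) : Set ℂ := rect ζ.re (ζ.re + 1 / 4 * ζ.im) ζ.im (ζ.im + 1 / 4 * ζ.im)

lemma norm_sub_le_of_mem_cell {ζ w : ℂ} (hw : w ∈ cell ζ) : ‖w - ζ‖ ≤ 1 / 2 * ζ.im := by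
  refine (Complex.norm_le_abs_re_add_abs_im _).trans ?_
  obtain ⟨⟨h1, h2⟩, h3, h4⟩ := hw
  rw [Complex.sub_re, Complex.sub_im, abs_of_nonneg (by linarith), abs_of_nonneg (by linarith)]
  linarith

lemma norm_sub_conj_self {ζ : ℂ} (hζ : 0 < ζ.im) : ‖ζ - conj ζ‖ = 2 * ζ.im := by
  rw [Complex.sub_conj, norm_mul, Complex.norm_I, mul_one, Complex.norm_real, Real.norm_eq_abs,
    abs_of_pos (by linarith)]

lemma mem_hball_of_norm_sub_le {ζ w : ℂ} {r s : ℝ} (hζ : 0 < ζ.im) (hw : 0 < w.im)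
    (h : ‖w - ζ‖ ≤ r) (hs : r + 2 * ζ.im < s) : w ∈ hball ζ s := by
  refine ⟨hw, ?_⟩
  have h1 := norm_sub_conj_le_add_norm_sub w ζ ζ
  rw [norm_sub_conj_self hζ, norm_sub_conj_comm] at h1
  linarith

lemma cell_subset_hball {ζ : ℂ} (hζ : 0 < ζ.im) : cell ζ ⊆ hball ζ (8 * ζ.im) := fun _ hw =>
  mem_hball_of_norm_sub_le hζ (hζ.trans_le hw.2.1) (norm_sub_le_of_mem_cell hw) (by linarith)

lemma exists_area_cell {α : ℝ} (hα : -1 < α) : ∃ c : ℝ, 0 < c ∧ ∀ ζ : ℂ, 0 < ζ.im →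
    areaMeasure α (cell ζ) = ENNReal.ofReal (c * ζ.im ^ (2 + α)) :=
  ⟨_, whitneyConst_pos hα (p := 1 / 4) (q := 1 / 4) (by norm_num) (by norm_num), fun _ hζ =>
    areaMeasure_whitney hα _ (by norm_num) (by norm_num) hζ⟩

section

variable {α : ℝ} {𝒟₁ 𝒟₂ : Set (ℝ × ℝ)} {W V : ℂ → ℝ≥0∞}

/-- Doubling. -/
lemma B2Pair.measure_hball_le (h : B2Pair α (𝒟₁ ∪ 𝒟₂) W V) (hα : -1 < α)
    (h𝒟 : AreAdjacent 𝒟₁ 𝒟₂) {Λ : ℝ} (hΛ : 8 ≤ Λ) :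
    ∃ C : ℝ≥0∞, C ≠ ⊤ ∧ ∀ ζ : ℂ, 0 < ζ.im →
      (areaMeasure α).withDensity W (hball ζ (Λ * ζ.im)) ≤
        C * (areaMeasure α).withDensity W (hball ζ (8 * ζ.im)) := by
  obtain ⟨C, hC, H⟩ := h.sq_measure_mul_le hα h𝒟
  obtain ⟨c, hc, hcell⟩ := exists_area_cell hα
  have hc' : ENNReal.ofReal c ≠ 0 := (ENNReal.ofReal_pos.2 hc).ne'
  have hΛ0 : (0 : ℝ) ≤ Λ ^ (2 + α) := by positivity
  refine ⟨C * ENNReal.ofReal (Λ ^ (2 + α)) ^ 2 / ENNReal.ofReal c ^ 2,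
    ENNReal.div_ne_top (by finiteness) (by positivity), fun ζ hζ => ?_⟩
  have hsub : hball ζ (8 * ζ.im) ⊆ hball ζ (Λ * ζ.im) := hball_subset (by
    rw [sub_self, norm_zero]; nlinarith)
  have h1 := H ζ (Λ * ζ.im) _ hζ (by positivity) hsub
  have h2 := measure_mono (μ := areaMeasure α) (cell_subset_hball hζ)
  rw [hcell ζ hζ, ENNReal.ofReal_mul hc.le] at h2
  have hx0 : ENNReal.ofReal (ζ.im ^ (2 + α)) ^ 2 ≠ 0 :=
    pow_ne_zero 2 (ENNReal.ofReal_pos.2 (by positivity)).ne'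
  rw [Real.mul_rpow (by linarith) hζ.le, ENNReal.ofReal_mul hΛ0] at h1
  set m := (areaMeasure α).withDensity W
  rw [← ENNReal.mul_div_right_comm,
    ENNReal.le_div_iff_mul_le (Or.inl (by positivity)) (Or.inl (by finiteness)),
    ← ENNReal.mul_le_mul_iff_left hx0 (by finiteness)]
  calc _ = (ENNReal.ofReal c * ENNReal.ofReal (ζ.im ^ (2 + α))) ^ 2 * m (hball ζ (Λ * ζ.im)) := by
        ring
    _ ≤ areaMeasure α (hball ζ (8 * ζ.im)) ^ 2 * m (hball ζ (Λ * ζ.im)) := by gcongr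
    _ ≤ _ := h1
    _ = _ := by ring

lemma areaMeasure_hball_ne_top (hα : -1 < α) (h𝒟 : AreAdjacent 𝒟₁ 𝒟₂) {z : ℂ} {r : ℝ}
    (hz : 0 < z.im) (hr : 0 < r) : areaMeasure α (hball z r) ≠ ⊤ := by
  obtain ⟨C, hC, H⟩ := exists_box_measure_le hα h𝒟
  obtain ⟨I, -, hs, hA⟩ := H z r hz hr
  exact ne_top_of_le_ne_top (by finiteness) ((measure_mono hs).trans hA)

lemma deepPart_subset_hball {R : ℝ} (hR : 0 < R) : deepPart R ⊆ hball Complex.I (R + 4) :=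
  fun w hw => mem_hball_of_norm_sub_le (by simp) ((inv_pos.2 hR).trans_le hw.1) (r := R + 1)
    ((norm_sub_le _ _).trans (by simpa using hw.2)) (by simp only [Complex.I_im]; linarith)

/-- If the derivative of `b` vanishes at the boundary then the kernel of the commutator is, up to
small terms, dominated by a kernel of rank one. -/
lemma DerivVanish.exists_split (h : B2Pair α (𝒟₁ ∪ 𝒟₂) W V) (hα : -1 < α)
    (h𝒟 : AreAdjacent 𝒟₁ 𝒟₂) {b : ℂ → ℂ} (hb : DifferentiableOn ℂ b upperHalf) {C₀ : ℝ≥0∞}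
    (hC₀ : C₀ ≠ ⊤) (hbd : DerivBound α b (C₀ • (areaMeasure α).withDensity W))
    (hv : DerivVanish α b ((areaMeasure α).withDensity W)) {ε : ℝ≥0∞} (hε : ε ≠ 0) :
    ∃ M : ℝ≥0∞, M ≠ ⊤ ∧ ∀ z w : ℂ, 0 < z.im → 0 < w.im → ‖b z - b w‖ₑ * kerP α z w ≤
      ε * ∫⁻ ζ, kerP α z ζ * kerP α w ζ ∂(areaMeasure α).withDensity W +
        M * (kerP α Complex.I z * kerP α Complex.I w) := by
  obtain ⟨C, hC, H⟩ := DerivBound.enorm_sub_mul_kerP_le hα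
  obtain ⟨c, hc, hcell⟩ := exists_area_cell hα
  set m := (areaMeasure α).withDensity W with hm
  set ε' := ε / (C + 1) with hε'
  have hε'0 : ε' ≠ 0 := (ENNReal.div_pos hε (by finiteness)).ne'
  obtain ⟨R, hR, hvR⟩ := hv ε' hε'0
  -- Chosen so that M₁ times the lower bound for the area of a cell based in `deepPart R` equals an
  -- upper bound for the derivative there.
  set M₁ := C₀ * m (hball Complex.I (11 * R + 4)) / ENNReal.ofReal (c * R⁻¹ ^ (2 + α)) with hM₁
  have hcR : ENNReal.ofReal (c * R⁻¹ ^ (2 + α)) ≠ 0 := (ENNReal.ofReal_pos.2 (by positivity)).ne'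
  have hM₁t : M₁ ≠ ⊤ := by
    have := h.measure_hball_ne_top hα h𝒟 (z := Complex.I) (r := 11 * R + 4) (by simp) (by positivity)
    exact ENNReal.div_ne_top (by finiteness) hcR
  set F := deepPart (3 * R) with hF
  -- Near the boundary the small multiple of m already controls b'. Over the deep part the cell of ζ
  -- lies in F, so a large multiple of area on F suffices. The enlargement from R to 3R makes room
  -- for the cells.
  set ρ := ε' • m + M₁ • (areaMeasure α).restrict F with hρ
  have hρb : DerivBound α b ρ := fun ζ hζ => by
    by_cases hd : ζ ∈ deepPart R
    · have hζR : ζ.im ≤ R := ((le_abs_self _).trans (Complex.abs_im_le_norm ζ)).trans hd.2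
      have h1 := hbd ζ hζ
      have h2 : hball ζ (8 * ζ.im) ⊆ hball Complex.I (11 * R + 4) := hball_subset (by
        have := norm_sub_le Complex.I ζ
        rw [Complex.norm_I] at this
        linarith [hd.2])
      have h3 : cell ζ ⊆ hball ζ (8 * ζ.im) ∩ F := fun w hw => ⟨cell_subset_hball hζ hw, by
        refine ⟨?_, ?_⟩
        · have : (3 * R)⁻¹ ≤ R⁻¹ := by gcongr; linarith
          linarith [hd.1, hw.2.1]
        · have e1 := norm_sub_le_of_mem_cell hw
          have e2 := norm_le_norm_add_norm_sub' w ζ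
          linarith [hd.2]⟩
      have h4 : ENNReal.ofReal (c * R⁻¹ ^ (2 + α)) ≤
          (areaMeasure α).restrict F (hball ζ (8 * ζ.im)) := by
        rw [Measure.restrict_apply (measurableSet_hball _ _)]
        refine le_trans ?_ (measure_mono h3)
        rw [hcell ζ hζ]
        apply ENNReal.ofReal_le_ofReal
        have := hd.1
        gcongr
        linarith
      calc _ ≤ C₀ * m (hball ζ (8 * ζ.im)) := h1
        _ ≤ C₀ * m (hball Complex.I (11 * R + 4)) := by gcongr
        _ = M₁ * ENNReal.ofReal (c * R⁻¹ ^ (2 + α)) := by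
            rw [hM₁, ENNReal.div_mul_cancel hcR (by simp)]
        _ ≤ M₁ * (areaMeasure α).restrict F (hball ζ (8 * ζ.im)) := by gcongr
        _ ≤ _ := by rw [hρ]; exact le_add_self
    · exact (hvR ζ hζ hd).trans (by rw [hρ]; exact le_self_add)
  have hAF : areaMeasure α F ≠ ⊤ := ne_top_of_le_ne_top
    (areaMeasure_hball_ne_top hα h𝒟 (by simp) (by positivity))
    (measure_mono (deepPart_subset_hball (by positivity : 0 < 3 * R)))
  set K := 1 + (3 * R + 1) * (3 * R) with hK
  -- Points of F have bounded norm and height bounded below, so they are interchangeable with i in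
  -- the kernel; this produces the rank one term.
  have hkF : ∀ ζ ∈ F, ∀ z : ℂ, 0 < z.im →
      kerP α z ζ ≤ ENNReal.ofReal (K ^ (2 + α)) * kerP α Complex.I z := fun ζ hζ z hz => by
    have hR3 : 0 < 3 * R := by positivity
    have hζ0 : 0 < ζ.im := (inv_pos.2 hR3).trans_le hζ.1
    rw [kerP_comm]
    refine kerP_le_of_le hα hζ0 hz (by simp) hz (by positivity) ?_
    have h1 := norm_sub_conj_le_add_norm_sub Complex.I ζ z
    have h2 := im_add_im_le_norm_sub_conj ζ z
    have h3 := norm_sub_le Complex.I ζ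
    rw [Complex.norm_I] at h3
    have h4 : 1 ≤ (3 * R) * ‖ζ - conj z‖ := by
      have := hζ.1
      rw [inv_le_iff_one_le_mul₀ hR3] at this
      nlinarith
    have h5 : 3 * R + 1 ≤ (3 * R + 1) * ((3 * R) * ‖ζ - conj z‖) :=
      le_mul_of_one_le_right (by positivity) h4
    have := hζ.2
    rw [hK]
    linarith
  refine ⟨C * (M₁ * (ENNReal.ofReal (K ^ (2 + α)) ^ 2 * areaMeasure α F)), by finiteness,
    fun z w hz hw => (H b ρ hb hρb z w hz hw).trans ?_⟩
  rw [hρ, lintegral_add_measure, lintegral_smul_measure, lintegral_smul_measure, mul_add, smul_eq_mul,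
    smul_eq_mul, ← mul_assoc]
  refine add_le_add ?_ ?_
  · gcongr
    rw [hε', mul_comm, ← ENNReal.mul_div_right_comm]
    refine ENNReal.div_le_of_le_mul ?_
    gcongr
    exact le_self_add
  · rw [mul_assoc C, mul_assoc M₁]
    gcongr
    calc _ ≤ ∫⁻ _ in F, ENNReal.ofReal (K ^ (2 + α)) ^ 2 *
          (kerP α Complex.I z * kerP α Complex.I w) ∂areaMeasure α := by
          refine setLIntegral_mono' (measurableSet_deepPart _) fun ζ hζ => ?_
          calc _ ≤ (ENNReal.ofReal (K ^ (2 + α)) * kerP α Complex.I z) *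
                (ENNReal.ofReal (K ^ (2 + α)) * kerP α Complex.I w) :=
                mul_le_mul' (hkF ζ hζ z hz) (hkF ζ hζ w hw)
            _ = _ := by ring
      _ = _ := by rw [setLIntegral_const]; ring

end

/-! ### Mean oscillation and the derivative -/

section

variable {α : ℝ} {𝒟₁ 𝒟₂ : Set (ℝ × ℝ)} {ν : ℂ → ℝ} {V : ℂ → ℝ≥0∞}

lemma areaMeasure_carlesonBox_ne_zero (hα : -1 < α) {I : ℝ × ℝ} (hI : I.1 < I.2) :
    areaMeasure α (carlesonBox I) ≠ 0 := by
  have := boxConst_pos α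
  have h0 : 0 < I.2 - I.1 := by linarith
  rw [areaMeasure_carlesonBox hα hI]
  exact (ENNReal.ofReal_pos.2 (by positivity)).ne'

lemma areaMeasure_carlesonBox_ne_top (hα : -1 < α) {I : ℝ × ℝ} (hI : I.1 < I.2) :
    areaMeasure α (carlesonBox I) ≠ ⊤ := by
  rw [areaMeasure_carlesonBox hα hI]; simp

lemma norm_sub_conj_le_of_mem_carlesonBox {I : ℝ × ℝ} {z w : ℂ} (hz : z ∈ carlesonBox I)
    (hw : w ∈ carlesonBox I) : ‖z - conj w‖ ≤ 3 * (I.2 - I.1) := by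
  refine (Complex.norm_le_abs_re_add_abs_im _).trans ?_
  simp only [Complex.sub_re, Complex.sub_im, Complex.conj_re, Complex.conj_im, sub_neg_eq_add]
  obtain ⟨⟨h1, h2⟩, h3, h4⟩ := hz
  obtain ⟨⟨h5, h6⟩, h7, h8⟩ := hw
  have : |z.re - w.re| ≤ I.2 - I.1 := abs_le.2 ⟨by linarith, by linarith⟩
  rw [abs_of_pos (by linarith : 0 < z.im + w.im)]
  linarith

lemma norm_sub_boxCenter_le {I : ℝ × ℝ} {z : ℂ} (hz : z ∈ carlesonBox I) :
    ‖z - boxCenter I‖ ≤ I.2 - I.1 := by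
  refine (Complex.norm_le_abs_re_add_abs_im _).trans ?_
  obtain ⟨⟨h1, h2⟩, h3, h4⟩ := hz
  have e1 : |(z - boxCenter I).re| ≤ (I.2 - I.1) / 2 := by
    rw [Complex.sub_re, boxCenter]
    exact abs_le.2 ⟨by simp only; linarith, by simp only; linarith⟩
  have e2 : |(z - boxCenter I).im| ≤ (I.2 - I.1) / 2 := by
    rw [Complex.sub_im, boxCenter]
    exact abs_le.2 ⟨by simp only; linarith, by simp only; linarith⟩
  linarith

lemma half_length_le_norm_boxCenter (I : ℝ × ℝ) : (I.2 - I.1) / 2 ≤ ‖boxCenter I‖ :=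
  (le_abs_self _).trans (Complex.abs_im_le_norm (boxCenter I))

/-- The box contains `hball ζ (8 * ζ.im)` and has comparable size. The derivative estimate is used
with c equal to the average of b over the box, and doubling returns from the mass of the box to that
of the half-ball. The bounds on the length and centre of the box transfer closeness of ζ to the line
or to infinity to the box. -/
lemma exists_box_enorm_deriv_le (h : B2Pair α (𝒟₁ ∪ 𝒟₂) (fun z => ENNReal.ofReal (ν z)) V)
    (hα : -1 < α) (h𝒟 : AreAdjacent 𝒟₁ 𝒟₂) :
    ∃ C : ℝ≥0∞, C ≠ ⊤ ∧ ∃ L : ℝ, 0 < L ∧ ∀ b : ℂ → ℂ, DifferentiableOn ℂ b upperHalf →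
      ∀ ζ : ℂ, 0 < ζ.im → ∃ I ∈ 𝒟₁ ∪ 𝒟₂, I.2 - I.1 ≤ L * ζ.im ∧ ‖ζ‖ ≤ 3 * ‖boxCenter I‖ ∧
        ‖deriv b ζ‖ₑ * ENNReal.ofReal (ζ.im ^ (3 + α)) ≤
          C * meanOsc α ν b I * weightedMeasure α ν (hball ζ (8 * ζ.im)) := by
  obtain ⟨C₁, hC₁, H₁⟩ := enorm_deriv_mul_le hα
  obtain ⟨L, hL1, HL⟩ := h𝒟.exists_box
  obtain ⟨C₂, hC₂, H₂⟩ := h.measure_hball_le hα h𝒟 (Λ := 32 * L) (by linarith)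
  refine ⟨C₁ * C₂, by finiteness, 8 * L, by positivity, fun b hb ζ hζ => ?_⟩
  obtain ⟨I, hI, hs, h1, h2, h3⟩ := HL ζ (8 * ζ.im) hζ (by positivity)
  have hζI : ζ ∈ carlesonBox I := hs ⟨hζ, by rw [norm_sub_conj_self hζ]; linarith⟩
  have hbs : Metric.ball ζ (ζ.im / 2) ⊆ carlesonBox I := fun w hw => hs
    (mem_hball_of_norm_sub_le hζ (closedBall_subset_upperHalf (by linarith : ζ.im / 2 < ζ.im)
      (Metric.ball_subset_closedBall hw)) (mem_ball_iff_norm.1 hw).le (by linarith))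
  have hsub : carlesonBox I ⊆ hball ζ (32 * L * ζ.im) := fun w hw =>
    ⟨hw.2.1, (norm_sub_conj_le_of_mem_carlesonBox hζI hw).trans_lt (by nlinarith)⟩
  refine ⟨I, hI, by linarith, ?_, ?_⟩
  · have e1 := norm_sub_boxCenter_le hζI
    have e2 := half_length_le_norm_boxCenter I
    have e3 := norm_le_norm_add_norm_sub' ζ (boxCenter I)
    linarith
  set m := weightedMeasure α ν with hm
  have hm0 : m (carlesonBox I) ≠ 0 :=
    h.measure_ne_zero (areaMeasure_carlesonBox_ne_zero hα (h𝒟.lt hI))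
  have hmt : m (carlesonBox I) ≠ ⊤ := ne_top_of_le_ne_top
    (h.measure_hball_ne_top hα h𝒟 hζ (r := 32 * L * ζ.im) (by positivity)) (measure_mono hsub)
  set c := ⨍ w in carlesonBox I, b w ∂areaMeasure α with hc
  calc _ ≤ C₁ * ∫⁻ w in Metric.ball ζ (ζ.im / 2), ‖b w - c‖ₑ ∂areaMeasure α := H₁ b hb ζ hζ c
    _ ≤ C₁ * ∫⁻ w in carlesonBox I, ‖b w - c‖ₑ ∂areaMeasure α := by
        gcongr
    _ = C₁ * (meanOsc α ν b I * m (carlesonBox I)) := by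
        rw [meanOsc, ENNReal.div_mul_cancel hm0 hmt]
    _ ≤ C₁ * (meanOsc α ν b I * (C₂ * m (hball ζ (8 * ζ.im)))) := by
        gcongr
        exact (measure_mono hsub).trans (H₂ ζ hζ)
    _ = _ := by ring

lemma MemBMOA.exists_derivBound (h : B2Pair α (𝒟₁ ∪ 𝒟₂) (fun z => ENNReal.ofReal (ν z)) V)
    (hα : -1 < α) (h𝒟 : AreAdjacent 𝒟₁ 𝒟₂) {b : ℂ → ℂ} (hb : MemBMOA α (𝒟₁ ∪ 𝒟₂) ν b) :
    ∃ C : ℝ≥0∞, C ≠ ⊤ ∧ DerivBound α b (C • weightedMeasure α ν) := by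
  obtain ⟨C, hC, L, hL, H⟩ := exists_box_enorm_deriv_le h hα h𝒟
  set B := ⨆ I ∈ 𝒟₁ ∪ 𝒟₂, meanOsc α ν b I with hB
  have hBt : B ≠ ⊤ := hb.1.bounded.ne
  refine ⟨C * B, by finiteness, fun ζ hζ => ?_⟩
  obtain ⟨I, hI, -, -, h1⟩ := H b hb.2 ζ hζ
  refine h1.trans ?_
  rw [Measure.smul_apply, smul_eq_mul]
  gcongr
  exact le_iSup₂ (f := fun I (_ : I ∈ 𝒟₁ ∪ 𝒟₂) => meanOsc α ν b I) I hI

lemma MemVMOA.derivVanish (h : B2Pair α (𝒟₁ ∪ 𝒟₂) (fun z => ENNReal.ofReal (ν z)) V)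
    (hα : -1 < α) (h𝒟 : AreAdjacent 𝒟₁ 𝒟₂) {b : ℂ → ℂ} (hb : MemVMOA α (𝒟₁ ∪ 𝒟₂) ν b) :
    DerivVanish α b (weightedMeasure α ν) := fun ε hε => by
  obtain ⟨C, hC, L, hL, H⟩ := exists_box_enorm_deriv_le h hα h𝒟
  have hε' : 0 < ε / (C + 1) := ENNReal.div_pos hε (by finiteness)
  obtain ⟨δ, hδ, Hδ⟩ := hb.1.small _ hε'
  obtain ⟨R₀, HR⟩ := hb.1.far _ hε'
  -- If Im ζ is below the reciprocal of this radius, the box is shorter than δ; if |ζ| exceeds it,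
  -- the centre is beyond R₀. The entry 1 only ensures positivity.
  refine ⟨max (L / δ) (max (3 * R₀) 1), by positivity, fun ζ hζ hd => ?_⟩
  obtain ⟨I, hI, h1, h2, h3⟩ := H b hb.2 ζ hζ
  have hosc : meanOsc α ν b I ≤ ε / (C + 1) := by
    rw [deepPart, mem_ofPred_eq, not_and_or, not_le, not_le] at hd
    rcases hd with hd | hd
    · refine Hδ I hI (h1.trans_lt ?_)
      have e1 : ζ.im < (L / δ)⁻¹ := hd.trans_le (by gcongr; exact le_max_left _ _)
      rw [inv_div, lt_div_iff₀ hL] at e1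
      linarith
    · refine HR I hI ?_
      have : 3 * R₀ < ‖ζ‖ := lt_of_le_of_lt ((le_max_left _ _).trans (le_max_right _ _)) hd
      linarith
  refine h3.trans ?_
  gcongr
  calc C * meanOsc α ν b I ≤ (C + 1) * (ε / (C + 1)) := by gcongr; exact le_self_add
    _ = ε := ENNReal.mul_div_cancel (by simp) (by finiteness)

end

/-! ### From the vanishing of the derivative to vanishing mean oscillation -/

section

variable {α : ℝ} {𝒟₁ 𝒟₂ : Set (ℝ × ℝ)} {ν : ℂ → ℝ} {V : ℂ → ℝ≥0∞}

lemma Measurable.kerP {X : Type*} [MeasurableSpace X] (α : ℝ) {f g : X → ℂ} (hf : Measurable f)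
    (hg : Measurable g) : Measurable fun x => kerP α (f x) (g x) := by
  unfold BergmanCommutator.kerP
  have : Measurable fun x => conj (g x) := Complex.continuous_conj.measurable.comp hg
  fun_prop

/-- Points of one box satisfy |z - w̄| ≤ 3|I|. The normalisation of a double average over the box
can thus be replaced by the kernel, which is where pointwise kernel bounds become oscillation
bounds. -/
lemma exists_inv_area_le_kerP (hα : -1 < α) :
    ∃ C : ℝ≥0∞, C ≠ ⊤ ∧ ∀ I : ℝ × ℝ, I.1 < I.2 → ∀ z ∈ carlesonBox I, ∀ w ∈ carlesonBox I,
      (areaMeasure α (carlesonBox I))⁻¹ ≤ C * kerP α z w := by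
  have hb := boxConst_pos α
  refine ⟨ENNReal.ofReal (3 ^ (2 + α) / boxConst α), by simp, fun I hI z hz w hw => ?_⟩
  have h0 : 0 < I.2 - I.1 := by linarith
  rw [areaMeasure_carlesonBox hα hI, ← ENNReal.ofReal_inv_of_pos (by positivity), kerP,
    ← ENNReal.ofReal_mul (by positivity)]
  apply ENNReal.ofReal_le_ofReal
  have := rpow_neg_le_of_le_mul (s := 2 + α) (by linarith) h0 three_pos
    (norm_sub_conj_le_of_mem_carlesonBox hz hw) (norm_sub_conj_pos hz.2.1 hw.2.1)
  rw [Real.rpow_neg h0.le] at this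
  calc _ = (boxConst α)⁻¹ * ((I.2 - I.1) ^ (2 + α))⁻¹ := mul_inv _ _
    _ ≤ (boxConst α)⁻¹ * (3 ^ (2 + α) * ‖z - conj w‖ ^ (-(2 + α))) := by gcongr
    _ = _ := by ring

lemma enorm_sub_average_le (hα : -1 < α) {I : ℝ × ℝ} (hI : I.1 < I.2) {b : ℂ → ℂ}
    (hb : IntegrableOn b (carlesonBox I) (areaMeasure α)) (z : ℂ) :
    ‖b z - ⨍ w in carlesonBox I, b w ∂areaMeasure α‖ₑ ≤
      (areaMeasure α (carlesonBox I))⁻¹ * ∫⁻ w in carlesonBox I, ‖b z - b w‖ₑ ∂areaMeasure α := by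
  set A := areaMeasure α with hA
  have h0 := areaMeasure_carlesonBox_ne_zero hα hI
  have ht := areaMeasure_carlesonBox_ne_top hα hI
  have hr0 : (A.real (carlesonBox I)) ≠ 0 := (ENNReal.toReal_pos h0 ht).ne'
  have hfin : IsFiniteMeasure (A.restrict (carlesonBox I)) :=
    ⟨by rw [Measure.restrict_apply_univ]; exact ht.lt_top⟩
  have e1 : b z - ⨍ w in carlesonBox I, b w ∂A =
      (A.real (carlesonBox I))⁻¹ • ∫ w in carlesonBox I, (b z - b w) ∂A := by
    rw [integral_sub (integrable_const _) hb, setAverage_eq, setIntegral_const, smul_sub, smul_smul,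
      inv_mul_cancel₀ hr0, one_smul]
  rw [e1, enorm_smul]
  refine mul_le_mul' (le_of_eq ?_) (enorm_integral_le_lintegral_enorm _)
  rw [enorm_inv hr0, Real.enorm_eq_ofReal measureReal_nonneg, ofReal_measureReal ht]

/-- The oscillation is at most a double integral of |b(z) - b(w)| times the kernel over Q × Q. By
Fubini the first term of the assumed bound becomes ε∫(P⁺1_Q)² ν, which is at most Cεν(Q) by
boundedness of P⁺ on L²(ν); the rank one term factorises into a square. -/
lemma lintegral_enorm_sub_average_le (h : B2Pair α (𝒟₁ ∪ 𝒟₂) (fun z => ENNReal.ofReal (ν z)) V)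
    (hα : -1 < α) (h𝒟 : AreAdjacent 𝒟₁ 𝒟₂) :
    ∃ C : ℝ≥0∞, C ≠ ⊤ ∧ ∀ (b : ℂ → ℂ) (ε M : ℝ≥0∞), ε ≠ ⊤ → M ≠ ⊤ →
      (∀ z w : ℂ, 0 < z.im → 0 < w.im → ‖b z - b w‖ₑ * kerP α z w ≤
        ε * ∫⁻ ζ, kerP α z ζ * kerP α w ζ ∂weightedMeasure α ν +
          M * (kerP α Complex.I z * kerP α Complex.I w)) →
      ∀ I ∈ 𝒟₁ ∪ 𝒟₂, IntegrableOn b (carlesonBox I) (areaMeasure α) →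
      ∫⁻ z in carlesonBox I, ‖b z - ⨍ w in carlesonBox I, b w ∂areaMeasure α‖ₑ ∂areaMeasure α ≤
        C * (ε * weightedMeasure α ν (carlesonBox I) +
          M * (∫⁻ z in carlesonBox I, kerP α Complex.I z ∂areaMeasure α) ^ 2) := by
  obtain ⟨C₁, hC₁, H₁⟩ := exists_inv_area_le_kerP hα
  obtain ⟨C₂, hC₂, H₂⟩ := lintegral_opP_sq_le hα h𝒟 h
  refine ⟨C₁ * (C₂ + 1), by finiteness, fun b ε M hε hM hk I hI hint => ?_⟩
  set A := areaMeasure α with hA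
  set Q := carlesonBox I with hQ
  have hQm : MeasurableSet Q := measurableSet_carlesonBox I
  set m := weightedMeasure α ν with hm
  have hsf : SigmaFinite m := h.sigmaFinite
  have hlt := h𝒟.lt hI
  have hk2 : Measurable fun p : ℂ × ℂ => kerP α p.1 p.2 := measurable_kerP_uncurry α
  have hkI : Measurable fun z => kerP α Complex.I z := measurable_kerP_right α _
  have hone : Measurable (Q.indicator (1 : ℂ → ℝ≥0∞)) := measurable_one.indicator hQm
  have hPQ : ∀ ζ, ∫⁻ z in Q, kerP α z ζ ∂A = opP α (Q.indicator 1) ζ := fun ζ => by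
    rw [opP, ← lintegral_indicator hQm]
    refine lintegral_congr fun z => ?_
    by_cases hz : z ∈ Q <;> simp [hz, kerP_comm]
  have hPm : AEMeasurable (opP α (Q.indicator 1)) A := aemeasurable_opP hone.aemeasurable
  have step1 : ∫⁻ z in Q, ‖b z - ⨍ w in Q, b w ∂A‖ₑ ∂A ≤
      C₁ * ∫⁻ z in Q, ∫⁻ w in Q, (ε * ∫⁻ ζ, kerP α z ζ * kerP α w ζ ∂m +
          M * (kerP α Complex.I z * kerP α Complex.I w)) ∂A ∂A := by
    rw [← lintegral_const_mul' _ _ hC₁]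
    refine setLIntegral_mono' hQm fun z hz => (enorm_sub_average_le hα hlt hint z).trans ?_
    have h0 := areaMeasure_carlesonBox_ne_zero hα hlt
    rw [← lintegral_const_mul' _ _ (ENNReal.inv_ne_top.2 h0), ← lintegral_const_mul' _ _ hC₁]
    refine setLIntegral_mono' hQm fun w hw => ?_
    calc _ ≤ C₁ * kerP α z w * ‖b z - b w‖ₑ := by gcongr; exact H₁ I hlt z hz w hw
      _ = C₁ * (‖b z - b w‖ₑ * kerP α z w) := by ring
      _ ≤ _ := by gcongr; exact hk z w hz.2.1 hw.2.1
  have hkk : ∀ z, Measurable fun p : ℂ × ℂ => kerP α z p.2 * kerP α p.1 p.2 := fun z =>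
    (Measurable.kerP α measurable_const measurable_snd).mul hk2
  have step2 : ∫⁻ z in Q, ∫⁻ w in Q, (ε * ∫⁻ ζ, kerP α z ζ * kerP α w ζ ∂m +
      M * (kerP α Complex.I z * kerP α Complex.I w)) ∂A ∂A =
      ε * ∫⁻ ζ, opP α (Q.indicator 1) ζ ^ 2 ∂m + M * (∫⁻ z in Q, kerP α Complex.I z ∂A) ^ 2 := by
    have e1 : ∀ z, ∫⁻ w in Q, (ε * ∫⁻ ζ, kerP α z ζ * kerP α w ζ ∂m +
        M * (kerP α Complex.I z * kerP α Complex.I w)) ∂A =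
        ε * ∫⁻ ζ, kerP α z ζ * opP α (Q.indicator 1) ζ ∂m +
          M * (kerP α Complex.I z * ∫⁻ w in Q, kerP α Complex.I w ∂A) := fun z => by
      rw [lintegral_add_right _ ((hkI.const_mul _).const_mul _), lintegral_const_mul' _ _ hε,
        lintegral_const_mul' _ _ hM, lintegral_const_mul' _ _ (kerP_ne_top _ _ _)]
      congr 2
      rw [lintegral_lintegral_swap (hkk z).aemeasurable]
      refine lintegral_congr fun ζ => ?_
      rw [lintegral_const_mul' _ _ (kerP_ne_top _ _ _), hPQ]
    simp_rw [e1]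
    rw [lintegral_add_right _ ((hkI.mul_const _).const_mul _), lintegral_const_mul' _ _ hε,
      lintegral_const_mul' _ _ hM, lintegral_mul_const _ hkI, ← sq]
    congr 2
    have hPm' : AEMeasurable (opP α (Q.indicator 1)) m :=
      hPm.mono_ac (withDensity_absolutelyContinuous _ _)
    rw [lintegral_lintegral_swap (hk2.aemeasurable.fun_mul hPm'.comp_snd)]
    refine lintegral_congr fun ζ => ?_
    rw [lintegral_mul_const _ (Measurable.kerP α measurable_id' measurable_const), hPQ, sq]
  have step3 : ∫⁻ ζ, opP α (Q.indicator 1) ζ ^ 2 ∂m ≤ C₂ * m Q := by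
    have e1 := H₂ (Q.indicator 1) hone.aemeasurable
    have e2 : ∫⁻ z, Q.indicator 1 z ^ 2 * ENNReal.ofReal (ν z) ∂A = m Q := by
      rw [hm, weightedMeasure, withDensity_apply _ hQm, ← lintegral_indicator hQm]
      refine lintegral_congr fun z => ?_
      by_cases hz : z ∈ Q <;> simp [hz]
    rw [e2] at e1
    rw [hm, weightedMeasure, lintegral_withDensity_eq_lintegral_mul₀ h.aem_left (hPm.pow_const 2)]
    refine le_trans (le_of_eq (lintegral_congr fun z => mul_comm _ _)) e1
  refine step1.trans ?_
  rw [step2, mul_assoc]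
  gcongr
  calc _ ≤ ε * (C₂ * m Q) + M * (∫⁻ z in Q, kerP α Complex.I z ∂A) ^ 2 := by gcongr
    _ ≤ ε * ((C₂ + 1) * m Q) + (C₂ + 1) * (M * (∫⁻ z in Q, kerP α Complex.I z ∂A) ^ 2) := by
        refine add_le_add (by gcongr; exact le_self_add) ?_
        exact le_mul_of_one_le_left zero_le le_add_self
    _ = _ := by ring

lemma norm_le_of_mem_hball_I {z : ℂ} {r : ℝ} (hz : z ∈ hball Complex.I r) : ‖z‖ ≤ r + 1 := by
  have h1 := hz.2
  have h2 := norm_le_norm_add_norm_sub' (conj z) Complex.I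
  rw [Complex.norm_conj, norm_sub_rev, Complex.norm_I] at h2
  linarith

/-- Large Carleson boxes meeting a fixed ball have large mass. -/
lemma B2Pair.exists_le_measure_carlesonBox {W : ℂ → ℝ≥0∞} (h : B2Pair α (𝒟₁ ∪ 𝒟₂) W V)
    (hα : -1 < α) (h𝒟 : AreAdjacent 𝒟₁ 𝒟₂) (r : ℝ) (N : ℝ≥0∞) (hN : N ≠ ⊤) :
    ∃ l : ℝ, ∀ I : ℝ × ℝ, l ≤ I.2 - I.1 → (carlesonBox I ∩ hball Complex.I r).Nonempty →
      N ≤ (areaMeasure α).withDensity W (carlesonBox I) := by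
  obtain ⟨C, hC, H⟩ := h.sq_measure_mul_le hα h𝒟
  have hb := boxConst_pos α
  set c := ENNReal.ofReal (boxConst α) ^ 2 with hc
  have hc0 : c ≠ 0 := pow_ne_zero 2 (ENNReal.ofReal_pos.2 hb).ne'
  set C' := C * ENNReal.ofReal (4 ^ (2 + α)) ^ 2 / c with hC'
  have hC't : C' ≠ ⊤ := ENNReal.div_ne_top (by finiteness) hc0
  -- A box of large side ℓ and `hball Complex.I ℓ` both lie in one half-ball of radius 4ℓ. The A_∞
  -- property compares its mass with that of the box, and the half-balls about i have mass tending
  -- to infinity.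
  obtain ⟨l, hl⟩ := h.measure_hball_tendsto hα h𝒟 ((C' + 1) * N) (by finiteness)
  refine ⟨max l (max 1 (r + 3)), fun I hI ⟨z, hzI, hzr⟩ => ?_⟩
  set m := (areaMeasure α).withDensity W
  set ℓ := I.2 - I.1 with hℓ
  have h1 : l ≤ ℓ := (le_max_left _ _).trans hI
  have h2 : 1 ≤ ℓ := ((le_max_left _ _).trans (le_max_right _ _)).trans hI
  have h3 : r + 3 ≤ ℓ := ((le_max_right _ _).trans (le_max_right _ _)).trans hI
  have hℓ0 : 0 < ℓ := by linarith
  have hlt : I.1 < I.2 := by linarith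
  have hsub : carlesonBox I ⊆ hball z (4 * ℓ) := fun w hw =>
    ⟨hw.2.1, (norm_sub_conj_le_of_mem_carlesonBox hzI hw).trans_lt (by linarith)⟩
  have h4 := H z (4 * ℓ) _ hzI.2.1 (by positivity) hsub
  have h5 : hball Complex.I ℓ ⊆ hball z (4 * ℓ) := hball_subset (by
    have e1 := norm_sub_le z Complex.I
    rw [Complex.norm_I] at e1
    linarith [norm_le_of_mem_hball_I hzr])
  rw [areaMeasure_carlesonBox hα hlt, ← hℓ, Real.mul_rpow (x := 4) (by norm_num) hℓ0.le,
    ENNReal.ofReal_mul hb.le, ENNReal.ofReal_mul (p := 4 ^ (2 + α)) (by positivity)] at h4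
  have hx0 : ENNReal.ofReal (ℓ ^ (2 + α)) ^ 2 ≠ 0 :=
    pow_ne_zero 2 (ENNReal.ofReal_pos.2 (by positivity)).ne'
  have h6 : m (hball z (4 * ℓ)) ≤ C' * m (carlesonBox I) := by
    rw [hC', ← ENNReal.mul_div_right_comm,
      ENNReal.le_div_iff_mul_le (Or.inl hc0) (Or.inl (by finiteness)),
      ← ENNReal.mul_le_mul_iff_left hx0 (by finiteness)]
    calc _ = _ := by rw [hc]; ring
      _ ≤ _ := h4
      _ = _ := by ring
  have h7 : (C' + 1) * N ≤ (C' + 1) * m (carlesonBox I) :=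
    ((hl ℓ h1).trans (measure_mono h5)).trans (h6.trans (by gcongr; exact le_self_add))
  exact (ENNReal.mul_le_mul_iff_right (by simp) (by finiteness)).1 h7

/-- Cauchy–Schwarz with the weights W and V separates the mass of E from the integral over E of a
fixed integrable function, which is small for small or remote E. -/
lemma sq_setLIntegral_kerP_le {W : ℂ → ℝ≥0∞} (h : B2Pair α (𝒟₁ ∪ 𝒟₂) W V) (E : Set ℂ) :
    (∫⁻ z in E, kerP α Complex.I z ∂areaMeasure α) ^ 2 ≤
      (areaMeasure α).withDensity W E * ∫⁻ z in E, kerP α Complex.I z ^ 2 * V z ∂areaMeasure α := by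
  have hk : AEMeasurable (fun z => kerP α Complex.I z) (areaMeasure α) :=
    (measurable_kerP_right α Complex.I).aemeasurable
  have h1 := sq_lintegral_mul_le (m := (areaMeasure α).restrict E)
    (h.aem_left.restrict.pow_const (1 / 2 : ℝ))
    (hk.restrict.fun_mul (h.aem_right.restrict.pow_const (1 / 2 : ℝ)))
  simp only [mul_pow, sq_rpow_half] at h1
  rw [withDensity_apply']
  refine le_trans (le_of_eq ?_) h1
  congr 1
  refine lintegral_congr_ae (ae_restrict_of_ae (h.mul_eq.mono fun z hz => ?_))
  have e : W z ^ (1 / 2 : ℝ) * V z ^ (1 / 2 : ℝ) = 1 := by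
    rw [← ENNReal.mul_rpow_of_nonneg _ _ (by norm_num), hz, ENNReal.one_rpow]
  calc _ = (W z ^ (1 / 2 : ℝ) * V z ^ (1 / 2 : ℝ)) * kerP α Complex.I z := by rw [e, one_mul]
    _ = _ := by ring

/-- Smallness of the rank one term on small and on far boxes. -/
lemma exists_sq_setLIntegral_kerP_le {W : ℂ → ℝ≥0∞} (h : B2Pair α (𝒟₁ ∪ 𝒟₂) W V) (hα : -1 < α)
    (h𝒟 : AreAdjacent 𝒟₁ 𝒟₂) {η : ℝ≥0∞} (hη : η ≠ 0) :
    (∃ δ : ℝ, 0 < δ ∧ ∀ I ∈ 𝒟₁ ∪ 𝒟₂, I.2 - I.1 < δ →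
      (∫⁻ z in carlesonBox I, kerP α Complex.I z ∂areaMeasure α) ^ 2 ≤
        η * (areaMeasure α).withDensity W (carlesonBox I)) ∧
    ∃ R : ℝ, ∀ I ∈ 𝒟₁ ∪ 𝒟₂, R < ‖boxCenter I‖ →
      (∫⁻ z in carlesonBox I, kerP α Complex.I z ∂areaMeasure α) ^ 2 ≤
        η * (areaMeasure α).withDensity W (carlesonBox I) := by
  set A := areaMeasure α with hA
  set m := A.withDensity W with hm
  have hk : AEMeasurable (fun z => kerP α Complex.I z) A :=
    (measurable_kerP_right α Complex.I).aemeasurable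
  have hfin := h.lintegral_kerP_I_sq_ne_top hα h𝒟
  constructor
  · obtain ⟨δ, hδ, H⟩ := exists_pos_setLIntegral_lt_of_measure_lt hfin hη
    have hlim : Tendsto (fun t : ℝ => ENNReal.ofReal (boxConst α * t ^ (2 + α)))
        (nhdsWithin 0 (Ioi 0)) (nhds 0) := by
      have : Tendsto (fun t : ℝ => ENNReal.ofReal (boxConst α * t ^ (2 + α)))
          (nhds 0) (nhds (ENNReal.ofReal (boxConst α * 0 ^ (2 + α)))) := by
        refine ENNReal.tendsto_ofReal (Tendsto.const_mul _ ?_)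
        exact (Real.continuousAt_rpow_const 0 (2 + α) (Or.inr (by linarith))).tendsto
      rw [Real.zero_rpow (by linarith), mul_zero, ENNReal.ofReal_zero] at this
      exact this.mono_left nhdsWithin_le_nhds
    have hev := hlim.eventually (gt_mem_nhds hδ)
    obtain ⟨δ', hδ', H'⟩ := mem_nhdsGT_iff_exists_Ioo_subset.1 hev
    refine ⟨δ', hδ', fun I hI hIδ => ?_⟩
    have hlt := h𝒟.lt hI
    have h1 : A (carlesonBox I) < δ := by
      rw [hA, areaMeasure_carlesonBox hα hlt]
      exact H' ⟨by linarith, hIδ⟩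
    refine (sq_setLIntegral_kerP_le h _).trans ?_
    rw [mul_comm]
    gcongr
    exact (H _ h1).le
  · obtain ⟨η', hη', hηη⟩ : ∃ η' : ℝ≥0∞, η' ≠ 0 ∧ 4 * η' ≤ η :=
      ⟨η / 4, (ENNReal.div_pos hη (by norm_num)).ne',
        (ENNReal.mul_div_cancel (by norm_num) (by norm_num)).le⟩
    set f : ℂ → ℝ≥0∞ := fun z => kerP α Complex.I z ^ 2 * V z with hf
    -- For far boxes, the part outside a large half-ball about i is governed by the tail of k²V. The
    -- part inside has bounded integral, and a far box that meets the half-ball is so long that its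
    -- mass is large.
    have htail : ∃ r : ℝ, 0 < r ∧ ∫⁻ z in (hball Complex.I r)ᶜ, f z ∂A ≤ η' := by
      set s : ℕ → Set ℂ := fun n => (hball Complex.I (n + 1))ᶜ with hs
      have hanti : Antitone s := fun i j hij => compl_subset_compl.2 fun z hz =>
        ⟨hz.1, hz.2.trans_le (by gcongr)⟩
      have hlim := tendsto_measure_iInter_atTop (μ := A.withDensity f) (s := s)
        (fun n => (measurableSet_hball Complex.I (n + 1)).compl.nullMeasurableSet) hanti
        ⟨0, ne_top_of_le_ne_top (by rw [withDensity_apply _ .univ, Measure.restrict_univ]; exact hfin)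
          (measure_mono (subset_univ _))⟩
      have hzero : A.withDensity f (⋂ n, s n) = 0 := by
        refine withDensity_absolutelyContinuous _ _ (measure_mono_null (fun z hz => ?_)
          (ae_mem_upperHalf α))
        intro hz'
        obtain ⟨n, hn⟩ := exists_nat_gt ‖Complex.I - conj z‖
        exact mem_iInter.1 hz n ⟨hz', by linarith⟩
      rw [hzero] at hlim
      obtain ⟨n, hn⟩ := (hlim.eventually (gt_mem_nhds (pos_iff_ne_zero.2 hη'))).exists
      refine ⟨n + 1, by positivity, ?_⟩
      rw [Function.comp_apply, withDensity_apply'] at hn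
      exact hn.le
    obtain ⟨r, hr, hrt⟩ := htail
    set T := (∫⁻ z in hball Complex.I r, kerP α Complex.I z ∂A) ^ 2 with hT
    have hTt : T ≠ ⊤ := by
      have e1 := sq_setLIntegral_kerP_le h (hball Complex.I r)
      refine ne_top_of_le_ne_top (ENNReal.mul_ne_top (h.measure_hball_ne_top hα h𝒟 (by simp) hr) ?_) e1
      exact ne_top_of_le_ne_top hfin (setLIntegral_le_lintegral _ _)
    obtain ⟨l, hl⟩ := h.exists_le_measure_carlesonBox hα h𝒟 r (T / η')
      (ENNReal.div_ne_top hTt hη')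
    refine ⟨l + r + 1, fun I hI hIR => ?_⟩
    have hQm := measurableSet_carlesonBox I
    have hout : (∫⁻ z in carlesonBox I \ hball Complex.I r, kerP α Complex.I z ∂A) ^ 2 ≤
        m (carlesonBox I) * η' := by
      refine (sq_setLIntegral_kerP_le h _).trans (mul_le_mul' (measure_mono sdiff_subset) ?_)
      exact (lintegral_mono_set fun z hz => hz.2).trans hrt
    have hin : (∫⁻ z in carlesonBox I ∩ hball Complex.I r, kerP α Complex.I z ∂A) ^ 2 ≤
        m (carlesonBox I) * η' := by
      rcases (carlesonBox I ∩ hball Complex.I r).eq_empty_or_nonempty with he | hne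
      · rw [he]; simp
      · have hlen : l ≤ I.2 - I.1 := by
          obtain ⟨z, hz⟩ := hne
          have e1 := norm_le_of_mem_hball_I hz.2
          have e2 := norm_sub_boxCenter_le hz.1
          have e3 := norm_le_norm_add_norm_sub z (boxCenter I)
          linarith
        have e4 := hl I hlen hne
        rcases eq_or_ne η' ⊤ with h0 | h0
        · rw [h0, ENNReal.mul_top (h.measure_ne_zero
            (areaMeasure_carlesonBox_ne_zero hα (h𝒟.lt hI)))]
          exact le_top
        · refine le_trans ?_ ((ENNReal.div_le_iff hη' h0).1 e4)
          rw [hT]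
          gcongr
          exact inter_subset_right
    rw [← lintegral_inter_add_sdiff _ _ (measurableSet_hball Complex.I r)]
    set a := ∫⁻ z in carlesonBox I ∩ hball Complex.I r, kerP α Complex.I z ∂A
    set d := ∫⁻ z in carlesonBox I \ hball Complex.I r, kerP α Complex.I z ∂A
    have hab : (a + d) ^ 2 ≤ 2 * (a ^ 2 + d ^ 2) := by
      have h3 := sq_sum_mul_le (Finset.univ : Finset (Fin 2)) ![1, 1] ![a, d]
      simpa [Fin.sum_univ_two, one_add_one_eq_two] using h3
    calc _ ≤ 2 * (a ^ 2 + d ^ 2) := hab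
      _ ≤ 2 * (m (carlesonBox I) * η' + m (carlesonBox I) * η') := by gcongr
      _ = 4 * η' * m (carlesonBox I) := by ring
      _ ≤ _ := by gcongr

/-- The kernel splitting bounds the oscillation on Q by ε₁ plus M(∫_Q k)²/ν(Q), up to a constant. M
is fixed once ε₁ is, so the second term is made small by restricting to short or remote boxes. -/
theorem DerivVanish.memVMOA (h : B2Pair α (𝒟₁ ∪ 𝒟₂) (fun z => ENNReal.ofReal (ν z)) V)
    (hα : -1 < α) (h𝒟 : AreAdjacent 𝒟₁ 𝒟₂) {b : ℂ → ℂ} (hb : MemBMOA α (𝒟₁ ∪ 𝒟₂) ν b)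
    (hv : DerivVanish α b (weightedMeasure α ν)) : MemVMOA α (𝒟₁ ∪ 𝒟₂) ν b := by
  obtain ⟨C₀, hC₀, hbd⟩ := hb.exists_derivBound h hα h𝒟
  obtain ⟨C, hC, H⟩ := lintegral_enorm_sub_average_le h hα h𝒟
  have key : ∀ ε : ℝ≥0∞, 0 < ε → ∃ η : ℝ≥0∞, η ≠ 0 ∧ ∀ I ∈ 𝒟₁ ∪ 𝒟₂,
      (∫⁻ z in carlesonBox I, kerP α Complex.I z ∂areaMeasure α) ^ 2 ≤
        η * weightedMeasure α ν (carlesonBox I) → meanOsc α ν b I ≤ ε := fun ε hε => by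
    -- The minimum with 1 covers ε = ⊤; the factor 2 shares ε between the two terms.
    set ε₁ := min ε 1 / (2 * (C + 1)) with hε₁
    have hε₁0 : ε₁ ≠ 0 := (ENNReal.div_pos (by positivity) (by finiteness)).ne'
    have hε₁t : ε₁ ≠ ⊤ := ENNReal.div_ne_top (ne_top_of_le_ne_top (by simp) (min_le_right _ _))
      (by simp)
    have hε₁C : C * (2 * ε₁) ≤ ε := by
      calc C * (2 * ε₁) ≤ (2 * (C + 1)) * ε₁ := by
            rw [← mul_assoc, mul_comm C 2]; gcongr; exact le_self_add
        _ = min ε 1 := ENNReal.mul_div_cancel (by simp) (by finiteness)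
        _ ≤ ε := min_le_left _ _
    obtain ⟨M, hM, hker⟩ := hv.exists_split h hα h𝒟 hb.2 hC₀ hbd hε₁0
    refine ⟨ε₁ / (M + 1), (ENNReal.div_pos hε₁0 (by finiteness)).ne', fun I hI hIη => ?_⟩
    have h1 := H b ε₁ M hε₁t hM hker I hI (hb.1.integrableOn_box I hI)
    refine ENNReal.div_le_of_le_mul (h1.trans ?_)
    calc _ ≤ C * (ε₁ * weightedMeasure α ν (carlesonBox I) +
          (M + 1) * (ε₁ / (M + 1) * weightedMeasure α ν (carlesonBox I))) := by
          gcongr; exact le_self_add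
      _ = C * (2 * ε₁) * weightedMeasure α ν (carlesonBox I) := by
          rw [← mul_assoc (M + 1), ENNReal.mul_div_cancel (by simp) (by finiteness)]; ring
      _ ≤ _ := by gcongr
  refine ⟨⟨hb.1, fun ε hε => ?_, fun ε hε => ?_⟩, hb.2⟩
  · obtain ⟨η, hη, Hη⟩ := key ε hε
    obtain ⟨δ, hδ, Hδ⟩ := (exists_sq_setLIntegral_kerP_le h hα h𝒟 hη).1
    exact ⟨δ, hδ, fun I hI hIδ => Hη I hI (Hδ I hI hIδ)⟩
  · obtain ⟨η, hη, Hη⟩ := key ε hε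
    obtain ⟨R, HR⟩ := (exists_sq_setLIntegral_kerP_le h hα h𝒟 hη).2
    exact ⟨R, fun I hI hIR => Hη I hI (HR I hI hIR)⟩

end

/-! ### Integral operators on `L²` -/

section

variable {X : Type*} [MeasurableSpace X] {A m l : Measure X}

lemma enorm_sq_eq_lintegral (f : Lp ℂ 2 m) : ‖f‖ₑ ^ 2 = ∫⁻ x, ‖f x‖ₑ ^ 2 ∂m := by
  have h := eLpNorm_nnreal_pow_eq_lintegral (f := f) (μ := m) (p := 2) (by norm_num)
  rw [Lp.enorm_def]
  simpa using h

lemma memLp_two_of_lintegral {g : X → ℂ} (hg : AEStronglyMeasurable g m)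
    (h : ∫⁻ x, ‖g x‖ₑ ^ 2 ∂m < ⊤) : MemLp g 2 m := by
  refine ⟨hg, ?_⟩
  have h' := eLpNorm_nnreal_pow_eq_lintegral (f := g) (μ := m) (p := 2) (by norm_num)
  simp only [ENNReal.coe_ofNat, NNReal.coe_ofNat, ENNReal.rpow_two] at h'
  rw [← h'] at h
  exact lt_top_iff_ne_top.2 fun h0 => by simp [h0] at h

lemma aestronglyMeasurable_coeFn (hAm : A ≪ m) (f : Lp ℂ 2 m) : AEStronglyMeasurable f A :=
  (Lp.aestronglyMeasurable f).mono_ac hAm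

lemma le_mul_of_enorm_sq_le {E F : Type*} [SeminormedAddCommGroup E] [SeminormedAddCommGroup F]
    {x : E} {y : F} {c : NNReal} (h : ‖x‖ₑ ^ 2 ≤ c ^ 2 * ‖y‖ₑ ^ 2) : ‖x‖ ≤ c * ‖y‖ := by
  rw [← mul_pow, ENNReal.pow_le_pow_left_iff two_ne_zero, enorm_eq_nnnorm, enorm_eq_nnnorm] at h
  exact_mod_cast h

variable {κ : X → X → ℂ} {c : NNReal}

lemma ae_integrable_kernel [SFinite A] (hAm : A ≪ m) (hAl : A ≪ l) (hlA : l ≪ A)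
    (hκ : Measurable fun p : X × X => κ p.1 p.2)
    (hc : ∀ f : X → ℝ≥0∞, AEMeasurable f A →
      ∫⁻ z, (∫⁻ w, ‖κ z w‖ₑ * f w ∂A) ^ 2 ∂l ≤ c ^ 2 * ∫⁻ w, f w ^ 2 ∂m) (f : Lp ℂ 2 m) :
    ∀ᵐ z ∂A, Integrable (fun w => κ z w * f w) A := by
  have hf := aestronglyMeasurable_coeFn hAm f
  have h1 : AEMeasurable (fun z => ∫⁻ w, ‖κ z w‖ₑ * ‖f w‖ₑ ∂A) A :=
    (AEMeasurable.fun_mul hκ.enorm.aemeasurable hf.comp_snd.enorm).lintegral_prod_right'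
  have h2 := hc _ hf.enorm
  have h3 : ∀ᵐ z ∂l, (∫⁻ w, ‖κ z w‖ₑ * ‖f w‖ₑ ∂A) ^ 2 < ⊤ := by
    refine ae_lt_top' ((h1.mono_ac hlA).pow_const 2) (ne_top_of_le_ne_top ?_ h2)
    rw [← enorm_sq_eq_lintegral]
    finiteness
  filter_upwards [hAl h3] with z hz
  refine ⟨(hκ.of_uncurry_left (x := z)).aestronglyMeasurable.mul hf, ?_⟩
  rw [HasFiniteIntegral]
  simp only [enorm_mul]
  exact lt_top_iff_ne_top.2 fun h0 => by simp [h0] at hz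

/-- A kernel whose modulus defines a bounded operator on nonnegative functions defines a bounded
operator. -/
lemma exists_integral_clm [SFinite A] (hAm : A ≪ m) (hAl : A ≪ l) (hlA : l ≪ A)
    (hκ : Measurable fun p : X × X => κ p.1 p.2)
    (hc : ∀ f : X → ℝ≥0∞, AEMeasurable f A →
      ∫⁻ z, (∫⁻ w, ‖κ z w‖ₑ * f w ∂A) ^ 2 ∂l ≤ c ^ 2 * ∫⁻ w, f w ^ 2 ∂m) :
    ∃ S : Lp ℂ 2 m →L[ℂ] Lp ℂ 2 l, ‖S‖ ≤ c ∧
      ∀ f : Lp ℂ 2 m, S f =ᵐ[A] fun z => ∫ w, κ z w * f w ∂A := by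
  have hint := ae_integrable_kernel hAm hAl hlA hκ hc
  have hsq : ∀ f : Lp ℂ 2 m,
      ∫⁻ z, ‖∫ w, κ z w * f w ∂A‖ₑ ^ 2 ∂l ≤ c ^ 2 * ‖f‖ₑ ^ 2 := fun f => by
    rw [enorm_sq_eq_lintegral]
    refine le_trans ?_ (hc _ (aestronglyMeasurable_coeFn hAm f).enorm)
    gcongr with z
    refine (enorm_integral_le_lintegral_enorm _).trans (le_of_eq ?_)
    simp only [enorm_mul]
  have hmem : ∀ f : Lp ℂ 2 m, MemLp (fun z => ∫ w, κ z w * f w ∂A) 2 l := fun f => by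
    refine memLp_two_of_lintegral ?_ ((hsq f).trans_lt (by finiteness))
    exact (AEStronglyMeasurable.fun_mul hκ.aestronglyMeasurable
      (aestronglyMeasurable_coeFn hAm f).comp_snd).integral_prod_right'.mono_ac hlA
  have hcoe : ∀ f : Lp ℂ 2 m, (hmem f).toLp =ᵐ[A] fun z => ∫ w, κ z w * f w ∂A := fun f =>
    hAl (hmem f).coeFn_toLp
  let T : Lp ℂ 2 m →ₗ[ℂ] Lp ℂ 2 l :=
    { toFun := fun f => (hmem f).toLp
      map_add' := fun f g => by
        refine Lp.ext (hlA ?_)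
        filter_upwards [hcoe (f + g), hAl (Lp.coeFn_add (hmem f).toLp (hmem g).toLp), hcoe f,
          hcoe g, hint f, hint g] with z h1 h2 h3 h4 h5 h6
        rw [h1, h2, Pi.add_apply, h3, h4, ← integral_add h5 h6]
        refine integral_congr_ae ?_
        filter_upwards [hAm (Lp.coeFn_add f g)] with w hw
        simp only [hw, Pi.add_apply, mul_add]
      map_smul' := fun a f => by
        refine Lp.ext (hlA ?_)
        filter_upwards [hcoe (a • f), hAl (Lp.coeFn_smul a (hmem f).toLp), hcoe f] with z h1 h2 h3
        rw [h1, RingHom.id_apply, h2, Pi.smul_apply, h3, ← integral_smul]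
        refine integral_congr_ae ?_
        filter_upwards [hAm (Lp.coeFn_smul a f)] with w hw
        simp only [hw, Pi.smul_apply, smul_eq_mul]
        ring }
  have hT : ∀ f, ‖T f‖ ≤ c * ‖f‖ := fun f => by
    refine le_mul_of_enorm_sq_le (le_trans (le_of_eq ?_) (hsq f))
    rw [enorm_sq_eq_lintegral]
    exact lintegral_congr_ae ((hmem f).coeFn_toLp.mono fun z hz => by
      simp only [T, LinearMap.coe_mk, AddHom.coe_mk]; rw [hz])
  exact ⟨T.mkContinuous c hT, T.mkContinuous_norm_le c.2 hT, hcoe⟩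

/-- Bessel's inequality for the functional `f ↦ ∫ g f`. -/
lemma sum_enorm_integral_sq_le {W V : X → ℝ≥0∞} (hW : AEMeasurable W A) (hV : AEMeasurable V A)
    (hWV : ∀ᵐ z ∂A, W z * V z = 1) {g : X → ℂ} (hg : AEStronglyMeasurable g A) {ι : Type*}
    {e : ι → Lp ℂ 2 (A.withDensity W)} (he : Orthonormal ℂ e) (s : Finset ι) :
    ∑ i ∈ s, ‖∫ w, g w * e i w ∂A‖ₑ ^ 2 ≤ ∫⁻ w, ‖g w‖ₑ ^ 2 * V w ∂A := by
  rcases eq_or_ne (∫⁻ w, ‖g w‖ₑ ^ 2 * V w ∂A) ⊤ with htop | hfin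
  · rw [htop]; exact le_top
  have hAm : A ≪ A.withDensity W := withDensity_absolutelyContinuous' hW
    (hWV.mono fun z hz h0 => by simp [h0] at hz)
  have hCS : ∀ f : Lp ℂ 2 (A.withDensity W), (∫⁻ w, ‖g w * f w‖ₑ ∂A) ^ 2 ≤
      (∫⁻ w, ‖g w‖ₑ ^ 2 * V w ∂A) * ‖f‖ₑ ^ 2 := fun f => by
    have hf := aestronglyMeasurable_coeFn hAm f
    have h1 := sq_lintegral_mul_le (m := A) (hg.enorm.fun_mul (hV.pow_const (1 / 2 : ℝ)))
      (hf.enorm.fun_mul (hW.pow_const (1 / 2 : ℝ)))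
    simp only [mul_pow, sq_rpow_half] at h1
    rw [enorm_sq_eq_lintegral, lintegral_withDensity_eq_lintegral_mul₀ hW (hf.enorm.pow_const 2)]
    refine le_trans (le_of_eq ?_) (h1.trans (le_of_eq ?_))
    · congr 1
      refine lintegral_congr_ae (hWV.mono fun z hz => ?_)
      simp only
      calc _ = ‖g z‖ₑ * ‖f z‖ₑ * (W z * V z) ^ (1 / 2 : ℝ) := by
            rw [hz, ENNReal.one_rpow, mul_one, enorm_mul]
        _ = _ := by rw [ENNReal.mul_rpow_of_nonneg _ _ (by norm_num)]; ring
    · simp only [Pi.mul_apply, mul_comm]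
  have hint : ∀ f : Lp ℂ 2 (A.withDensity W), Integrable (fun w => g w * f w) A := fun f => by
    refine ⟨hg.mul (aestronglyMeasurable_coeFn hAm f), ?_⟩
    have h1 : (∫⁻ w, ‖g w * f w‖ₑ ∂A) ^ 2 < ⊤ := (hCS f).trans_lt (by finiteness)
    exact lt_top_iff_ne_top.2 fun h0 => by
      rw [h0] at h1
      simp at h1
  set c : NNReal := ((∫⁻ w, ‖g w‖ₑ ^ 2 * V w ∂A) ^ (1 / 2 : ℝ)).toNNReal with hc
  have hcc : (c : ℝ≥0∞) ^ 2 = ∫⁻ w, ‖g w‖ₑ ^ 2 * V w ∂A := by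
    rw [hc, ENNReal.coe_toNNReal (by finiteness), sq_rpow_half]
  let T : Lp ℂ 2 (A.withDensity W) →ₗ[ℂ] ℂ :=
    { toFun := fun f => ∫ w, g w * f w ∂A
      map_add' := fun f f' => by
        rw [← integral_add (hint f) (hint f')]
        refine integral_congr_ae ?_
        filter_upwards [hAm (Lp.coeFn_add f f')] with w hw
        simp only [hw, Pi.add_apply, mul_add]
      map_smul' := fun a f => by
        rw [RingHom.id_apply, ← integral_smul]
        refine integral_congr_ae ?_
        filter_upwards [hAm (Lp.coeFn_smul a f)] with w hw
        simp only [hw, Pi.smul_apply, smul_eq_mul]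
        ring }
  have hT : ∀ f, ‖T f‖ ≤ c * ‖f‖ := fun f => by
    refine le_mul_of_enorm_sq_le (le_trans ?_ ((hCS f).trans_eq (by rw [hcc])))
    gcongr
    exact enorm_integral_le_lintegral_enorm _
  let ℓ := T.mkContinuous c hT
  have hℓ : ‖ℓ‖ ≤ c := T.mkContinuous_norm_le c.2 hT
  -- The functional is represented by a vector through the Riesz theorem, and the usual Bessel
  -- inequality applies to that vector.
  have hB := he.sum_inner_products_le (s := s) ((InnerProductSpace.toDual ℂ _).symm ℓ)
  rw [LinearIsometryEquiv.norm_map] at hB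
  have hB' : ∑ i ∈ s, ‖ℓ (e i)‖ ^ 2 ≤ c ^ 2 := by
    refine le_trans (le_of_eq ?_) (hB.trans (by gcongr))
    refine Finset.sum_congr rfl fun i _ => ?_
    rw [← InnerProductSpace.toDual_symm_apply, norm_inner_symm]
  rw [← hcc]
  have hB'' : ∑ i ∈ s, ‖ℓ (e i)‖₊ ^ 2 ≤ c ^ 2 := by
    rw [← NNReal.coe_le_coe]
    push_cast
    exact hB'
  have : ∀ i, ‖∫ w, g w * e i w ∂A‖ₑ = (‖ℓ (e i)‖₊ : ℝ≥0∞) := fun i => rfl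
  simp only [this]
  exact_mod_cast hB''

end

/-! ### Hilbert–Schmidt operators are compact -/

section

variable {H H' : Type*} [NormedAddCommGroup H] [InnerProductSpace ℂ H] [CompleteSpace H]
  [NormedAddCommGroup H'] [InnerProductSpace ℂ H']

lemma norm_sum_smul_le {ι : Type*} (s : Finset ι) (a : ι → ℂ) (y : ι → H') {p q : ℝ}
    (ha : ∑ i ∈ s, ‖a i‖ ^ 2 ≤ p ^ 2) (hy : ∑ i ∈ s, ‖y i‖ ^ 2 ≤ q ^ 2) (hp : 0 ≤ p) (hq : 0 ≤ q) :
    ‖∑ i ∈ s, a i • y i‖ ≤ p * q := by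
  refine (norm_sum_le _ _).trans (abs_le_of_sq_le_sq' ?_ (by positivity)).2
  simp only [norm_smul]
  calc _ ≤ (∑ i ∈ s, ‖a i‖ ^ 2) * ∑ i ∈ s, ‖y i‖ ^ 2 := Finset.sum_mul_sq_le_sq_mul_sq _ _ _
    _ ≤ p ^ 2 * q ^ 2 := by gcongr
    _ = _ := by ring

/-- Hilbert–Schmidt operators are compact. -/
lemma isCompactOperator_of_sum_sq_le [CompleteSpace H'] (S : H →L[ℂ] H') (B : ℝ)
    (hS : ∀ (w : Set H) (s : Finset w), Orthonormal ℂ ((↑) : w → H) →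
      ∑ i ∈ s, ‖S i‖ ^ 2 ≤ B) : IsCompactOperator S := by
  classical
  obtain ⟨w, e, he⟩ := exists_hilbertBasis ℂ H
  have hon : Orthonormal ℂ ((↑) : w → H) := he ▸ e.orthonormal
  have hsum : Summable fun i : w => ‖S i‖ ^ 2 :=
    summable_of_sum_le (fun i => by positivity) fun s => hS w s hon
  -- Finite rank truncations of S in a Hilbert basis.
  let P : Finset w → H →L[ℂ] H' := fun s => ∑ i ∈ s,
    (ContinuousLinearMap.toSpanSingleton ℂ (S i)).comp (innerSL ℂ (i : H))
  have hPapp : ∀ s x, P s x = ∑ i ∈ s, inner ℂ (i : H) x • S i := fun s x => by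
    simp [P]
  have hP : ∀ s, IsCompactOperator (P s) := fun s => by
    induction s using Finset.cons_induction with
    | empty => simpa [P] using isCompactOperator_zero
    | cons a s ha ih =>
      have : P (Finset.cons a s ha) =
          (ContinuousLinearMap.toSpanSingleton ℂ (S a)).comp (innerSL ℂ (a : H)) + P s := by
        simp only [P, Finset.sum_cons]
      have h1 : IsCompactOperator
          ((ContinuousLinearMap.toSpanSingleton ℂ (S a)).comp (innerSL ℂ (a : H))) :=
        (isCompactOperator_of_locallyCompactSpace_dom (innerSL ℂ (a : H))).clm_comp
          (ContinuousLinearMap.toSpanSingleton ℂ (S a))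
      rw [this]
      exact h1.add ih
  refine isCompactOperator_of_tendsto (l := atTop) (F := P) ?_ (Eventually.of_forall hP)
  rw [Metric.tendsto_atTop]
  intro ε hε
  -- Beyond s₀ the square sums of ‖S e_i‖ are below (ε/2)², and Cauchy–Schwarz with Bessel turns
  -- this into operator norm smallness of S - P s.
  obtain ⟨s₀, hs₀⟩ := (summable_iff_vanishing_norm.1 hsum) ((ε / 2) ^ 2) (by positivity)
  refine ⟨s₀, fun s hs => ?_⟩
  rw [dist_eq_norm, norm_sub_rev]
  refine lt_of_le_of_lt (ContinuousLinearMap.opNorm_le_bound _ (half_pos hε).le fun x => ?_)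
    (half_lt_self hε)
  have hx : HasSum (fun i : w => inner ℂ (i : H) x • S i) (S x) := by
    have := (e.hasSum_repr x).mapL S
    simpa [e.repr_apply_apply, he] using this
  refine le_of_tendsto ((hx.sub_const (P s x)).norm) ?_
  filter_upwards [eventually_ge_atTop s] with t ht
  rw [hPapp, ← Finset.sum_sdiff ht, add_sub_cancel_right, mul_comm]
  refine norm_sum_smul_le _ _ _ (hon.sum_inner_products_le x) ?_ (norm_nonneg _) (by positivity)
  have := hs₀ (t \ s) (Finset.disjoint_of_subset_right hs Finset.sdiff_disjoint)
  exact ((le_abs_self _).trans_lt this).le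

end

lemma isCompactOperator_of_forall_norm_sub_le {H H' : Type*} [NormedAddCommGroup H]
    [NormedSpace ℂ H] [NormedAddCommGroup H'] [NormedSpace ℂ H'] [CompleteSpace H']
    {S : H →L[ℂ] H'} (h : ∀ ε : ℝ, 0 < ε → ∃ T : H →L[ℂ] H', IsCompactOperator T ∧ ‖S - T‖ ≤ ε) :
    IsCompactOperator S := by
  choose! T hT hd using h
  refine isCompactOperator_of_tendsto (l := atTop) (F := fun n : ℕ => T (1 / ((n : ℝ) + 1))) ?_
    (Eventually.of_forall fun n => hT _ Nat.one_div_pos_of_nat)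
  rw [tendsto_iff_norm_sub_tendsto_zero]
  refine squeeze_zero (fun n => norm_nonneg _) (fun n => ?_) tendsto_one_div_add_atTop_nhds_zero_nat
  rw [norm_sub_rev]
  exact hd _ Nat.one_div_pos_of_nat

lemma exists_nnreal_sq {C : ℝ≥0∞} (hC : C ≠ ⊤) : ∃ c : NNReal, (c : ℝ≥0∞) ^ 2 = C :=
  ⟨(C ^ (1 / 2 : ℝ)).toNNReal, by rw [ENNReal.coe_toNNReal (by finiteness), sq_rpow_half]⟩

/-! ### Compactness of integral operators with product-dominated kernels -/

section

variable {X : Type*} [MeasurableSpace X] {A l : Measure X} {W V : X → ℝ≥0∞} {κ : X → X → ℂ}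

lemma sq_lintegral_mul_le_of_mul_eq_one (hW : AEMeasurable W A) (hV : AEMeasurable V A)
    (hWV : ∀ᵐ z ∂A, W z * V z = 1) {v f : X → ℝ≥0∞} (hv : AEMeasurable v A)
    (hf : AEMeasurable f A) :
    (∫⁻ w, v w * f w ∂A) ^ 2 ≤ (∫⁻ w, v w ^ 2 * V w ∂A) * ∫⁻ w, f w ^ 2 * W w ∂A := by
  have h1 := sq_lintegral_mul_le (m := A) (hv.fun_mul (hV.pow_const (1 / 2 : ℝ)))
    (hf.fun_mul (hW.pow_const (1 / 2 : ℝ)))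
  simp only [mul_pow, sq_rpow_half] at h1
  refine le_trans (le_of_eq ?_) h1
  congr 1
  refine lintegral_congr_ae (hWV.mono fun z hz => ?_)
  simp only
  calc _ = v z * f z * (W z * V z) ^ (1 / 2 : ℝ) := by rw [hz, ENNReal.one_rpow, mul_one]
    _ = _ := by rw [ENNReal.mul_rpow_of_nonneg _ _ (by norm_num)]; ring

/-- Kernels dominated by a product of square integrable functions define compact operators. -/
lemma exists_compact_clm_of_le_mul [SFinite A] (hW : AEMeasurable W A) (hV : AEMeasurable V A)
    (hWV : ∀ᵐ z ∂A, W z * V z = 1) (hAl : A ≪ l) (hlA : l ≪ A)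
    (hκ : Measurable fun p : X × X => κ p.1 p.2) {u v : X → ℝ≥0∞} (hu : AEMeasurable u A)
    (hv : AEMeasurable v A) (hle : ∀ z w, ‖κ z w‖ₑ ≤ u z * v w)
    (hul : ∫⁻ z, u z ^ 2 ∂l ≠ ⊤) (hvV : ∫⁻ w, v w ^ 2 * V w ∂A ≠ ⊤) :
    (∀ f : Lp ℂ 2 (A.withDensity W), ∀ᵐ z ∂A, Integrable (fun w => κ z w * f w) A) ∧
    ∃ S : Lp ℂ 2 (A.withDensity W) →L[ℂ] Lp ℂ 2 l, IsCompactOperator S ∧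
      ∀ f : Lp ℂ 2 (A.withDensity W), S f =ᵐ[A] fun z => ∫ w, κ z w * f w ∂A := by
  have hAm : A ≪ A.withDensity W := withDensity_absolutelyContinuous' hW
    (hWV.mono fun z hz h0 => by simp [h0] at hz)
  obtain ⟨c, hc⟩ := exists_nnreal_sq (ENNReal.mul_ne_top hul hvV)
  have hbd : ∀ f : X → ℝ≥0∞, AEMeasurable f A → ∫⁻ z, (∫⁻ w, ‖κ z w‖ₑ * f w ∂A) ^ 2 ∂l ≤
      c ^ 2 * ∫⁻ w, f w ^ 2 ∂A.withDensity W := fun f hf => by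
    have h1 : ∫⁻ w, f w ^ 2 ∂A.withDensity W = ∫⁻ w, f w ^ 2 * W w ∂A := by
      rw [lintegral_withDensity_eq_lintegral_mul₀ hW (hf.pow_const 2)]
      simp only [Pi.mul_apply, mul_comm]
    calc _ ≤ ∫⁻ z, u z ^ 2 * (∫⁻ w, v w * f w ∂A) ^ 2 ∂l := by
          refine lintegral_mono fun z => ?_
          rw [← mul_pow, ← lintegral_const_mul'' _ (hv.fun_mul hf)]
          refine pow_le_pow_left' (lintegral_mono fun w => ?_) 2
          rw [← mul_assoc]
          exact mul_le_mul_left (hle z w) _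
      _ = (∫⁻ z, u z ^ 2 ∂l) * (∫⁻ w, v w * f w ∂A) ^ 2 := by
          rw [lintegral_mul_const'' _ ((hu.mono_ac hlA).pow_const 2)]
      _ ≤ _ := by
          rw [hc, h1, mul_assoc]
          exact mul_le_mul_right (sq_lintegral_mul_le_of_mul_eq_one hW hV hWV hv hf) _
  obtain ⟨S, -, hS⟩ := exists_integral_clm hAm hAl hlA hκ hbd
  refine ⟨ae_integrable_kernel hAm hAl hlA hκ hbd, S,
    isCompactOperator_of_sum_sq_le S (c ^ 2) fun w s he => ?_, hS⟩
  -- For almost every z, Bessel's inequality for the functional with kernel κ(z, ·) bounds the sum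
  -- at z by u(z)² ∫ v²V; integration over z gives the Hilbert–Schmidt bound.
  have hmain : ∑ i ∈ s, ‖S i‖ₑ ^ 2 ≤ (c : ℝ≥0∞) ^ 2 := by
    simp only [enorm_sq_eq_lintegral]
    rw [← lintegral_finsetSum' (f := fun (i : w) z => ‖S i z‖ₑ ^ 2) _
      fun i _ => (Lp.aestronglyMeasurable (S i)).enorm.pow_const 2, hc,
      ← lintegral_mul_const'' _ ((hu.mono_ac hlA).pow_const 2)]
    have h1 : ∀ᵐ z ∂l, ∀ i ∈ s, S i z = ∫ w, κ z w * (i : Lp ℂ 2 (A.withDensity W)) w ∂A := by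
      rw [Filter.eventually_all_finset]
      exact fun i _ => hlA (hS i)
    refine lintegral_mono_ae (h1.mono fun z hz => ?_)
    calc _ = ∑ i ∈ s, ‖∫ w, κ z w * (i : Lp ℂ 2 (A.withDensity W)) w ∂A‖ₑ ^ 2 :=
          Finset.sum_congr rfl fun i hi => by rw [hz i hi]
      _ ≤ ∫⁻ w, ‖κ z w‖ₑ ^ 2 * V w ∂A := sum_enorm_integral_sq_le hW hV hWV
          (hκ.of_uncurry_left (x := z)).aestronglyMeasurable he s
      _ ≤ ∫⁻ w, u z ^ 2 * (v w ^ 2 * V w) ∂A := lintegral_mono fun w => by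
          rw [← mul_assoc, ← mul_pow]
          exact mul_le_mul_left (pow_le_pow_left' (hle z w) 2) _
      _ = _ := lintegral_const_mul'' _ ((hv.pow_const 2).fun_mul hV)
  have h2 : ∑ i ∈ s, ‖S i‖₊ ^ 2 ≤ c ^ 2 := by
    simp only [enorm_eq_nnnorm] at hmain
    exact_mod_cast hmain
  rw [← NNReal.coe_le_coe] at h2
  push_cast at h2
  exact h2

end

/-! ### The operator P⁺ν P⁺ between the two weighted spaces -/

section

variable {α : ℝ} {𝒟₁ 𝒟₂ : Set (ℝ × ℝ)} {Wμ Vμ Wl Vl Wν Vν : ℂ → ℝ≥0∞}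

lemma B2Pair.absolutelyContinuous (h : B2Pair α (𝒟₁ ∪ 𝒟₂) Wμ Vμ) :
    areaMeasure α ≪ (areaMeasure α).withDensity Wμ :=
  withDensity_absolutelyContinuous' h.aem_left h.ne_zero_ae

lemma lintegral_withDensity_sq (hW : AEMeasurable Wμ (areaMeasure α)) {f : ℂ → ℝ≥0∞}
    (hf : AEMeasurable f (areaMeasure α)) :
    ∫⁻ w, f w ^ 2 ∂(areaMeasure α).withDensity Wμ = ∫⁻ w, f w ^ 2 * Wμ w ∂areaMeasure α := by
  rw [lintegral_withDensity_eq_lintegral_mul₀ hW (hf.pow_const 2)]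
  simp only [Pi.mul_apply, mul_comm]

/-- The composition `P⁺ ν P⁺` as an integral operator. -/
lemma lintegral_lintegral_kerP_mul_kerP (hν : B2Pair α (𝒟₁ ∪ 𝒟₂) Wν Vν) {f : ℂ → ℝ≥0∞}
    (hf : AEMeasurable f (areaMeasure α)) (z : ℂ) :
    ∫⁻ w, (∫⁻ ζ, kerP α z ζ * kerP α w ζ ∂(areaMeasure α).withDensity Wν) * f w ∂areaMeasure α =
      opP α (fun ζ => Wν ζ * opP α f ζ) z := by
  have h1 : ∀ w, (∫⁻ ζ, kerP α z ζ * kerP α w ζ ∂(areaMeasure α).withDensity Wν) * f w =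
      ∫⁻ ζ, Wν ζ * (kerP α z ζ * kerP α w ζ) * f w ∂areaMeasure α := fun w => by
    have hm : AEMeasurable (fun ζ => kerP α z ζ * kerP α w ζ) (areaMeasure α) :=
      ((measurable_kerP_right α z).mul (measurable_kerP_right α w)).aemeasurable
    rw [lintegral_withDensity_eq_lintegral_mul₀ hν.aem_left hm,
      ← lintegral_mul_const'' _ (hν.aem_left.mul hm)]
    rfl
  simp only [h1]
  rw [lintegral_lintegral_swap, opP]
  · refine lintegral_congr fun ζ => ?_
    rw [opP, ← mul_assoc,
      ← lintegral_const_mul'' _ ((measurable_kerP_right α ζ).aemeasurable.fun_mul hf)]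
    refine lintegral_congr fun w => ?_
    rw [kerP_comm α w ζ]
    ring
  · refine AEMeasurable.fun_mul (AEMeasurable.fun_mul hν.aem_left.comp_snd ?_) hf.comp_fst
    exact ((Measurable.kerP α measurable_const measurable_snd).mul
      (Measurable.kerP α measurable_fst measurable_snd)).aemeasurable

/-- P⁺ is bounded on L²(μ), multiplication by ν is isometric into L²(λ) because ν²λ = μ, and P⁺ is
bounded on L²(λ). The norm bound is linear in c, so a small domination constant gives a small
operator. -/
lemma exists_lintegral_kernel_sq_le (hα : -1 < α) (h𝒟 : AreAdjacent 𝒟₁ 𝒟₂)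
    (hμ : B2Pair α (𝒟₁ ∪ 𝒟₂) Wμ Vμ) (hl : B2Pair α (𝒟₁ ∪ 𝒟₂) Wl Vl)
    (hν : B2Pair α (𝒟₁ ∪ 𝒟₂) Wν Vν)
    (hrel : ∀ᵐ z ∂areaMeasure α, Wν z ^ 2 * Wl z = Wμ z) :
    ∃ C : NNReal, ∀ (κ : ℂ → ℂ → ℂ) (c : NNReal),
      (∀ z w, 0 < z.im → 0 < w.im →
        ‖κ z w‖ₑ ≤ c * ∫⁻ ζ, kerP α z ζ * kerP α w ζ ∂(areaMeasure α).withDensity Wν) →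
      ∀ f : ℂ → ℝ≥0∞, AEMeasurable f (areaMeasure α) →
        ∫⁻ z, (∫⁻ w, ‖κ z w‖ₑ * f w ∂areaMeasure α) ^ 2 ∂(areaMeasure α).withDensity Wl ≤
          ((c * C : NNReal) : ℝ≥0∞) ^ 2 * ∫⁻ w, f w ^ 2 ∂(areaMeasure α).withDensity Wμ := by
  obtain ⟨C₁, hC₁, H₁⟩ := lintegral_opP_sq_le hα h𝒟 hμ
  obtain ⟨C₂, hC₂, H₂⟩ := lintegral_opP_sq_le hα h𝒟 hl
  obtain ⟨C, hC⟩ := exists_nnreal_sq (ENNReal.mul_ne_top hC₂ hC₁)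
  refine ⟨C, fun κ c hκ f hf => ?_⟩
  have hmf := hν.aem_left.fun_mul (aemeasurable_opP hf)
  rw [lintegral_withDensity_sq hμ.aem_left hf]
  calc _ ≤ ∫⁻ z, (c * opP α (fun ζ => Wν ζ * opP α f ζ) z) ^ 2
        ∂(areaMeasure α).withDensity Wl := by
        refine lintegral_mono_ae (withDensity_absolutelyContinuous _ _
          ((ae_mem_upperHalf α).mono fun z hz => ?_))
        refine pow_le_pow_left' ?_ 2
        rw [← lintegral_lintegral_kerP_mul_kerP hν hf]
        refine le_trans (lintegral_mono_ae ((ae_mem_upperHalf α).mono fun w hw => ?_))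
          (lintegral_const_mul' _ _ ENNReal.coe_ne_top).le
        rw [← mul_assoc]
        exact mul_le_mul_left (hκ z w hz hw) _
    _ = c ^ 2 * ∫⁻ z, opP α (fun ζ => Wν ζ * opP α f ζ) z ^ 2 * Wl z ∂areaMeasure α := by
        rw [← lintegral_withDensity_sq hl.aem_left (aemeasurable_opP hmf),
          ← lintegral_const_mul' _ _ (by finiteness)]
        simp only [mul_pow]
    _ ≤ c ^ 2 * (C₂ * ∫⁻ z, (Wν z * opP α f z) ^ 2 * Wl z ∂areaMeasure α) :=
        mul_le_mul_right (H₂ _ hmf) _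
    _ = c ^ 2 * (C₂ * ∫⁻ z, opP α f z ^ 2 * Wμ z ∂areaMeasure α) := by
        congr 2
        exact lintegral_congr_ae (hrel.mono fun z hz => by simp only; rw [← hz]; ring)
    _ ≤ c ^ 2 * (C₂ * (C₁ * ∫⁻ z, f z ^ 2 * Wμ z ∂areaMeasure α)) :=
        mul_le_mul_right (mul_le_mul_right (H₁ _ hf) _) _
    _ = _ := by
        rw [ENNReal.coe_mul, mul_pow, hC]
        ring

end

/-! ### Sufficiency: compactness from a vanishing derivative -/

section

variable {α : ℝ} {𝒟₁ 𝒟₂ : Set (ℝ × ℝ)} {Wμ Vμ Wl Vl Wν Vν : ℂ → ℝ≥0∞} {K : ℂ → ℂ → ℂ}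

/-- The integral operator converges absolutely on `L²` of a Békollé–Bonami weight. -/
lemma ae_integrable_kernel_mul (hα : -1 < α) (h𝒟 : AreAdjacent 𝒟₁ 𝒟₂)
    (hμ : B2Pair α (𝒟₁ ∪ 𝒟₂) Wμ Vμ) (hK : Measurable fun p : ℂ × ℂ => K p.1 p.2)
    (hKk : ∀ z w, 0 < z.im → 0 < w.im → ‖K z w‖ₑ ≤ kerP α z w)
    (f : Lp ℂ 2 ((areaMeasure α).withDensity Wμ)) :
    ∀ᵐ z ∂areaMeasure α, Integrable (fun w => K z w * f w) (areaMeasure α) := by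
  obtain ⟨C, hC, H⟩ := lintegral_opP_sq_le hα h𝒟 hμ
  obtain ⟨c, hc⟩ := exists_nnreal_sq hC
  refine ae_integrable_kernel (c := c) hμ.absolutelyContinuous hμ.absolutelyContinuous
    (withDensity_absolutelyContinuous _ _) hK (fun f hf => ?_) f
  rw [lintegral_withDensity_sq hμ.aem_left hf, hc]
  refine le_trans ?_ (H f hf)
  rw [← lintegral_withDensity_sq hμ.aem_left (aemeasurable_opP hf)]
  refine lintegral_mono_ae (withDensity_absolutelyContinuous _ _
    ((ae_mem_upperHalf α).mono fun z hz => pow_le_pow_left' ?_ 2))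
  exact lintegral_mono_ae ((ae_mem_upperHalf α).mono fun w hw => mul_le_mul_left (hKk z w hz hw) _)

/-- The commutator with a symbol whose derivative vanishes at the boundary is compact. -/
theorem DerivVanish.isCompactOperator (hα : -1 < α) (h𝒟 : AreAdjacent 𝒟₁ 𝒟₂)
    (hμ : B2Pair α (𝒟₁ ∪ 𝒟₂) Wμ Vμ) (hl : B2Pair α (𝒟₁ ∪ 𝒟₂) Wl Vl)
    (hν : B2Pair α (𝒟₁ ∪ 𝒟₂) Wν Vν) (hrel : ∀ᵐ z ∂areaMeasure α, Wν z ^ 2 * Wl z = Wμ z)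
    (hK : Measurable fun p : ℂ × ℂ => K p.1 p.2)
    (hKk : ∀ z w, 0 < z.im → 0 < w.im → ‖K z w‖ₑ ≤ kerP α z w)
    {b : ℂ → ℂ} (hb : DifferentiableOn ℂ b upperHalf) {C₀ : ℝ≥0∞} (hC₀ : C₀ ≠ ⊤)
    (hbd : DerivBound α b (C₀ • (areaMeasure α).withDensity Wν))
    (hv : DerivVanish α b ((areaMeasure α).withDensity Wν)) :
    (∀ f : Lp ℂ 2 ((areaMeasure α).withDensity Wμ), ∀ᵐ z ∂areaMeasure α,
      Integrable (fun w => K z w * f w) (areaMeasure α) ∧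
      Integrable (fun w => K z w * (b w * f w)) (areaMeasure α)) ∧
    ∃ S : Lp ℂ 2 ((areaMeasure α).withDensity Wμ) →L[ℂ] Lp ℂ 2 ((areaMeasure α).withDensity Wl),
      IsCompactOperator S ∧ ∀ f : Lp ℂ 2 ((areaMeasure α).withDensity Wμ),
        S f =ᵐ[areaMeasure α] commutator b (integralOp α K) f := by
  set A := areaMeasure α with hA
  have hAm := hμ.absolutelyContinuous
  have hAl := hl.absolutelyContinuous
  have hlA : A.withDensity Wl ≪ A := withDensity_absolutelyContinuous _ _
  have hbm := measurable_indicator_upperHalf hb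
  have hae := ae_mem_upperHalf α
  -- Outside the half plane b is arbitrary; cutting it off makes the kernel measurable without
  -- changing it almost everywhere.
  set b' := upperHalf.indicator b with hb'
  have hbb : ∀ z, 0 < z.im → b' z = b z := fun z hz => indicator_of_mem (s := upperHalf) hz b
  set κ : ℂ → ℂ → ℂ := fun z w => (b' z - b' w) * K z w with hκ
  have hκm : Measurable fun p : ℂ × ℂ => κ p.1 p.2 :=
    ((hbm.comp measurable_fst).sub (hbm.comp measurable_snd)).mul hK
  have hκle : ∀ z w, 0 < z.im → 0 < w.im → ‖κ z w‖ₑ ≤ ‖b z - b w‖ₑ * kerP α z w :=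
    fun z w hz hw => by
      simp only [hκ, enorm_mul, hbb z hz, hbb w hw]
      exact mul_le_mul_right (hKk z w hz hw) _
  obtain ⟨C, hC⟩ := exists_lintegral_kernel_sq_le hα h𝒟 hμ hl hν hrel
  obtain ⟨C₁, hC₁, H₁⟩ := DerivBound.enorm_sub_mul_kerP_le hα
  have htot : ∀ z w, 0 < z.im → 0 < w.im → ‖κ z w‖ₑ ≤ ((C₁ * C₀).toNNReal : ℝ≥0∞) *
      ∫⁻ ζ, kerP α z ζ * kerP α w ζ ∂A.withDensity Wν := fun z w hz hw => by
    rw [ENNReal.coe_toNNReal (by finiteness)]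
    refine (hκle z w hz hw).trans ((H₁ b _ hb hbd z w hz hw).trans_eq ?_)
    rw [lintegral_smul_measure, mul_assoc, smul_eq_mul]
  have hint := ae_integrable_kernel hAm hAl hlA hκm (hC κ _ htot)
  obtain ⟨S, -, hS⟩ := exists_integral_clm hAm hAl hlA hκm (hC κ _ htot)
  have hintK := ae_integrable_kernel_mul hα h𝒟 hμ hK hKk
  -- The integrals defining T f and κ converge separately; this identity yields convergence of T(bf)
  -- and identifies the commutator with the operator of kernel κ.
  have hkey : ∀ f : Lp ℂ 2 (A.withDensity Wμ), ∀ᵐ z ∂A, (fun w => K z w * (b w * f w)) =ᵐ[A]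
      fun w => b z * (K z w * f w) - κ z w * f w := fun f => by
    filter_upwards [hae] with z hz
    filter_upwards [hae] with w hw
    simp only [hκ, hbb z hz, hbb w hw]
    ring
  refine ⟨fun f => ?_, S, isCompactOperator_of_forall_norm_sub_le fun ε hε => ?_, fun f => ?_⟩
  · filter_upwards [hint f, hintK f, hkey f] with z h1 h2 h3
    exact ⟨h2, ((h2.const_mul (b z)).sub h1).congr h3.symm⟩
  · set δ : NNReal := (ε / (C + 1)).toNNReal with hδ
    have hδ0 : 0 < δ := Real.toNNReal_pos.2 (by positivity)
    obtain ⟨M, hM, hsplit⟩ := hv.exists_split hν hα h𝒟 hb hC₀ hbd (ε := (δ : ℝ≥0∞) / 2)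
      (ENNReal.div_pos (by exact_mod_cast hδ0.ne') (by finiteness)).ne'
    -- The kernel is cut according to whether the rank one term dominates it. On E it is
    -- Hilbert–Schmidt.
    set E : Set (ℂ × ℂ) := {p | ‖κ p.1 p.2‖ₑ ≤
      2 * M * kerP α Complex.I p.1 * kerP α Complex.I p.2} with hE
    have hEm : MeasurableSet E := measurableSet_le hκm.enorm
      ((measurable_const.mul ((measurable_kerP_right α _).comp measurable_fst)).mul
        ((measurable_kerP_right α _).comp measurable_snd))
    set κ₁ : ℂ → ℂ → ℂ := fun z w => E.indicator (fun p => κ p.1 p.2) (z, w) with hκ₁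
    set κ₂ : ℂ → ℂ → ℂ := fun z w => Eᶜ.indicator (fun p => κ p.1 p.2) (z, w) with hκ₂
    have hκ₁m : Measurable fun p : ℂ × ℂ => κ₁ p.1 p.2 := hκm.indicator hEm
    have hκ₂m : Measurable fun p : ℂ × ℂ => κ₂ p.1 p.2 := hκm.indicator hEm.compl
    have hsum : ∀ z w, κ z w = κ₁ z w + κ₂ z w := fun z w =>
      (indicator_self_add_compl_apply E (fun p : ℂ × ℂ => κ p.1 p.2) (z, w)).symm
    have hle₁ : ∀ z w, ‖κ₁ z w‖ₑ ≤ 2 * M * kerP α Complex.I z * kerP α Complex.I w := fun z w => by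
      by_cases h : (z, w) ∈ E
      · simp only [hκ₁, indicator_of_mem h]
        exact h
      · simp [hκ₁, indicator_of_notMem h]
    have hle₂ : ∀ z w, 0 < z.im → 0 < w.im → ‖κ₂ z w‖ₑ ≤
        δ * ∫⁻ ζ, kerP α z ζ * kerP α w ζ ∂A.withDensity Wν := fun z w hz hw => by
      by_cases h : (z, w) ∈ Eᶜ
      · simp only [hκ₂, indicator_of_mem h]
        have h1 := (hκle z w hz hw).trans (hsplit z w hz hw)
        have h2 : 2 * M * kerP α Complex.I z * kerP α Complex.I w ≤ ‖κ z w‖ₑ :=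
          (lt_of_not_ge fun h' => h h').le
        -- Off E twice the rank one term is less than |κ|, so doubling the splitting bound allows it
        -- to be absorbed; this is why the splitting was taken with δ/2.
        refine (ENNReal.add_le_add_iff_right (enorm_ne_top (x := κ z w))).1 ?_
        set J := ∫⁻ ζ, kerP α z ζ * kerP α w ζ ∂A.withDensity Wν
        calc _ ≤ (2 : ℝ≥0∞) * ((δ : ℝ≥0∞) / 2 * J +
              M * (kerP α Complex.I z * kerP α Complex.I w)) := by
              rw [← two_mul]; exact mul_le_mul_right h1 _
          _ = (2 * ((δ : ℝ≥0∞) / 2)) * J + 2 * M * kerP α Complex.I z * kerP α Complex.I w := by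
              ring
          _ ≤ _ := by
              rw [ENNReal.mul_div_cancel (by norm_num) (by norm_num)]
              gcongr
      · simp [hκ₂, indicator_of_notMem h]
    have hu : ∫⁻ z, (2 * M * kerP α Complex.I z) ^ 2 ∂A.withDensity Wl ≠ ⊤ := by
      simp only [mul_pow (2 * M)]
      rw [lintegral_const_mul' _ _ (by finiteness),
        lintegral_withDensity_sq hl.aem_left (measurable_kerP_right α _).aemeasurable]
      exact ENNReal.mul_ne_top (by finiteness) (hl.symm.lintegral_kerP_I_sq_ne_top hα h𝒟)
    obtain ⟨hint₁, S₁, hS₁c, hS₁⟩ := exists_compact_clm_of_le_mul hμ.aem_left hμ.aem_right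
      hμ.mul_eq hAl hlA hκ₁m ((measurable_kerP_right α _).const_mul _).aemeasurable
      (measurable_kerP_right α _).aemeasurable hle₁ hu (hμ.lintegral_kerP_I_sq_ne_top hα h𝒟)
    have hint₂ := ae_integrable_kernel hAm hAl hlA hκ₂m (hC κ₂ δ hle₂)
    obtain ⟨S₂, hS₂n, hS₂⟩ := exists_integral_clm hAm hAl hlA hκ₂m (hC κ₂ δ hle₂)
    refine ⟨S₁, hS₁c, ?_⟩
    have hSS : S - S₁ = S₂ := by
      ext1 f
      refine Lp.ext (hlA ?_)
      filter_upwards [hS f, hS₁ f, hS₂ f, hAl (Lp.coeFn_sub (S f) (S₁ f)), hint₁ f, hint₂ f]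
        with z h h1 h2 h3 h4 h5
      rw [_root_.sub_apply, h3, Pi.sub_apply, h, h1, h2, sub_eq_iff_eq_add,
        ← integral_add h5 h4]
      simp only [hsum, add_mul, add_comm]
    rw [hSS]
    refine hS₂n.trans ?_
    have h1 : (δ : ℝ) = ε / (C + 1) := Real.coe_toNNReal _ (by positivity)
    rw [NNReal.coe_mul, h1, div_mul_eq_mul_div, div_le_iff₀ (by positivity)]
    nlinarith
  · filter_upwards [hS f, hint f, hintK f, hkey f] with z h0 h1 h2 h3
    rw [h0, commutator, integralOp, integralOp, integral_congr_ae h3,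
      integral_sub (h2.const_mul _) h1, integral_const_mul]
    ring

end

/-! ### Local estimates for kernels of Bergman type -/

/-- The properties of the kernels of `P_α` and `P_α⁺` that the theory needs. -/
structure IsBergmanType (α : ℝ) (K : ℂ → ℂ → ℂ) : Prop where
  measurable : Measurable fun p : ℂ × ℂ => K p.1 p.2
  enorm_le : ∀ z w, 0 < z.im → 0 < w.im → ‖K z w‖ₑ ≤ kerP α z w
  scale : ∀ (x y : ℝ) (z w : ℂ), 0 < y → 0 < z.im → 0 < w.im →
    K (x + y * z) (x + y * w) = ((y ^ (-(2 + α)) : ℝ) : ℂ) * K z w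
  continuousAt : ContinuousAt (fun p : ℂ × ℂ => K p.1 p.2) (Complex.I, Complex.I)
  ne_zero : K Complex.I Complex.I ≠ 0

section

variable {α : ℝ} {𝒟₁ 𝒟₂ : Set (ℝ × ℝ)} {Wμ Vμ Wl Vl : ℂ → ℝ≥0∞}

/-- The weights `μ` and `λ⁻¹` are comparable on average to the Bloom weight. -/
lemma exists_measure_hball_mul_le (hα : -1 < α) (h𝒟 : AreAdjacent 𝒟₁ 𝒟₂)
    (hμ : B2Pair α (𝒟₁ ∪ 𝒟₂) Wμ Vμ) (hl : B2Pair α (𝒟₁ ∪ 𝒟₂) Wl Vl) :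
    ∃ C : ℝ≥0∞, C ≠ ⊤ ∧ ∀ ζ : ℂ, 0 < ζ.im →
      (areaMeasure α).withDensity Wμ (hball ζ (8 * ζ.im)) *
        (areaMeasure α).withDensity Vl (hball ζ (8 * ζ.im)) ≤
      C * (areaMeasure α).withDensity (fun z => (Wμ z * Vl z) ^ (1 / 2 : ℝ))
        (hball ζ (8 * ζ.im)) ^ 2 := by
  obtain ⟨C₁, hC₁, H₁⟩ := hμ.measure_hball_mul_le hα h𝒟
  obtain ⟨C₂, hC₂, H₂⟩ := hl.measure_hball_mul_le hα h𝒟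
  obtain ⟨c, hc, hcell⟩ := exists_area_cell hα
  have hc0 : ENNReal.ofReal c ^ 4 ≠ 0 := pow_ne_zero 4 (ENNReal.ofReal_pos.2 hc).ne'
  refine ⟨C₁ * C₂ * ENNReal.ofReal (8 ^ (2 + α)) ^ 4 / ENNReal.ofReal c ^ 4,
    ENNReal.div_ne_top (by finiteness) hc0, fun ζ hζ => ?_⟩
  set B := hball ζ (8 * ζ.im) with hB
  set A := areaMeasure α with hA
  set t := ENNReal.ofReal (ζ.im ^ (2 + α)) with ht
  have ht0 : t ^ 4 ≠ 0 := pow_ne_zero 4 (ENNReal.ofReal_pos.2 (by positivity)).ne'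
  have h1 := H₁ ζ (8 * ζ.im) hζ (by positivity)
  have h2 := H₂ ζ (8 * ζ.im) hζ (by positivity)
  rw [Real.mul_rpow (by norm_num) hζ.le, ENNReal.ofReal_mul (by positivity)] at h1 h2
  have h3 := (hμ.geom hl.symm).sq_measure_le' B
  have h4 : A.withDensity (fun z => (Vμ z * Wl z) ^ (1 / 2 : ℝ)) B ^ 2 ≤
      A.withDensity Vμ B * A.withDensity Wl B := by
    simp only [withDensity_apply']
    have := sq_lintegral_mul_le (m := A.restrict B) (hμ.aem_right.restrict.pow_const (1 / 2 : ℝ))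
      (hl.aem_left.restrict.pow_const (1 / 2 : ℝ))
    simp only [sq_rpow_half] at this
    refine le_trans (le_of_eq ?_) this
    simp only [ENNReal.mul_rpow_of_nonneg _ _ (show (0 : ℝ) ≤ 1 / 2 by norm_num)]
  have h5 : ENNReal.ofReal c * t ≤ A B := by
    rw [ht, ← ENNReal.ofReal_mul hc.le, ← hcell ζ hζ]
    exact measure_mono (cell_subset_hball hζ)
  generalize A.withDensity Wμ B = M at *
  generalize A.withDensity Vμ B = M' at *
  generalize A.withDensity Wl B = l at *
  generalize A.withDensity Vl B = l' at *
  generalize A.withDensity (fun z => (Wμ z * Vl z) ^ (1 / 2 : ℝ)) B = n at *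
  generalize A.withDensity (fun z => (Vμ z * Wl z) ^ (1 / 2 : ℝ)) B = n' at *
  generalize A B = a at *
  set e := ENNReal.ofReal (8 ^ (2 + α))
  set c' := ENNReal.ofReal c
  -- A(B)² ≤ ν(B)ν⁻¹(B) and ν⁻¹(B)² ≤ μ⁻¹(B)λ(B). After squaring the first, the products μ(B)μ⁻¹(B)
  -- and λ(B)λ⁻¹(B) appear, and both are bounded by the B₂ conditions.
  have h6 : (M * l') * c' ^ 4 * t ^ 4 ≤ (C₁ * C₂ * e ^ 4) * n ^ 2 * t ^ 4 := by
    calc _ = (M * l') * ((c' * t) ^ 2) ^ 2 := by ring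
      _ ≤ (M * l') * (a ^ 2) ^ 2 := by gcongr
      _ ≤ (M * l') * (n * n') ^ 2 := by gcongr
      _ = (M * l') * n ^ 2 * n' ^ 2 := by ring
      _ ≤ (M * l') * n ^ 2 * (M' * l) := by gcongr
      _ = (M * M') * (l * l') * n ^ 2 := by ring
      _ ≤ (C₁ * (e * t) ^ 2) * (C₂ * (e * t) ^ 2) * n ^ 2 :=
          mul_le_mul_left (mul_le_mul' h1 h2) _
      _ = _ := by ring
  have h7 := (ENNReal.mul_le_mul_iff_left ht0 (by finiteness)).1 h6
  rw [ENNReal.mul_comm_div, mul_div_assoc', ENNReal.le_div_iff_mul_le (.inl hc0) (.inl (by finiteness))]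
  exact h7

/-- The derivative bound propagates to a neighbourhood. -/
lemma DerivBound.exists_ball_le {Wν Vν : ℂ → ℝ≥0∞} (hα : -1 < α) (h𝒟 : AreAdjacent 𝒟₁ 𝒟₂)
    (hν : B2Pair α (𝒟₁ ∪ 𝒟₂) Wν Vν) {b : ℂ → ℂ} {C₀ : ℝ≥0∞} (hC₀ : C₀ ≠ ⊤)
    (hbd : DerivBound α b (C₀ • (areaMeasure α).withDensity Wν)) :
    ∃ C : ℝ≥0∞, C ≠ ⊤ ∧ ∀ ζ u : ℂ, 0 < ζ.im → ‖u - ζ‖ ≤ ζ.im / 2 →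
      ‖deriv b u‖ₑ * ENNReal.ofReal (ζ.im ^ (3 + α)) ≤
        C * (areaMeasure α).withDensity Wν (hball ζ (8 * ζ.im)) := by
  obtain ⟨C, hC, H⟩ := hν.measure_hball_le hα h𝒟 (Λ := 16) (by norm_num)
  refine ⟨ENNReal.ofReal (2 ^ (3 + α)) * (C₀ * C), by finiteness, fun ζ u hζ hu => ?_⟩
  have h1 := (Complex.abs_im_le_norm _).trans hu
  rw [Complex.sub_im, abs_le] at h1
  have hu0 : 0 < u.im := by linarith
  have h2 := hbd u hu0
  have h3 : ζ.im ^ (3 + α) ≤ 2 ^ (3 + α) * u.im ^ (3 + α) := by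
    rw [← Real.mul_rpow two_pos.le hu0.le]
    exact Real.rpow_le_rpow hζ.le (by linarith) (by linarith)
  calc _ ≤ ‖deriv b u‖ₑ * ENNReal.ofReal (2 ^ (3 + α) * u.im ^ (3 + α)) := by gcongr
    _ = ENNReal.ofReal (2 ^ (3 + α)) * (‖deriv b u‖ₑ * ENNReal.ofReal (u.im ^ (3 + α))) := by
        rw [ENNReal.ofReal_mul (by positivity)]; ring
    _ ≤ ENNReal.ofReal (2 ^ (3 + α)) * (C₀ * (areaMeasure α).withDensity Wν
          (hball ζ (16 * ζ.im))) := by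
        refine mul_le_mul_right (h2.trans ?_) _
        rw [Measure.smul_apply, smul_eq_mul]
        refine mul_le_mul_right (measure_mono (hball_subset ?_)) _
        rw [norm_sub_rev]; linarith
    _ ≤ ENNReal.ofReal (2 ^ (3 + α)) * (C₀ * (C * (areaMeasure α).withDensity Wν
          (hball ζ (8 * ζ.im)))) := by
        gcongr; exact H ζ hζ
    _ = _ := by ring

end

/-! ### Test functions -/

/-- A small square near `ζ`. -/
def testBox (ζ : ℂ) (p ρ : ℝ) : Set ℂ :=
  rect (ζ.re + p * ζ.im) (ζ.re + p * ζ.im + ρ * ζ.im) ζ.im (ζ.im + ρ * ζ.im)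

lemma norm_sub_le_of_mem_testBox {ζ w : ℂ} {p ρ : ℝ} (hw : w ∈ testBox ζ p ρ) :
    ‖w - ζ - (p * ζ.im : ℝ)‖ ≤ 2 * ρ * ζ.im := by
  refine (Complex.norm_le_abs_re_add_abs_im _).trans ?_
  obtain ⟨⟨h1, h2⟩, h3, h4⟩ := hw
  simp only [Complex.sub_re, Complex.sub_im, Complex.ofReal_re, Complex.ofReal_im]
  rw [abs_of_nonneg (by linarith), abs_of_nonneg (by linarith)]
  linarith

lemma norm_sub_le_of_mem_testBox' {ζ w : ℂ} {p η : ℝ} (hζ : 0 < ζ.im) (hp : |p| ≤ η)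
    (hη : η ≤ 1 / 12) (hw : w ∈ testBox ζ p (η ^ 2)) : ‖w - ζ‖ ≤ 2 * η * ζ.im := by
  have h1 := norm_sub_le_of_mem_testBox hw
  have h2 : ‖((p * ζ.im : ℝ) : ℂ)‖ ≤ η * ζ.im := by
    rw [Complex.norm_real, Real.norm_eq_abs, abs_mul, abs_of_pos hζ]
    gcongr
  have h3 := norm_add_le (w - ζ - (p * ζ.im : ℝ)) ((p * ζ.im : ℝ) : ℂ)
  rw [sub_add_cancel] at h3
  have h4 : 0 ≤ η := (abs_nonneg p).trans hp
  nlinarith [mul_nonneg h4 hζ.le]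

/-- First order Taylor expansion of `b` at `ζ`, on test squares. -/
lemma norm_sub_add_deriv_mul_le {b : ℂ → ℂ} (hb : DifferentiableOn ℂ b upperHalf) {ζ z w : ℂ}
    (hζ : 0 < ζ.im) {L η : ℝ} (hL0 : 0 ≤ L) (hL : ∀ u, ‖u - ζ‖ ≤ ζ.im / 2 → ‖deriv b u‖ ≤ L)
    (hη : 0 < η) (hη1 : η ≤ 1 / 12) (hz : z ∈ testBox ζ 0 (η ^ 2)) (hw : w ∈ testBox ζ η (η ^ 2)) :
    ‖b z - b w + deriv b ζ * (η * ζ.im : ℝ)‖ ≤ 26 * L * η ^ 2 * ζ.im := by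
  have hball_sub : Metric.ball ζ (ζ.im / 2) ⊆ upperHalf :=
    Metric.ball_subset_closedBall.trans (closedBall_subset_upperHalf (by linarith))
  have hz1 := norm_sub_le_of_mem_testBox' hζ (by simpa using hη.le) hη1 hz
  have hw1 := norm_sub_le_of_mem_testBox' hζ (abs_of_pos hη).le hη1 hw
  have hsmall : 2 * η * ζ.im < ζ.im / 2 := by nlinarith
  have hdiff : ∀ u ∈ Metric.closedBall ζ (2 * η * ζ.im), DifferentiableAt ℂ b u := fun u hu =>
    hb.differentiableAt (isOpen_upperHalf.mem_nhds (hball_sub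
      ((Metric.mem_closedBall.1 hu).trans_lt hsmall)))
  -- Schwarz lemma for b': it maps the disc of radius y/2 into a disc of radius 2L about b'(ζ), and
  -- the points considered are at distance at most 2ηy.
  have hder : ∀ u ∈ Metric.closedBall ζ (2 * η * ζ.im), ‖deriv b u - deriv b ζ‖ ≤ 8 * L * η := by
    intro u hu
    have h1 := Complex.dist_le_div_mul_dist_of_mapsTo_ball (f := deriv b) (c := ζ) (z := u)
      (R₁ := ζ.im / 2) (R₂ := 2 * L)
      ((hb.deriv isOpen_upperHalf).mono hball_sub) (fun v hv => by
        rw [Metric.mem_closedBall, dist_eq_norm]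
        have h2 := hL v (by rw [← dist_eq_norm]; exact (Metric.mem_ball.1 hv).le)
        have h3 := hL ζ (by rw [sub_self, norm_zero]; positivity)
        linarith [norm_sub_le (deriv b v) (deriv b ζ)])
      ((Metric.mem_closedBall.1 hu).trans_lt hsmall)
    rw [dist_eq_norm] at h1
    refine h1.trans ?_
    calc 2 * L / (ζ.im / 2) * dist u ζ ≤ 2 * L / (ζ.im / 2) * (2 * η * ζ.im) := by
          gcongr; exact hu
      _ = _ := by field_simp; ring
  have hmv := Convex.norm_image_sub_le_of_norm_deriv_le (𝕜 := ℂ)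
    (f := fun u => b u - deriv b ζ * u) (C := 8 * L * η)
    (fun u hu => (hdiff u hu).sub ((differentiableAt_id).const_mul _)) (fun u hu => by
      rw [deriv_fun_sub (hdiff u hu) (by fun_prop), deriv_const_mul_field, deriv_id'', mul_one]
      exact hder u hu)
    (convex_closedBall ζ (2 * η * ζ.im)) (mem_closedBall_iff_norm.2 hw1)
    (mem_closedBall_iff_norm.2 hz1)
  have hz2 := norm_sub_le_of_mem_testBox hz
  have hw2 := norm_sub_le_of_mem_testBox hw
  have hD := hL ζ (by rw [sub_self, norm_zero]; positivity)
  -- The squares have side η²y and are offset by ηy, so z - w is -ηy up to an error of second order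
  -- in η.
  have e1 : ‖z - w + (η * ζ.im : ℝ)‖ ≤ 4 * η ^ 2 * ζ.im := by
    have := norm_sub_le (z - ζ - ((0 * ζ.im : ℝ) : ℂ)) (w - ζ - (η * ζ.im : ℝ))
    rw [show z - ζ - ((0 * ζ.im : ℝ) : ℂ) - (w - ζ - (η * ζ.im : ℝ)) = z - w + (η * ζ.im : ℝ) by
      push_cast; ring] at this
    linarith
  have e2 : ‖z - w‖ ≤ 2 * η * ζ.im := by
    have h1 := norm_sub_le (z - w + (η * ζ.im : ℝ)) ((η * ζ.im : ℝ) : ℂ)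
    rw [add_sub_cancel_right, Complex.norm_real, Real.norm_eq_abs,
      abs_of_pos (by positivity)] at h1
    nlinarith [mul_pos hη hζ]
  calc _ = ‖(b z - deriv b ζ * z - (b w - deriv b ζ * w)) +
        deriv b ζ * (z - w + (η * ζ.im : ℝ))‖ := by congr 1; ring
    _ ≤ 8 * L * η * (2 * η * ζ.im) + L * (4 * η ^ 2 * ζ.im) := by
        refine (norm_add_le _ _).trans (add_le_add (hmv.trans (by gcongr)) ?_)
        rw [norm_mul]
        gcongr
    _ ≤ _ := by nlinarith [mul_nonneg hL0 (mul_nonneg (sq_nonneg η) hζ.le)]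

/-- Scaling moves ζ to i, where the kernel is nearly K(i,i) by continuity; the Taylor expansion
supplies the factor b(z) - b(w). The relative error is θ, uniformly in ζ. -/
lemma IsBergmanType.exists_norm_sub_le {α : ℝ} {K : ℂ → ℂ → ℂ} (hK : IsBergmanType α K) {θ : ℝ}
    (hθ : 0 < θ) : ∃ η : ℝ, 0 < η ∧ η ≤ 1 / 12 ∧ ∀ (b : ℂ → ℂ), DifferentiableOn ℂ b upperHalf →
      ∀ (ζ z w : ℂ) (L : ℝ), 0 < ζ.im → 0 ≤ L →
      (∀ u, ‖u - ζ‖ ≤ ζ.im / 2 → ‖deriv b u‖ ≤ L) →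
      z ∈ testBox ζ 0 (η ^ 2) → w ∈ testBox ζ η (η ^ 2) →
      ‖(ζ.im ^ (2 + α) : ℝ) * ((b z - b w) * K z w) +
        deriv b ζ * (η * ζ.im : ℝ) * K Complex.I Complex.I‖ ≤
          L * η * ζ.im * ‖K Complex.I Complex.I‖ * θ := by
  set K₀ := K Complex.I Complex.I with hK₀
  have hK₀0 : 0 < ‖K₀‖ := norm_pos_iff.2 hK.ne_zero
  obtain ⟨δ, hδ, H⟩ := Metric.continuousAt_iff.1 hK.continuousAt (min 1 (θ / 2) * ‖K₀‖)
    (by positivity)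
  -- δ/3 keeps the rescaled points, at distance at most 2η from i, in the continuity neighbourhood;
  -- θ/104 makes the Taylor error 52η at most θ/2.
  refine ⟨min (1 / 12) (min (δ / 3) (θ / 104)), by positivity, min_le_left _ _,
    fun b hb ζ z w L hζ hL0 hL hz hw => ?_⟩
  set η := min (1 / 12) (min (δ / 3) (θ / 104)) with hη
  have hη0 : 0 < η := by positivity
  have hη1 : η ≤ 1 / 12 := min_le_left _ _
  have hη2 : η ≤ δ / 3 := (min_le_right _ _).trans (min_le_left _ _)
  have hη3 : η ≤ θ / 104 := (min_le_right _ _).trans (min_le_right _ _)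
  have hX := norm_sub_add_deriv_mul_le hb hζ hL0 hL hη0 hη1 hz hw
  have hz1 := norm_sub_le_of_mem_testBox' hζ (by simpa using hη0.le) hη1 hz
  have hw1 := norm_sub_le_of_mem_testBox' hζ (abs_of_pos hη0).le hη1 hw
  have hy : (ζ.im : ℂ) ≠ 0 := by exact_mod_cast hζ.ne'
  have hnorm : ∀ u : ℂ, ‖u - ζ‖ ≤ 2 * η * ζ.im → ‖(u - ζ.re) / ζ.im - Complex.I‖ < δ := by
    intro u hu
    have : (u - ζ.re) / ζ.im - Complex.I = (u - ζ) / ζ.im := by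
      rw [eq_div_iff hy, sub_mul, div_mul_cancel₀ _ hy]
      conv_rhs => rw [← Complex.re_add_im ζ]
      ring
    rw [this, norm_div, Complex.norm_real, Real.norm_eq_abs, abs_of_pos hζ, div_lt_iff₀ hζ]
    nlinarith
  have him : ∀ u : ℂ, 0 < u.im → 0 < ((u - ζ.re) / ζ.im).im := fun u hu => by
    rw [Complex.div_ofReal_im, Complex.sub_im, Complex.ofReal_im, sub_zero]
    positivity
  have hz0 : 0 < z.im := hζ.trans_le hz.2.1
  have hw0 : 0 < w.im := hζ.trans_le hw.2.1
  have hsc := hK.scale ζ.re ζ.im _ _ hζ (him z hz0) (him w hw0)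
  rw [mul_div_cancel₀ _ hy, mul_div_cancel₀ _ hy, add_sub_cancel, add_sub_cancel] at hsc
  set κ := K ((z - ζ.re) / ζ.im) ((w - ζ.re) / ζ.im) with hκ
  have hκd : ‖κ - K₀‖ ≤ min 1 (θ / 2) * ‖K₀‖ := by
    rw [← dist_eq_norm]
    exact (H (x := ((z - ζ.re) / ζ.im, (w - ζ.re) / ζ.im)) (by
      rw [Prod.dist_eq, max_lt_iff, dist_eq_norm, dist_eq_norm]
      exact ⟨hnorm z hz1, hnorm w hw1⟩)).le
  have hκn : ‖κ‖ ≤ 2 * ‖K₀‖ := by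
    have h1 := norm_add_le (κ - K₀) K₀
    rw [sub_add_cancel] at h1
    have := min_le_left 1 (θ / 2)
    nlinarith
  have hκθ : ‖κ - K₀‖ ≤ θ / 2 * ‖K₀‖ := hκd.trans (by gcongr; exact min_le_right _ _)
  have hD := hL ζ (by rw [sub_self, norm_zero]; positivity)
  have hcancel : ((ζ.im ^ (2 + α) : ℝ) : ℂ) * ((ζ.im ^ (-(2 + α)) : ℝ) : ℂ) = 1 := by
    rw [← Complex.ofReal_mul, ← Real.rpow_add hζ, add_neg_cancel, Real.rpow_zero,
      Complex.ofReal_one]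
  calc _ = ‖(b z - b w + deriv b ζ * (η * ζ.im : ℝ)) * κ -
        deriv b ζ * (η * ζ.im : ℝ) * (κ - K₀)‖ := by
        rw [hsc]
        congr 1
        linear_combination ((b z - b w) * κ) * hcancel
    _ ≤ (26 * L * η ^ 2 * ζ.im) * (2 * ‖K₀‖) + L * (η * ζ.im) * (θ / 2 * ‖K₀‖) := by
        refine (norm_sub_le _ _).trans (add_le_add ?_ ?_)
        · rw [norm_mul]; gcongr
        · rw [norm_mul, norm_mul, Complex.norm_real, Real.norm_eq_abs,
            abs_of_pos (mul_pos hη0 hζ)]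
          gcongr
    _ = L * η * ζ.im * ‖K₀‖ * (52 * η + θ / 2) := by ring
    _ ≤ _ := by gcongr; linarith

section

variable {α : ℝ} {𝒟₁ 𝒟₂ : Set (ℝ × ℝ)} {Wμ Vμ Wl Vl : ℂ → ℝ≥0∞}

lemma testBox_subset_hball {ζ : ℂ} {p η : ℝ} (hζ : 0 < ζ.im) (hp : |p| ≤ η) (hη : η ≤ 1 / 12) :
    testBox ζ p (η ^ 2) ⊆ hball ζ (8 * ζ.im) := fun _ hw =>
  mem_hball_of_norm_sub_le hζ (hζ.trans_le hw.2.1) (norm_sub_le_of_mem_testBox' hζ hp hη hw)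
    (by nlinarith)

lemma areaMeasure_testBox (hα : -1 < α) {ρ : ℝ} (hρ : 0 < ρ) : ∃ c : ℝ, 0 < c ∧
    ∀ (ζ : ℂ) (p : ℝ), 0 < ζ.im →
      areaMeasure α (testBox ζ p ρ) = ENNReal.ofReal (c * ζ.im ^ (2 + α)) :=
  ⟨_, whitneyConst_pos hα hρ hρ, fun _ _ hζ => areaMeasure_whitney hα _ hρ hρ hζ⟩

/-- On a neighbouring test square, the commutator of an indicator function is bounded below by the
derivative of the symbol. -/
lemma IsBergmanType.exists_norm_deriv_le {K : ℂ → ℂ → ℂ} (hK : IsBergmanType α K) (hα : -1 < α)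
    {θ : ℝ} (hθ : 0 < θ) : ∃ η k : ℝ, 0 < η ∧ η ≤ 1 / 12 ∧ 0 < k ∧ ∀ (b : ℂ → ℂ),
      DifferentiableOn ℂ b upperHalf → ∀ (ζ : ℂ) (L : ℝ), 0 < ζ.im → 0 ≤ L →
      (∀ u, ‖u - ζ‖ ≤ ζ.im / 2 → ‖deriv b u‖ ≤ L) → ∀ z ∈ testBox ζ 0 (η ^ 2), ∀ f : ℂ → ℂ,
      f =ᵐ[areaMeasure α] (testBox ζ η (η ^ 2)).indicator (fun _ => 1) →
      Integrable (fun w => K z w * f w) (areaMeasure α) →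
      Integrable (fun w => K z w * (b w * f w)) (areaMeasure α) →
      ‖deriv b ζ‖ * ζ.im ≤ k * ‖commutator b (integralOp α K) f z‖ + L * ζ.im * θ := by
  obtain ⟨η, hη, hη1, H⟩ := hK.exists_norm_sub_le hθ
  obtain ⟨c, hc, hcE⟩ := areaMeasure_testBox hα (pow_pos hη 2)
  set K₀ := K Complex.I Complex.I with hK₀
  have hK₀0 : 0 < ‖K₀‖ := norm_pos_iff.2 hK.ne_zero
  refine ⟨η, 1 / (c * η * ‖K₀‖), hη, hη1, by positivity,
    fun b hb ζ L hζ hL0 hL z hz f hf hi₁ hi₂ => ?_⟩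
  set E := testBox ζ η (η ^ 2) with hE
  set A := areaMeasure α with hA
  have hEm : MeasurableSet E := measurableSet_rect _ _ _ _
  set t := ζ.im ^ (2 + α) with ht
  have ht0 : 0 < t := by positivity
  have hAE : A E = ENNReal.ofReal (c * t) := hcE ζ η hζ
  have hAEr : A.real E = c * t := by
    rw [measureReal_def, hAE, ENNReal.toReal_ofReal (by positivity)]
  set D := deriv b ζ * (η * ζ.im : ℝ) * K₀ with hD
  have hX : (fun w => b z * (K z w * f w) - K z w * (b w * f w)) =ᵐ[A]
      E.indicator fun w => (b z - b w) * K z w := by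
    filter_upwards [hf] with w hw
    by_cases h : w ∈ E
    · rw [hw, indicator_of_mem h, indicator_of_mem h]; ring
    · rw [hw, indicator_of_notMem h, indicator_of_notMem h]; ring
  have hcomm : commutator b (integralOp α K) f z = ∫ w in E, (b z - b w) * K z w ∂A := by
    rw [commutator, integralOp, integralOp, ← integral_const_mul,
      ← integral_sub (hi₁.const_mul _) hi₂, integral_congr_ae hX, integral_indicator hEm]
  have hXi : IntegrableOn (fun w => (b z - b w) * K z w) E A := by
    rw [← integrable_indicator_iff hEm]
    exact ((hi₁.const_mul _).sub hi₂).congr hX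
  have h1 : ‖∫ w in E, ((t : ℂ) * ((b z - b w) * K z w) + D) ∂A‖ ≤
      L * η * ζ.im * ‖K₀‖ * θ * (c * t) := by
    rw [← hAEr]
    exact norm_setIntegral_le_of_norm_le_const (by rw [hAE]; exact ENNReal.ofReal_lt_top)
      fun w hw => H b hb ζ z w L hζ hL0 hL hz hw
  have h2 : ∫ w in E, ((t : ℂ) * ((b z - b w) * K z w) + D) ∂A =
      t * commutator b (integralOp α K) f z + (c * t : ℝ) * D := by
    rw [integral_add (hXi.const_mul _) (integrableOn_const (by rw [hAE]; exact ENNReal.ofReal_ne_top)),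
      integral_const_mul, ← hcomm, setIntegral_const, hAEr, Complex.real_smul]
  have h3 : ‖((c * t : ℝ) : ℂ) * D‖ = c * t * (‖deriv b ζ‖ * (η * ζ.im) * ‖K₀‖) := by
    rw [norm_mul, hD, norm_mul, norm_mul, Complex.norm_real, Complex.norm_real, Real.norm_eq_abs,
      Real.norm_eq_abs, abs_of_pos (mul_pos hc ht0), abs_of_pos (mul_pos hη hζ)]
  rw [h2] at h1
  have h4 := norm_sub_le (t * commutator b (integralOp α K) f z + (c * t : ℝ) * D)
    (t * commutator b (integralOp α K) f z)
  rw [add_sub_cancel_left, h3, norm_mul, Complex.norm_real, Real.norm_eq_abs,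
    abs_of_pos ht0] at h4
  have h5 := h4.trans (add_le_add_left h1 _)
  have h6 : 0 < c * t * η * ‖K₀‖ := by positivity
  refine le_of_mul_le_mul_left ?_ h6
  calc _ = c * t * (‖deriv b ζ‖ * (η * ζ.im) * ‖K₀‖) := by ring
    _ ≤ _ := h5
    _ = _ := by field_simp; ring

/-- Lower bound for the commutator, tested on normalized indicator functions. -/
lemma IsBergmanType.exists_test {K : ℂ → ℂ → ℂ} (hK : IsBergmanType α K) (hα : -1 < α)
    (h𝒟 : AreAdjacent 𝒟₁ 𝒟₂) (hμ : B2Pair α (𝒟₁ ∪ 𝒟₂) Wμ Vμ) (hl : B2Pair α (𝒟₁ ∪ 𝒟₂) Wl Vl)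
    {b : ℂ → ℂ} (hb : DifferentiableOn ℂ b upperHalf) {C₀ : ℝ≥0∞} (hC₀ : C₀ ≠ ⊤)
    (hbd : DerivBound α b (C₀ • (areaMeasure α).withDensity fun z => (Wμ z * Vl z) ^ (1 / 2 : ℝ)))
    (hint : ∀ f : Lp ℂ 2 ((areaMeasure α).withDensity Wμ), ∀ᵐ z ∂areaMeasure α,
      Integrable (fun w => K z w * f w) (areaMeasure α) ∧
      Integrable (fun w => K z w * (b w * f w)) (areaMeasure α))
    {S : Lp ℂ 2 ((areaMeasure α).withDensity Wμ) →L[ℂ] Lp ℂ 2 ((areaMeasure α).withDensity Wl)}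
    (hS : ∀ f : Lp ℂ 2 ((areaMeasure α).withDensity Wμ),
      S f =ᵐ[areaMeasure α] commutator b (integralOp α K) f) {ε : ℝ≥0∞} (hε : ε ≠ 0) :
    ∃ C : ℝ≥0∞, C ≠ ⊤ ∧ ∀ ζ : ℂ, 0 < ζ.im → ∃ f : Lp ℂ 2 ((areaMeasure α).withDensity Wμ),
      ‖f‖ = 1 ∧ (∀ᵐ w ∂(areaMeasure α).withDensity Wμ, f w ≠ 0 → ‖w - ζ‖ ≤ ζ.im / 2) ∧
      ‖deriv b ζ‖ₑ * ENNReal.ofReal (ζ.im ^ (3 + α)) ≤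
        (C * ‖S f‖ₑ + ε) * (areaMeasure α).withDensity (fun z => (Wμ z * Vl z) ^ (1 / 2 : ℝ))
          (hball ζ (8 * ζ.im)) := by
  have hν := hμ.geom hl.symm
  obtain ⟨C₁, hC₁, H₁⟩ := DerivBound.exists_ball_le hα h𝒟 hν hC₀ hbd
  obtain ⟨C₂, hC₂, H₂⟩ := exists_measure_hball_mul_le hα h𝒟 hμ hl
  obtain ⟨c₂, hc₂⟩ := exists_nnreal_sq hC₂
  -- The relative error θ is measured against the a priori derivative bound with constant C₁, so C₁θ
  -- ≤ ε makes it harmless.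
  obtain ⟨θ, hθ, hθε⟩ : ∃ θ : ℝ, 0 < θ ∧ C₁ * ENNReal.ofReal θ ≤ ε := by
    obtain ⟨r, hr, hr'⟩ := ENNReal.lt_iff_exists_nnreal_btwn.1
      (ENNReal.div_pos hε (show C₁ + 1 ≠ ⊤ by finiteness))
    refine ⟨r, by exact_mod_cast hr, ?_⟩
    rw [ENNReal.ofReal_coe_nnreal]
    calc _ ≤ (C₁ + 1) * (ε / (C₁ + 1)) := mul_le_mul' le_self_add hr'.le
      _ = ε := ENNReal.mul_div_cancel (by simp) (by finiteness)
  obtain ⟨η, k, hη, hη1, hk, H⟩ := hK.exists_norm_deriv_le hα hθ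
  obtain ⟨c, hc, hcE⟩ := areaMeasure_testBox hα (pow_pos hη 2)
  refine ⟨ENNReal.ofReal (k / c) * c₂, by finiteness, fun ζ hζ => ?_⟩
  set B := hball ζ (8 * ζ.im) with hB
  set n := (areaMeasure α).withDensity (fun z => (Wμ z * Vl z) ^ (1 / 2 : ℝ)) B with hn
  have hnt : n ≠ ⊤ := hν.measure_hball_ne_top hα h𝒟 hζ (by positivity)
  set E := testBox ζ η (η ^ 2) with hE
  set E' := testBox ζ 0 (η ^ 2) with hE'
  have hEB : E ⊆ B := testBox_subset_hball hζ (abs_of_pos hη).le hη1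
  have hEB' : E' ⊆ B := testBox_subset_hball hζ (by simpa using hη.le) hη1
  have hEm : MeasurableSet E := measurableSet_rect _ _ _ _
  have hEm' : MeasurableSet E' := measurableSet_rect _ _ _ _
  set t := ζ.im ^ (2 + α) with ht
  have ht0 : 0 < t := by positivity
  have hAE : (areaMeasure α) E = ENNReal.ofReal (c * t) := hcE ζ η hζ
  have hAE' : (areaMeasure α) E' = ENNReal.ofReal (c * t) := hcE ζ 0 hζ
  have hμE0 : (areaMeasure α).withDensity Wμ E ≠ 0 := hμ.measure_ne_zero (by
    rw [hAE]; exact (ENNReal.ofReal_pos.2 (by positivity)).ne')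
  have hμEt : (areaMeasure α).withDensity Wμ E ≠ ⊤ :=
    ne_top_of_le_ne_top (hμ.measure_hball_ne_top hα h𝒟 hζ (by positivity)) (measure_mono hEB)
  set g : Lp ℂ 2 ((areaMeasure α).withDensity Wμ) := indicatorConstLp 2 hEm hμEt 1 with hg
  have hgc : g =ᵐ[areaMeasure α] E.indicator fun _ => 1 :=
    hμ.absolutelyContinuous indicatorConstLp_coeFn
  have hgn : ‖g‖ₑ ^ 2 = (areaMeasure α).withDensity Wμ E := by
    rw [enorm_sq_eq_lintegral, lintegral_congr_ae
      ((indicatorConstLp_coeFn (p := 2) (hs := hEm) (hμs := hμEt) (c := (1 : ℂ))).mono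
        fun w hw => by rw [hw]), ← lintegral_indicator_one hEm]
    refine lintegral_congr fun w => ?_
    by_cases h : w ∈ E <;> simp [h]
  have hg0 : ‖g‖ ≠ 0 := fun h0 => hμE0 (by rw [← hgn, ← ofReal_norm, h0]; simp)
  have hgne : ‖g‖ₑ ≠ 0 := fun h0 => hμE0 (by rw [← hgn, h0]; simp)
  set f : Lp ℂ 2 ((areaMeasure α).withDensity Wμ) := ((‖g‖⁻¹ : ℝ) : ℂ) • g with hf
  have hSg : ‖S g‖ₑ = ‖S f‖ₑ * ‖g‖ₑ := by
    rw [hf, map_smul, enorm_smul, ← ofReal_norm ((‖g‖⁻¹ : ℝ) : ℂ), Complex.norm_real, norm_inv,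
      norm_norm, ENNReal.ofReal_inv_of_pos (lt_of_le_of_ne (norm_nonneg _) hg0.symm), ofReal_norm,
      mul_right_comm, ENNReal.inv_mul_cancel hgne enorm_ne_top, one_mul]
  refine ⟨f, ?_, ?_, ?_⟩
  · rw [hf, norm_smul, Complex.norm_real, norm_inv, norm_norm, inv_mul_cancel₀ hg0]
  · filter_upwards [Lp.coeFn_smul ((‖g‖⁻¹ : ℝ) : ℂ) g,
      indicatorConstLp_coeFn (p := 2) (hs := hEm) (hμs := hμEt) (c := (1 : ℂ))] with w h1 h2 h3
    have h4 : w ∈ E := by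
      by_contra h4
      rw [h1, Pi.smul_apply, h2, indicator_of_notMem h4, smul_zero] at h3
      exact h3 rfl
    refine (norm_sub_le_of_mem_testBox' hζ (abs_of_pos hη).le hη1 h4).trans ?_
    nlinarith
  -- Cauchy–Schwarz with λ and λ⁻¹ brings in the square root of μ(B)λ⁻¹(B), which is at most a
  -- constant times ν(B).
  have hI : ∫⁻ z in E', ‖S g z‖ₑ ∂(areaMeasure α) ≤ c₂ * ‖S f‖ₑ * n := by
    have hSm : AEMeasurable (fun z => ‖S g z‖ₑ) (areaMeasure α) :=
      (aestronglyMeasurable_coeFn hl.absolutelyContinuous (S g)).enorm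
    have h1 := sq_lintegral_mul_le_of_mul_eq_one hl.aem_left hl.aem_right hl.mul_eq
      (v := E'.indicator 1) (aemeasurable_one.indicator hEm') hSm
    have e1 : ∫⁻ z, E'.indicator 1 z * ‖S g z‖ₑ ∂(areaMeasure α) = ∫⁻ z in E', ‖S g z‖ₑ ∂(areaMeasure α) := by
      rw [← lintegral_indicator hEm']
      refine lintegral_congr fun w => ?_
      by_cases h : w ∈ E' <;> simp [h]
    have e2 : ∫⁻ z, E'.indicator 1 z ^ 2 * Vl z ∂(areaMeasure α) = (areaMeasure α).withDensity Vl E' := by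
      rw [withDensity_apply _ hEm', ← lintegral_indicator hEm']
      refine lintegral_congr fun w => ?_
      by_cases h : w ∈ E' <;> simp [h]
    rw [e1, e2, ← lintegral_withDensity_sq hl.aem_left hSm, ← enorm_sq_eq_lintegral, hSg, mul_pow,
      hgn] at h1
    refine (ENNReal.pow_le_pow_left_iff two_ne_zero).1 (h1.trans ?_)
    calc _ ≤ (areaMeasure α).withDensity Vl B * (‖S f‖ₑ ^ 2 * (areaMeasure α).withDensity Wμ B) := by gcongr
      _ = ‖S f‖ₑ ^ 2 * ((areaMeasure α).withDensity Wμ B * (areaMeasure α).withDensity Vl B) := by ring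
      _ ≤ ‖S f‖ₑ ^ 2 * (C₂ * n ^ 2) := mul_le_mul_right (H₂ ζ hζ) _
      _ = _ := by rw [← hc₂]; ring
  set L := (C₁ * n).toReal * (ζ.im ^ (3 + α))⁻¹ with hL
  have hL0 : 0 ≤ L := by positivity
  have hLb : ∀ u, ‖u - ζ‖ ≤ ζ.im / 2 → ‖deriv b u‖ ≤ L := fun u hu => by
    have h1 := ENNReal.toReal_mono (by finiteness) (H₁ ζ u hζ hu)
    rw [ENNReal.toReal_mul, ENNReal.toReal_ofReal (by positivity), toReal_enorm] at h1
    rwa [hL, ← div_eq_mul_inv, le_div_iff₀ (by positivity)]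
  have hpt : ∀ᵐ z ∂(areaMeasure α).restrict E', ‖deriv b ζ‖ₑ * ENNReal.ofReal ζ.im ≤
      ENNReal.ofReal k * ‖S g z‖ₑ + ENNReal.ofReal (L * ζ.im * θ) := by
    filter_upwards [ae_restrict_mem hEm', ae_restrict_of_ae (hint g), ae_restrict_of_ae (hS g)]
      with z hz hi hSz
    have h1 := H b hb ζ L hζ hL0 hLb z hz g hgc hi.1 hi.2
    rw [← hSz] at h1
    have h2 := ENNReal.ofReal_le_ofReal h1
    rwa [ENNReal.ofReal_mul (norm_nonneg _), ENNReal.ofReal_add (by positivity) (by positivity),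
      ENNReal.ofReal_mul hk.le, ofReal_norm, ofReal_norm] at h2
  have h1 := lintegral_mono_ae hpt
  rw [lintegral_const, lintegral_add_right _ measurable_const, lintegral_const,
    lintegral_const_mul' _ _ ENNReal.ofReal_ne_top, Measure.restrict_apply_univ, hAE'] at h1
  have h2 : ENNReal.ofReal (ζ.im ^ (3 + α)) =
      ENNReal.ofReal ζ.im * ENNReal.ofReal (c * t) * ENNReal.ofReal c⁻¹ := by
    rw [← ENNReal.ofReal_mul hζ.le, ← ENNReal.ofReal_mul (by positivity), ht,
      show 3 + α = 1 + (2 + α) by ring, Real.rpow_add hζ, Real.rpow_one]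
    congr 1
    field_simp
  have h3 : ENNReal.ofReal (L * ζ.im * θ) * ENNReal.ofReal (c * t) * ENNReal.ofReal c⁻¹ =
      C₁ * ENNReal.ofReal θ * n := by
    rw [← ENNReal.ofReal_mul (by positivity), ← ENNReal.ofReal_mul (by positivity)]
    have : L * ζ.im * θ * (c * t) * c⁻¹ = (C₁ * n).toReal * θ := by
      rw [hL, ht, show 3 + α = 1 + (2 + α) by ring, Real.rpow_add hζ, Real.rpow_one]
      field_simp
    rw [this, ENNReal.ofReal_mul (by positivity), ENNReal.ofReal_toReal (by finiteness)]
    ring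
  calc _ = ‖deriv b ζ‖ₑ * ENNReal.ofReal ζ.im * ENNReal.ofReal (c * t) * ENNReal.ofReal c⁻¹ := by
        rw [h2]; ring
    _ ≤ (ENNReal.ofReal k * ∫⁻ z in E', ‖S g z‖ₑ ∂(areaMeasure α) +
          ENNReal.ofReal (L * ζ.im * θ) * ENNReal.ofReal (c * t)) * ENNReal.ofReal c⁻¹ :=
        mul_le_mul_left h1 _
    _ = ENNReal.ofReal (k / c) * ∫⁻ z in E', ‖S g z‖ₑ ∂(areaMeasure α) + C₁ * ENNReal.ofReal θ * n := by
        rw [add_mul, h3, div_eq_mul_inv k, ENNReal.ofReal_mul hk.le]; ring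
    _ ≤ ENNReal.ofReal (k / c) * (c₂ * ‖S f‖ₑ * n) + ε * n := by gcongr
    _ = _ := by ring

end

/-! ### Necessity: compactness forces the derivative to vanish -/

/-- A compact operator is not bounded below on an orthonormal sequence. -/
lemma not_forall_le_norm_of_orthonormal {H H' : Type*} [NormedAddCommGroup H]
    [InnerProductSpace ℂ H] [CompleteSpace H] [NormedAddCommGroup H'] [InnerProductSpace ℂ H']
    [CompleteSpace H'] {S : H →L[ℂ] H'} (hS : IsCompactOperator S) {f : ℕ → H}
    (hf : Orthonormal ℂ f) {δ : ℝ} (hδ : 0 < δ) : ¬ ∀ n, δ ≤ ‖S (f n)‖ := fun hle => by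
  have hK := hS.isCompact_closure_image_closedBall (f := (S : H →ₗ[ℂ] H')) 1
  obtain ⟨y, -, φ, hφ, hlim⟩ := hK.tendsto_subseq (x := fun n => S (f n))
    fun n => subset_closure ⟨f n, by simp [hf.1 n], rfl⟩
  -- A limit point y of the images pairs with them to ‖y‖² in the limit; by Bessel for S*y the
  -- pairings also tend to 0. Hence y = 0, against the lower bound on the norms.
  have h1 : Tendsto (fun n => inner ℂ (S (f (φ n))) y) atTop (nhds (inner ℂ y y)) :=
    hlim.inner tendsto_const_nhds
  have h2 : Tendsto (fun n => inner ℂ (S (f (φ n))) y) atTop (nhds 0) := by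
    have h3 := (hf.inner_products_summable (S.adjoint y)).tendsto_atTop_zero.comp hφ.tendsto_atTop
    rw [tendsto_zero_iff_norm_tendsto_zero]
    have h4 := h3.sqrt
    simpa [Function.comp_def, ContinuousLinearMap.adjoint_inner_right] using h4
  have h3 : y = 0 := inner_self_eq_zero.1 (tendsto_nhds_unique h1 h2)
  have h4 : Tendsto (fun n => ‖S (f (φ n))‖) atTop (nhds ‖y‖) := hlim.norm
  rw [h3, norm_zero] at h4
  exact hδ.not_ge (ge_of_tendsto' h4 fun n => hle _)

lemma inner_eq_zero_of_ae {m : Measure ℂ} {f g : Lp ℂ 2 m} (h : ∀ᵐ w ∂m, f w = 0 ∨ g w = 0) :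
    inner ℂ f g = 0 := by
  rw [L2.inner_def]
  refine integral_eq_zero_of_ae (h.mono fun w hw => ?_)
  rcases hw with hw | hw <;> simp [hw]

/-- Small discs around points close to the boundary avoid finitely many given discs. -/
lemma exists_deepPart_disjoint (s : Finset ℂ) (hs : ∀ ζ ∈ s, 0 < ζ.im) :
    ∃ R : ℝ, 0 < R ∧ ∀ ζ ∈ s, ∀ ξ : ℂ, 0 < ξ.im → ξ ∉ deepPart R → ∀ w : ℂ,
      ‖w - ζ‖ ≤ ζ.im / 2 → ¬ ‖w - ξ‖ ≤ ξ.im / 2 := by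
  -- The sum exceeds 2/Im ζ and 2|ζ| for every ζ in s. If the disc at ξ meets the disc at ζ, then Im
  -- ξ ≥ Im ζ/3 and |ξ| ≤ 3|ζ|, which places ξ in the deep part.
  set R' : ℝ := 1 + ∑ ζ ∈ s, (2 / |ζ.im| + 2 * ‖ζ‖) with hR'
  have hnn : ∀ ζ ∈ s, 0 ≤ 2 / |ζ.im| + 2 * ‖ζ‖ := fun ζ _ => by positivity
  have hR0 : 0 < R' := by linarith [Finset.sum_nonneg hnn]
  refine ⟨2 * R', by positivity, fun ζ hζ ξ hξ hdeep w hw hw' => hdeep ?_⟩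
  have h1 := Finset.single_le_sum hnn hζ
  have hζ0 := hs ζ hζ
  rw [abs_of_pos hζ0] at h1
  have h2 := (Complex.abs_im_le_norm _).trans hw
  have h3 := (Complex.abs_im_le_norm _).trans hw'
  rw [Complex.sub_im, abs_le] at h2 h3
  have hζn : ζ.im ≤ ‖ζ‖ := (le_abs_self _).trans (Complex.abs_im_le_norm _)
  have hξn : ξ.im ≤ ‖ξ‖ := (le_abs_self _).trans (Complex.abs_im_le_norm _)
  have h4 : 2 / ζ.im ≤ R' := by linarith [norm_nonneg ζ]
  have h5 : 2 * ‖ζ‖ ≤ R' := by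
    have : 0 < 2 / ζ.im := by positivity
    linarith
  rw [div_le_iff₀ hζ0] at h4
  constructor
  · rw [inv_le_iff_one_le_mul₀ (by positivity)]
    nlinarith
  · have h6 := norm_sub_norm_le w ζ
    have h7 := norm_sub_norm_le ξ w
    rw [norm_sub_rev] at h7
    linarith

section

variable {α : ℝ} {𝒟₁ 𝒟₂ : Set (ℝ × ℝ)} {Wμ Vμ Wl Vl : ℂ → ℝ≥0∞}

/-- If the commutator is compact, the derivative of the symbol vanishes at the boundary. -/
theorem IsBergmanType.derivVanish {K : ℂ → ℂ → ℂ} (hK : IsBergmanType α K) (hα : -1 < α)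
    (h𝒟 : AreAdjacent 𝒟₁ 𝒟₂) (hμ : B2Pair α (𝒟₁ ∪ 𝒟₂) Wμ Vμ) (hl : B2Pair α (𝒟₁ ∪ 𝒟₂) Wl Vl)
    {b : ℂ → ℂ} (hb : DifferentiableOn ℂ b upperHalf) {C₀ : ℝ≥0∞} (hC₀ : C₀ ≠ ⊤)
    (hbd : DerivBound α b (C₀ • (areaMeasure α).withDensity fun z => (Wμ z * Vl z) ^ (1 / 2 : ℝ)))
    (hint : ∀ f : Lp ℂ 2 ((areaMeasure α).withDensity Wμ), ∀ᵐ z ∂areaMeasure α,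
      Integrable (fun w => K z w * f w) (areaMeasure α) ∧
      Integrable (fun w => K z w * (b w * f w)) (areaMeasure α))
    {S : Lp ℂ 2 ((areaMeasure α).withDensity Wμ) →L[ℂ] Lp ℂ 2 ((areaMeasure α).withDensity Wl)}
    (hSc : IsCompactOperator S) (hS : ∀ f : Lp ℂ 2 ((areaMeasure α).withDensity Wμ),
      S f =ᵐ[areaMeasure α] commutator b (integralOp α K) f) :
    DerivVanish α b ((areaMeasure α).withDensity fun z => (Wμ z * Vl z) ^ (1 / 2 : ℝ)) := by
  intro ε hε
  set n := (areaMeasure α).withDensity fun z => (Wμ z * Vl z) ^ (1 / 2 : ℝ) with hn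
  -- Half of ε is spent on the error of the test inequality and half remains for ‖S f‖; the minimum
  -- with 1 covers ε = ⊤.
  set ε' := min ε 1 / 2 with hε'
  have hε'0 : ε' ≠ 0 := (ENNReal.div_pos (by simp [hε]) (by finiteness)).ne'
  have hε't : ε' ≠ ⊤ := ENNReal.div_ne_top (ne_top_of_le_ne_top ENNReal.one_ne_top (min_le_right _ _))
    two_ne_zero
  have hεε : ε' + ε' ≤ ε := by rw [ENNReal.add_halves]; exact min_le_left _ _
  obtain ⟨C, hC, H⟩ := hK.exists_test hα h𝒟 hμ hl hb hC₀ hbd hint hS hε'0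
  set δ := (ε' / (C + 1)).toReal with hδ
  have hδt : ε' / (C + 1) ≠ ⊤ := ENNReal.div_ne_top hε't (by simp)
  have hδ0 : 0 < δ :=
    ENNReal.toReal_pos (ENNReal.div_pos hε'0 (by finiteness)).ne' hδt
  by_contra! hcon
  -- Points whose normalised test function is not sent to a small vector. Failure of the conclusion
  -- supplies such points outside every deep part, hence with discs avoiding any finite family
  -- already chosen.
  set P : ℂ → Prop := fun ζ => 0 < ζ.im ∧ ∃ f : Lp ℂ 2 ((areaMeasure α).withDensity Wμ), ‖f‖ = 1 ∧
    (∀ᵐ w ∂(areaMeasure α).withDensity Wμ, f w ≠ 0 → ‖w - ζ‖ ≤ ζ.im / 2) ∧ δ ≤ ‖S f‖ with hP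
  have hexists : ∀ s : Finset ℂ, (∀ ζ ∈ s, P ζ) → ∃ ξ, P ξ ∧ ∀ ζ ∈ s, ∀ w : ℂ,
      ‖w - ζ‖ ≤ ζ.im / 2 → ¬ ‖w - ξ‖ ≤ ξ.im / 2 := fun s hs => by
    obtain ⟨R, hR, hdis⟩ := exists_deepPart_disjoint s fun ζ hζ => (hs ζ hζ).1
    obtain ⟨ξ, hξ, hξR, hlt⟩ := hcon R hR
    obtain ⟨f, hf1, hf2, hf3⟩ := H ξ hξ
    refine ⟨ξ, ⟨hξ, f, hf1, hf2, ?_⟩, fun ζ hζ => hdis ζ hζ ξ hξ hξR⟩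
    have h1 : ε < C * ‖S f‖ₑ + ε' := lt_of_mul_lt_mul_right' (hlt.trans_le hf3)
    have h2 : ε' < C * ‖S f‖ₑ := lt_of_add_lt_add_right (hεε.trans_lt h1)
    have h3 : ε' / (C + 1) ≤ ‖S f‖ₑ := by
      refine ENNReal.div_le_of_le_mul' (h2.le.trans ?_)
      gcongr
      exact le_self_add
    rw [hδ, ← toReal_enorm]
    exact ENNReal.toReal_mono enorm_ne_top h3
  obtain ⟨ζ, hζP, hζd⟩ := exists_seq_of_forall_finset_exists P _ hexists
  choose hζ f hf1 hf2 hf3 using hζP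
  refine not_forall_le_norm_of_orthonormal hSc (f := f) ⟨hf1, fun i j hij => ?_⟩ hδ0 hf3
  refine inner_eq_zero_of_ae ?_
  filter_upwards [hf2 i, hf2 j] with w hi hj
  by_contra! hne
  rcases lt_or_gt_of_ne hij with h | h
  · exact hζd i j h w (hi hne.1) (hj hne.2)
  · exact hζd j i h w (hj hne.2) (hi hne.1)

end

/-! ### The two kernels -/

lemma sub_conj_ne_zero {z w : ℂ} (hz : 0 < z.im) (hw : 0 < w.im) : z - conj w ≠ 0 :=
  norm_pos_iff.1 (norm_sub_conj_pos hz hw)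

lemma add_mul_sub_conj (x y : ℝ) (z w : ℂ) :
    (x + y * z) - conj (x + y * w : ℂ) = y * (z - conj w) := by
  simp only [map_add, map_mul, Complex.conj_ofReal]
  ring

lemma continuousAt_sub_conj_I :
    ContinuousAt (fun p : ℂ × ℂ => p.1 - conj p.2) (Complex.I, Complex.I) := by
  have : Continuous fun p : ℂ × ℂ => conj p.2 := Complex.continuous_conj.comp continuous_snd
  fun_prop

lemma I_sub_conj_I : Complex.I - conj Complex.I = 2 * Complex.I := by
  rw [Complex.conj_I]; ring

lemma two_mul_I_mem_slitPlane : 2 * Complex.I ∈ Complex.slitPlane := by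
  right; simp

/-- A positive real factor does not change the argument, so the principal branch is multiplicative
here. -/
lemma ofReal_mul_cpow {y : ℝ} (hy : 0 < y) {z : ℂ} (hz : z ≠ 0) (s : ℂ) :
    (y * z) ^ s = (y : ℂ) ^ s * z ^ s := by
  have hy' : (y : ℂ) ≠ 0 := by exact_mod_cast hy.ne'
  rw [Complex.cpow_def_of_ne_zero (mul_ne_zero hy' hz), Complex.cpow_def_of_ne_zero hy',
    Complex.cpow_def_of_ne_zero hz, Complex.log_ofReal_mul hy hz, ← Complex.exp_add,
    Complex.ofReal_log hy.le, add_mul]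

lemma isBergmanType_bergmanKernel (α : ℝ) : IsBergmanType α (bergmanKernel α) where
  measurable := by
    unfold bergmanKernel
    have : Measurable fun p : ℂ × ℂ => conj p.2 :=
      Complex.continuous_conj.measurable.comp measurable_snd
    exact measurable_const.div ((measurable_fst.sub this).pow_const _)
  enorm_le z w hz hw := by
    have h0 := norm_sub_conj_pos hz hw
    rw [← ofReal_norm, kerP, bergmanKernel, norm_div]
    refine ENNReal.ofReal_le_ofReal (le_of_eq ?_)
    have e : (2 + α : ℂ) = ((2 + α : ℝ) : ℂ) := by push_cast; rfl
    rw [e, Complex.norm_cpow_real, Complex.norm_cpow_real, Complex.norm_I, Real.one_rpow,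
      Real.rpow_neg h0.le, one_div]
  scale x y z w hy hz hw := by
    have e : (2 + α : ℂ) = ((2 + α : ℝ) : ℂ) := by push_cast; rfl
    rw [bergmanKernel, bergmanKernel, add_mul_sub_conj,
      ofReal_mul_cpow hy (sub_conj_ne_zero hz hw)]
    rw [e, ← Complex.ofReal_cpow hy.le, Real.rpow_neg hy.le, Complex.ofReal_inv, div_mul_eq_div_div,
      div_eq_mul_inv, div_eq_mul_inv, div_eq_mul_inv]
    ring
  continuousAt := by
    unfold bergmanKernel
    have h : Complex.I - conj Complex.I ∈ Complex.slitPlane := by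
      rw [I_sub_conj_I]; exact two_mul_I_mem_slitPlane
    refine continuousAt_const.div (continuousAt_sub_conj_I.cpow continuousAt_const h) ?_
    exact (Complex.cpow_ne_zero_iff).2 (.inl (sub_conj_ne_zero (by simp) (by simp)))
  ne_zero := by
    unfold bergmanKernel
    refine div_ne_zero ((Complex.cpow_ne_zero_iff).2 (.inl Complex.I_ne_zero))
      ((Complex.cpow_ne_zero_iff).2 (.inl (sub_conj_ne_zero (by simp) (by simp))))

lemma isBergmanType_berezinKernel (α : ℝ) : IsBergmanType α (berezinKernel α) where
  measurable := by
    unfold berezinKernel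
    have : Measurable fun p : ℂ × ℂ => conj p.2 :=
      Complex.continuous_conj.measurable.comp measurable_snd
    exact Complex.measurable_ofReal.comp
      (measurable_const.div ((measurable_fst.sub this).norm.pow_const _))
  enorm_le z w hz hw := by
    have h0 := norm_sub_conj_pos hz hw
    rw [← ofReal_norm, kerP, berezinKernel, Complex.norm_real]
    refine ENNReal.ofReal_le_ofReal (le_of_eq ?_)
    rw [Real.norm_eq_abs, abs_of_pos (by positivity), Real.rpow_neg h0.le, one_div]
  scale x y z w hy hz hw := by
    rw [berezinKernel, berezinKernel, add_mul_sub_conj, norm_mul, Complex.norm_real,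
      Real.norm_eq_abs, abs_of_pos hy, Real.mul_rpow hy.le (norm_nonneg _), ← Complex.ofReal_mul,
      Real.rpow_neg hy.le]
    congr 1
    rw [one_div, one_div, mul_inv]
  continuousAt := by
    unfold berezinKernel
    have h0 : ‖Complex.I - conj Complex.I‖ ≠ 0 :=
      norm_ne_zero_iff.2 (sub_conj_ne_zero (by simp) (by simp))
    refine Complex.continuous_ofReal.continuousAt.comp
      (continuousAt_const.div (continuousAt_sub_conj_I.norm.rpow_const (.inl h0)) ?_)
    have : 0 < ‖Complex.I - conj Complex.I‖ := lt_of_le_of_ne (norm_nonneg _) h0.symm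
    positivity
  ne_zero := by
    have h0 : 0 < ‖Complex.I - conj Complex.I‖ := norm_sub_conj_pos (by simp) (by simp)
    unfold berezinKernel
    rw [Ne, Complex.ofReal_eq_zero]
    positivity

/-! ### Weights -/

section

variable {α : ℝ} {𝒟 𝒟₁ 𝒟₂ : Set (ℝ × ℝ)}

lemma MemB2.b2Pair {w : ℂ → ℝ} (hα : -1 < α) (hlt : ∀ I ∈ 𝒟, I.1 < I.2) (h : MemB2 α 𝒟 w) :
    B2Pair α 𝒟 (fun z => ENNReal.ofReal (w z)) fun z => ENNReal.ofReal (w z)⁻¹ where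
  aem_left := h.1.aemeasurable.ennreal_ofReal
  aem_right := h.1.aemeasurable.inv.ennreal_ofReal
  mul_eq := h.1.pos.mono fun z hz => by
    rw [← ENNReal.ofReal_mul hz.le, mul_inv_cancel₀ hz.ne', ENNReal.ofReal_one]
  bound := by
    refine ⟨b2Const α 𝒟 w, h.2.ne, fun I hI => ?_⟩
    have h1 := le_iSup₂ (f := fun I (_ : I ∈ 𝒟) =>
      (⨍⁻ z in carlesonBox I, ENNReal.ofReal (w z) ∂areaMeasure α) *
        (⨍⁻ z in carlesonBox I, ENNReal.ofReal ((w z)⁻¹) ∂areaMeasure α)) I hI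
    have hA := areaMeasure_carlesonBox hα (hlt I hI)
    have hpos : areaMeasure α (carlesonBox I) ≠ 0 := by
      have := boxConst_pos α
      have h0 : 0 < I.2 - I.1 := by linarith [hlt I hI]
      rw [hA]; exact (ENNReal.ofReal_pos.2 (by positivity)).ne'
    have htop : areaMeasure α (carlesonBox I) ≠ ⊤ := by rw [hA]; exact ENNReal.ofReal_ne_top
    have e : ∀ g : ℂ → ℝ≥0∞, ∫⁻ z in carlesonBox I, g z ∂areaMeasure α =
        (⨍⁻ z in carlesonBox I, g z ∂areaMeasure α) * areaMeasure α (carlesonBox I) := fun g => by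
      rw [setLAverage_eq, ENNReal.div_mul_cancel hpos htop]
    rw [e, e]
    calc _ = (⨍⁻ z in carlesonBox I, ENNReal.ofReal (w z) ∂areaMeasure α) *
          (⨍⁻ z in carlesonBox I, ENNReal.ofReal ((w z)⁻¹) ∂areaMeasure α) *
          areaMeasure α (carlesonBox I) ^ 2 := by ring
      _ ≤ _ := mul_le_mul_left h1 _

lemma B2Pair.congr_left {W W' V : ℂ → ℝ≥0∞} (h : B2Pair α 𝒟 W V) (hW : W =ᵐ[areaMeasure α] W') :
    B2Pair α 𝒟 W' V where
  aem_left := h.aem_left.congr hW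
  aem_right := h.aem_right
  mul_eq := by filter_upwards [h.mul_eq, hW] with z h1 h2; rw [← h2, h1]
  bound := by
    obtain ⟨K, hK, hb⟩ := h.bound
    refine ⟨K, hK, fun I hI => ?_⟩
    rw [← lintegral_congr_ae (ae_restrict_of_ae hW)]
    exact hb I hI

/-- The weights are first identified: the geometric mean of μ and λ⁻¹ agrees almost everywhere with
ν, so ν inherits the B₂ condition. Both directions then go through `DerivVanish` for ν. -/
theorem isCompactCommutator_iff_memVMOA (hα : -1 < α) (h𝒟 : AreAdjacent 𝒟₁ 𝒟₂) {μ lam : ℂ → ℝ}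
    (hμ : MemB2 α (𝒟₁ ∪ 𝒟₂) μ) (hlam : MemB2 α (𝒟₁ ∪ 𝒟₂) lam) {b : ℂ → ℂ}
    (hb : MemBMOA α (𝒟₁ ∪ 𝒟₂) (fun z => μ z ^ (1 / 2 : ℝ) * lam z ^ (-(1 / 2) : ℝ)) b)
    {K : ℂ → ℂ → ℂ} (hK : IsBergmanType α K) :
    IsCompactCommutator α μ lam b K ↔
      MemVMOA α (𝒟₁ ∪ 𝒟₂) (fun z => μ z ^ (1 / 2 : ℝ) * lam z ^ (-(1 / 2) : ℝ)) b := by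
  set ν : ℂ → ℝ := fun z => μ z ^ (1 / 2 : ℝ) * lam z ^ (-(1 / 2) : ℝ) with hν
  have hpμ := hμ.b2Pair hα fun _ => h𝒟.lt
  have hpl := hlam.b2Pair hα fun _ => h𝒟.lt
  have hgeom := hpμ.geom hpl.symm
  have heq : (fun z => (ENNReal.ofReal (μ z) * ENNReal.ofReal (lam z)⁻¹) ^ (1 / 2 : ℝ))
      =ᵐ[areaMeasure α] fun z => ENNReal.ofReal (ν z) := by
    filter_upwards [hμ.1.pos, hlam.1.pos] with z h1 h2
    rw [← ENNReal.ofReal_mul h1.le, ENNReal.ofReal_rpow_of_nonneg (by positivity) (by norm_num),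
      Real.mul_rpow h1.le (by positivity), Real.inv_rpow h2.le, ← Real.rpow_neg h2.le]
  have hpν := hgeom.congr_left heq
  have hmeas : (areaMeasure α).withDensity
      (fun z => (ENNReal.ofReal (μ z) * ENNReal.ofReal (lam z)⁻¹) ^ (1 / 2 : ℝ)) =
      weightedMeasure α ν := withDensity_congr_ae heq
  obtain ⟨C₀, hC₀, hbd⟩ := hb.exists_derivBound hpν hα h𝒟
  constructor
  · rintro ⟨hint, S, hSc, hS⟩
    have hv := hK.derivVanish hα h𝒟 hpμ hpl hb.2 hC₀ (by rw [hmeas]; exact hbd) hint hSc hS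
    rw [hmeas] at hv
    exact hv.memVMOA hpν hα h𝒟 hb
  · intro hvmo
    have hv := hvmo.derivVanish hpν hα h𝒟
    refine DerivVanish.isCompactOperator hα h𝒟 hpμ hpl hpν ?_ hK.measurable hK.enorm_le hb.2 hC₀
      hbd hv
    filter_upwards [heq, hpl.mul_eq] with z h1 h2
    rw [← h1, sq_rpow_half, mul_assoc, mul_comm (ENNReal.ofReal (lam z)⁻¹), h2, mul_one]

end

end BergmanCommutator

end

open BergmanCommutator in
theorem theorem1p2 (α : ℝ) (hα : -1 < α)
    (𝒟₁ 𝒟₂ : Set (ℝ × ℝ)) (h𝒟 : AreAdjacent 𝒟₁ 𝒟₂)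
    (μ lam : ℂ → ℝ) (hμ : MemB2 α (𝒟₁ ∪ 𝒟₂) μ) (hlam : MemB2 α (𝒟₁ ∪ 𝒟₂) lam)
    (ν : ℂ → ℝ) (hν : ν = fun z => μ z ^ (1 / 2 : ℝ) * lam z ^ (-(1 / 2) : ℝ))
    (b : ℂ → ℂ) (hb : MemBMOA α (𝒟₁ ∪ 𝒟₂) ν b) :
    (IsCompactCommutator α μ lam b (bergmanKernel α) ↔ MemVMOA α (𝒟₁ ∪ 𝒟₂) ν b) ∧
    (IsCompactCommutator α μ lam b (berezinKernel α) ↔ MemVMOA α (𝒟₁ ∪ 𝒟₂) ν b) := by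
  subst hν
  exact ⟨isCompactCommutator_iff_memVMOA hα h𝒟 hμ hlam hb (isBergmanType_bergmanKernel α),
    isCompactCommutator_iff_memVMOA hα h𝒟 hμ hlam hb (isBergmanType_berezinKernel α)⟩
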